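/- Let $n\ge 2$ and let $(N,g)$ be a closed (compact, without boundary), connected, smooth Riemannian manifold of dimension $n+1$ with positive Ricci curvature, i.e. $\mathrm{Ric}_x(v,v)>0$ for every $x\in N$ and $0\neq v\in T_xN$. Let $W:\mathbb R\to[0,\infty)$ be a $C^2$ double well potential with $W(t)=0$ if and only if $t=\pm1$, with $W''(\pm1)>0$, and of quadratic growth in the sense that $W''$ is bounded on $\mathbb R$. Put $\sigma=\int_{-1}^{1}\sqrt{W(t)/2}\,dt$. For $\varepsilon>0$ and $\mu\in\mathbb R$ consider on $W^{1,2}(N)$ the functional $$F_{\varepsilon,\mu}(u)=\frac1{2\sigma}\int_N\Big(\varepsilon\frac{|\nabla u|^2}{2}+\frac{W(u)}{\varepsilon}\Big)\,d\mathrm{vol}_g-\frac{\mu}{2\sigma}\int_N u\,d\mathrm{vol}_g .$$ Let $u\in W^{1,2}(N)$ be a stable critical point of $F_{\varepsilon,\mu}$, that is, for every $\varphi\in W^{1,2}(N)$, $$\frac{d}{dt}\Big|_{t=0}F_{\varepsilon,\mu}(u+t\varphi)=0\qquad\text{and}\qquad \frac{d^2}{dt^2}\Big|_{t=0}F_{\varepsilon,\mu}(u+t\varphi)\ge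 0 .$$ Then $u$ is constant (almost everywhere on $N$). -/

import Mathlib

open scoped Manifold ContDiff
open MeasureTheory

noncomputable section

namespace AllenCahn

/-- A smooth Riemannian metric on the tangent bundle of a smooth `m`-dimensional manifold `N`. -/
abbrev Metric (m : ℕ) (N : Type*) [TopologicalSpace N]
    [ChartedSpace (EuclideanSpace ℝ (Fin m)) N] [IsManifold (𝓡 m) ∞ N] :=
  Bundle.ContMDiffRiemannianMetric (𝓡 m) ∞ (EuclideanSpace ℝ (Fin m))
    (fun x : N => TangentSpace (𝓡 m) x)

section Coordinates

variable {m : ℕ} {N : Type*} [TopologicalSpace N]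
  [ChartedSpace (EuclideanSpace ℝ (Fin m)) N] [IsManifold (𝓡 m) ∞ N]

/-- The domain in `ℝᵐ` of the coordinates given by the preferred chart around `p`. -/
def coordDomain (m : ℕ) {N : Type*} [TopologicalSpace N]
    [ChartedSpace (EuclideanSpace ℝ (Fin m)) N] (p : N) : Set (EuclideanSpace ℝ (Fin m)) :=
  (extChartAt (𝓡 m) p).target

/-- The local parametrization of `N`, i.e. the inverse of the preferred chart around `p`. -/
def param (m : ℕ) {N : Type*} [TopologicalSpace N]
    [ChartedSpace (EuclideanSpace ℝ (Fin m)) N] (p : N) : EuclideanSpace ℝ (Fin m) → N :=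
  (extChartAt (𝓡 m) p).symm

/-- The coordinate vector field `∂ᵢ` of the chart around `p`, at the point with coordinates `y`. -/
def coordVec (m : ℕ) {N : Type*} [TopologicalSpace N]
    [ChartedSpace (EuclideanSpace ℝ (Fin m)) N] (p : N) (y : EuclideanSpace ℝ (Fin m))
    (i : Fin m) : TangentSpace (𝓡 m) (param m p y) :=
  mfderiv 𝓘(ℝ, EuclideanSpace ℝ (Fin m)) (𝓡 m) (param m p) y (EuclideanSpace.single i (1 : ℝ))

/-- The `i`-th partial derivative of a function on `ℝᵐ`. -/
def pd (i : Fin m) (f : EuclideanSpace ℝ (Fin m) → ℝ) (y : EuclideanSpace ℝ (Fin m)) : ℝ :=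
  fderiv ℝ f y (EuclideanSpace.single i (1 : ℝ))

/-- The matrix `gᵢⱼ = g(∂ᵢ, ∂ⱼ)` in the chart around `p`. -/
def gram (g : Metric m N) (p : N) (y : EuclideanSpace ℝ (Fin m)) : Matrix (Fin m) (Fin m) ℝ :=
  Matrix.of fun i j => g.inner (param m p y) (coordVec m p y i) (coordVec m p y j)

/-- The Christoffel symbols
`Γᵏᵢⱼ = ½ ∑ₗ gᵏˡ (∂ᵢ gⱼₗ + ∂ⱼ gᵢₗ - ∂ₗ gᵢⱼ)` of the Levi-Civita connection. -/
def christoffel (g : Metric m N) (p : N) (k i j : Fin m) (y : EuclideanSpace ℝ (Fin m)) : ℝ :=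
  (1 / 2) * ∑ l, (gram g p y)⁻¹ k l *
    (pd i (fun z => gram g p z j l) y + pd j (fun z => gram g p z i l) y
      - pd l (fun z => gram g p z i j) y)

/-- The Ricci tensor in coordinates:
`Rᵢⱼ = ∑ₖ (∂ₖ Γᵏᵢⱼ - ∂ⱼ Γᵏᵢₖ) + ∑ₖₗ (Γᵏₖₗ Γˡᵢⱼ - Γᵏⱼₗ Γˡᵢₖ)`. -/
def ricci (g : Metric m N) (p : N) (y : EuclideanSpace ℝ (Fin m)) (i j : Fin m) : ℝ :=
  ∑ k, (pd k (christoffel g p k i j) y - pd j (christoffel g p k i k) y)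
    + ∑ k, ∑ l, (christoffel g p k k l y * christoffel g p l i j y
        - christoffel g p k j l y * christoffel g p l i k y)

/-- Positive Ricci curvature: the Ricci tensor is positive definite at every point
(expressed in the coordinates of the charts of `N`). -/
def PositiveRicci (g : Metric m N) : Prop :=
  ∀ p : N, ∀ y ∈ coordDomain m p, ∀ v : Fin m → ℝ, v ≠ 0 →
    0 < ∑ i, ∑ j, ricci g p y i j * v i * v j

end Coordinates

section Sobolev

variable {m : ℕ} {N : Type*} [TopologicalSpace N]
  [ChartedSpace (EuclideanSpace ℝ (Fin m)) N] [IsManifold (𝓡 m) ∞ N]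
  [MeasurableSpace N]

/-- The measure `√(det gᵢⱼ) dy` of the chart around `p`, transported to `N`
(it vanishes outside the domain of the chart). -/
def chartVolume (g : Metric m N) (p : N) : Measure N :=
  (((volume : Measure (EuclideanSpace ℝ (Fin m))).restrict (coordDomain m p)).withDensity
    fun y => ENNReal.ofReal (Real.sqrt (gram g p y).det)).map (param m p)

/-- The Riemannian volume measure. The measures of two charts agree on the overlap of their
domains, so the supremum below is the measure that restricts to `chartVolume g p` on the domain of
the chart around `p`, for every `p`. -/
def vol (g : Metric m N) : Measure N := ⨆ p : N, chartVolume g p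

/-- `G` is a weak gradient of `u`: in the coordinates of each chart, `u` is locally integrable and
has the locally integrable weak partial derivatives `g(G, ∂ᵢ)`. -/
def HasWeakGradient (g : Metric m N) (u : N → ℝ) (G : ∀ x : N, TangentSpace (𝓡 m) x) : Prop :=
  ∀ p : N,
    LocallyIntegrableOn (fun y => u (param m p y)) (coordDomain m p) volume ∧
    ∀ i : Fin m,
      LocallyIntegrableOn (fun y => g.inner (param m p y) (G (param m p y)) (coordVec m p y i))
        (coordDomain m p) volume ∧
      ∀ ψ : EuclideanSpace ℝ (Fin m) → ℝ, ContDiff ℝ ∞ ψ → HasCompactSupport ψ →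
        tsupport ψ ⊆ coordDomain m p →
        ∫ y, u (param m p y) * pd i ψ y
          = -∫ y, g.inner (param m p y) (G (param m p y)) (coordVec m p y i) * ψ y

/-- The Sobolev space `W^{1,2}(N)`. -/
def MemW12 (g : Metric m N) (u : N → ℝ) : Prop :=
  MemLp u 2 (vol g) ∧
    ∃ G : ∀ x : N, TangentSpace (𝓡 m) x, HasWeakGradient g u G ∧
      Integrable (fun x => g.inner x (G x) (G x)) (vol g)

open Classical in
/-- The weak gradient `∇u` (unique almost everywhere; `0` if there is none). -/
def weakGradient (g : Metric m N) (u : N → ℝ) : ∀ x : N, TangentSpace (𝓡 m) x :=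
  if h : ∃ G, HasWeakGradient g u G then h.choose else fun _ => 0

/-- `|∇u|²`. -/
def gradSq (g : Metric m N) (u : N → ℝ) (x : N) : ℝ :=
  g.inner x (weakGradient g u x) (weakGradient g u x)

end Sobolev

/-- `W` is a `C²` double well potential with non-degenerate minima (of value zero) at `±1`, of
quadratic growth in the sense that `W''` is bounded. -/
structure IsDoubleWell (W : ℝ → ℝ) : Prop where
  contDiff : ContDiff ℝ 2 W
  nonneg : ∀ t, 0 ≤ W t
  eq_zero_iff : ∀ t, W t = 0 ↔ t = -1 ∨ t = 1
  nondegenerate_neg_one : 0 < deriv (deriv W) (-1)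
  nondegenerate_one : 0 < deriv (deriv W) 1
  quadratic_growth : ∃ K : ℝ, ∀ t, |deriv (deriv W) t| ≤ K

/-- `σ = ∫_{-1}^{1} √(W(t)/2) dt`. -/
def sigma (W : ℝ → ℝ) : ℝ := ∫ t in (-1 : ℝ)..1, Real.sqrt (W t / 2)

section Energy

variable {m : ℕ} {N : Type*} [TopologicalSpace N]
  [ChartedSpace (EuclideanSpace ℝ (Fin m)) N] [IsManifold (𝓡 m) ∞ N]
  [MeasurableSpace N]

/-- The Allen–Cahn energy `E_ε(u) = (1/2σ) ∫ ε|∇u|²/2 + W(u)/ε`. -/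
def energy (g : Metric m N) (W : ℝ → ℝ) (ε : ℝ) (u : N → ℝ) : ℝ :=
  1 / (2 * sigma W) * ∫ x, (ε * gradSq g u x / 2 + W (u x) / ε) ∂(vol g)

/-- The forced functional `F_{ε,μ}(u) = E_ε(u) - (μ/2σ) ∫ u`. -/
def forcedEnergy (g : Metric m N) (W : ℝ → ℝ) (ε μ : ℝ) (u : N → ℝ) : ℝ :=
  energy g W ε u - μ / (2 * sigma W) * ∫ x, u x ∂(vol g)

/-- `u ∈ W^{1,2}(N)` is a critical point of `F_{ε,μ}`: the first variation vanishes in every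
direction `φ ∈ W^{1,2}(N)`. -/
def IsCriticalPoint (g : Metric m N) (W : ℝ → ℝ) (ε μ : ℝ) (u : N → ℝ) : Prop :=
  MemW12 g u ∧ ∀ φ : N → ℝ, MemW12 g φ →
    HasDerivAt (fun t : ℝ => forcedEnergy g W ε μ (fun x => u x + t * φ x)) 0 0

/-- Stability of `u`: the second variation of `F_{ε,μ}` at `u` is nonnegative in every direction
`φ ∈ W^{1,2}(N)`. -/
def IsStable (g : Metric m N) (W : ℝ → ℝ) (ε μ : ℝ) (u : N → ℝ) : Prop :=
  ∀ φ : N → ℝ, MemW12 g φ →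
    0 ≤ deriv (deriv fun t : ℝ => forcedEnergy g W ε μ (fun x => u x + t * φ x)) 0

end Energy

end AllenCahn

end

/-!
The weak equation satisfied by a critical point is `Δu = f(u)` with `f = (W' / ε - μ) / ε`, and
stability says that `∫ |∇φ|² + f'(u) φ² ≥ 0` for all test functions. The constant `μ` is no
obstacle, since it disappears from `f'`. If `u` is smooth, take `φ = |∇u|`. The Bochner formula
`½ Δ|∇u|² = |∇²u|² + ⟨∇u, ∇Δu⟩ + Ric(∇u, ∇u)` together with `|∇|∇u||² ≤ |∇²u|²` and `Ric ≥ κ g`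
bounds the Dirichlet energy of `φ`, and after integration
`κ ∫ |∇u|² ≤ ∫ (Δu)² + ∫ f'(u) |∇u|²`.
By Green's formula `∫ (Δu)² = ∫ f(u) Δu = -∫ f'(u) |∇u|²`, so that the right side is zero, `∇u = 0`,
and `u` is constant because the manifold is connected. Positivity of the Ricci curvature and
compactness enter through `κ > 0`.

Two points need care. First, `|∇u|` need not be differentiable where `∇u = 0`; the test function is
`√(|∇v|² + δ²)` with `δ → 0` (`integral_lap_sq_of_stable`). Second, `u` is only of class `W^{1,2}`.
Instead of proving regularity, `u` is approximated by smooth functions `v` with `v → u`, `∇v → ∇u`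
and `Δv → Δu` in `L²` (`exists_smooth_approx`). In a chart these are mollifications of cut-offs of
`u`, and convergence of the Laplacians is Friedrichs' commutator lemma
(`isConcentrating_commutator`, `exists_friedrichs_approx`).
The functions `v` are smooth, so the inequality above holds for `v` with the weight `f'(u)`, Green's
formula holds for `v` with the weight `f'(v)`, and the errors vanish in the limit since `f'` is
bounded and continuous (`weakGradient_eq_zero`).

The geometric input is the Bochner formula in coordinates (`bochner`, `bochner_inequality`), its
global form with a uniform constant (`exists_bochner`), and Green's formula (`green`), which also
shows that the Laplacian defined in charts is independent of the chart (`lapC_coord_eq`). The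
variational input is the derivation of the weak equation and of the stability inequality
(`IsCriticalPoint.weak_equation`, `IsStable.nonneg`). The conclusion from `∇u = 0` is
`ae_eq_const_of_weakGradient_eq_zero`.
-/

set_option linter.unusedSectionVars false
open scoped Bundle

noncomputable section

namespace AllenCahn

/-! ### Charts, parametrizations and the metric in coordinates -/

/-- The model space `ℝᵐ`. -/
abbrev E (m : ℕ) := EuclideanSpace ℝ (Fin m)

variable {m : ℕ} {N : Type*} [TopologicalSpace N]
  [ChartedSpace (EuclideanSpace ℝ (Fin m)) N] [IsManifold (𝓡 m) ∞ N]

lemma isOpen_coordDomain (p : N) : IsOpen (coordDomain m p) := isOpen_extChartAt_target p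

/-- The domain in `N` of the preferred chart around `p`. -/
def chartDomain (m : ℕ) {N : Type*} [TopologicalSpace N]
    [ChartedSpace (EuclideanSpace ℝ (Fin m)) N] (p : N) : Set N := (extChartAt (𝓡 m) p).source

/-- The coordinates of the preferred chart around `p`. -/
def coord (m : ℕ) {N : Type*} [TopologicalSpace N]
    [ChartedSpace (EuclideanSpace ℝ (Fin m)) N] (p : N) : N → E m := extChartAt (𝓡 m) p

lemma isOpen_chartDomain (p : N) : IsOpen (chartDomain m p) := isOpen_extChartAt_source p

lemma mem_chartDomain (p : N) : p ∈ chartDomain m p := mem_extChartAt_source p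

lemma param_mem {p : N} {y : E m} (hy : y ∈ coordDomain m p) : param m p y ∈ chartDomain m p :=
  (extChartAt (𝓡 m) p).map_target hy

lemma coord_mem {p x : N} (hx : x ∈ chartDomain m p) : coord m p x ∈ coordDomain m p :=
  (extChartAt (𝓡 m) p).map_source hx

lemma coord_param {p : N} {y : E m} (hy : y ∈ coordDomain m p) :
    coord m p (param m p y) = y := (extChartAt (𝓡 m) p).right_inv hy

lemma param_coord {p x : N} (hx : x ∈ chartDomain m p) :
    param m p (coord m p x) = x := (extChartAt (𝓡 m) p).left_inv hx

lemma contMDiffOn_param (p : N) : ContMDiffOn 𝓘(ℝ, E m) (𝓡 m) ∞ (param m p) (coordDomain m p) :=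
  contMDiffOn_extChartAt_symm p

lemma contMDiffOn_coord (p : N) : ContMDiffOn (𝓡 m) 𝓘(ℝ, E m) ∞ (coord m p) (chartDomain m p) := by
  unfold chartDomain
  rw [extChartAt_source]
  exact contMDiffOn_extChartAt

lemma contMDiffAt_param {p : N} {y : E m} (hy : y ∈ coordDomain m p) :
    ContMDiffAt 𝓘(ℝ, E m) (𝓡 m) ∞ (param m p) y :=
  (contMDiffOn_param p).contMDiffAt ((isOpen_coordDomain p).mem_nhds hy)

lemma contMDiffAt_coord {p x : N} (hx : x ∈ chartDomain m p) :
    ContMDiffAt (𝓡 m) 𝓘(ℝ, E m) ∞ (coord m p) x :=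
  (contMDiffOn_coord p).contMDiffAt ((isOpen_chartDomain p).mem_nhds hx)

/-- The derivative of the parametrization; it maps the `i`-th unit vector to the coordinate vector
`coordVec m p y i`. -/
def dparam (m : ℕ) {N : Type*} [TopologicalSpace N]
    [ChartedSpace (EuclideanSpace ℝ (Fin m)) N] (p : N) (y : E m) :
    E m →L[ℝ] TangentSpace (𝓡 m) (param m p y) :=
  mfderiv 𝓘(ℝ, EuclideanSpace ℝ (Fin m)) (𝓡 m) (param m p) y

lemma mdifferentiableAt_param {p : N} {y : E m} (hy : y ∈ coordDomain m p) :
    MDifferentiableAt 𝓘(ℝ, E m) (𝓡 m) (param m p) y :=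
  (contMDiffAt_param hy).mdifferentiableAt (by simp)

lemma mdifferentiableAt_coord {p x : N} (hx : x ∈ chartDomain m p) :
    MDifferentiableAt (𝓡 m) 𝓘(ℝ, E m) (coord m p) x :=
  (contMDiffAt_coord hx).mdifferentiableAt (by simp)

lemma injective_dparam {p : N} {y : E m} (hy : y ∈ coordDomain m p) :
    Function.Injective (dparam m p y) := by
  have h1 : mfderiv 𝓘(ℝ, E m) 𝓘(ℝ, E m) (coord m p ∘ param m p) y
      = ContinuousLinearMap.id ℝ (E m) := by
    have : coord m p ∘ param m p =ᶠ[nhds y] id := by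
      filter_upwards [(isOpen_coordDomain p).mem_nhds hy] with z hz using coord_param hz
    rw [this.mfderiv_eq]
    exact mfderiv_id
  rw [mfderiv_comp y (mdifferentiableAt_coord (param_mem hy)) (mdifferentiableAt_param hy)] at h1
  intro v w hvw
  have h2 := fun v => DFunLike.congr_fun h1 v
  have hv := h2 v
  have hw := h2 w
  change mfderiv _ _ _ _ (dparam m p y v) = v at hv
  change mfderiv _ _ _ _ (dparam m p y w) = w at hw
  rw [← hv, ← hw, hvw]

lemma sum_single (v : E m) : v = ∑ i, v i • EuclideanSpace.single i (1 : ℝ) := by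
  have h := (EuclideanSpace.basisFun (Fin m) ℝ).sum_repr v
  simpa using h.symm

lemma dparam_apply (p : N) (y : E m) (v : E m) :
    dparam m p y v = ∑ i, v i • coordVec m p y i := by
  conv_lhs => rw [sum_single v]
  rw [map_sum]
  simp only [map_smul]
  rfl

variable (g : Metric m N)

lemma gram_apply (p : N) (y : E m) (i j : Fin m) :
    gram g p y i j = g.inner (param m p y) (coordVec m p y i) (coordVec m p y j) := rfl

lemma gram_symm (p : N) (y : E m) (i j : Fin m) : gram g p y i j = gram g p y j i :=
  g.symm _ _ _

lemma inner_dparam (p : N) (y : E m) (v w : E m) :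
    g.inner (param m p y) (dparam m p y v) (dparam m p y w)
      = ∑ i, ∑ j, gram g p y i j * v i * w j := by
  rw [dparam_apply, dparam_apply]
  simp only [map_sum, map_smul, _root_.sum_apply, _root_.smul_apply,
    smul_eq_mul, gram_apply, Finset.mul_sum]
  rw [Finset.sum_comm]
  refine Finset.sum_congr rfl fun i _ => Finset.sum_congr rfl fun j _ => by ring

lemma posDef_gram {p : N} {y : E m} (hy : y ∈ coordDomain m p) : (gram g p y).PosDef := by
  refine Matrix.PosDef.of_dotProduct_mulVec_pos ?_ ?_
  · exact Matrix.IsHermitian.ext fun i j => gram_symm g p y j i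
  · intro v hv
    have h := g.pos (param m p y) (dparam m p y (WithLp.toLp 2 v)) (by
      rw [Ne, ← map_zero (dparam m p y)]
      intro h
      exact hv (by simpa using injective_dparam hy h))
    rw [inner_dparam] at h
    refine lt_of_lt_of_eq h ?_
    simp only [dotProduct, Matrix.mulVec, star_trivial, Finset.mul_sum]
    refine Finset.sum_congr rfl fun i _ => Finset.sum_congr rfl fun j _ => by ring

lemma contDiffOn_gram (p : N) (i j : Fin m) :
    ContDiffOn ℝ ∞ (fun y => gram g p y i j) (coordDomain m p) := by
  have hv : ∀ i : Fin m, ContMDiffOn 𝓘(ℝ, E m) ((𝓡 m).prod 𝓘(ℝ, E m)) ∞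
      (fun y => (⟨param m p y, coordVec m p y i⟩ : TangentBundle (𝓡 m) N)) (coordDomain m p) := by
    intro i y hy
    have h1 := (contMDiffOn_param (m := m) p).contMDiffOn_tangentMapWithin
      (m := ∞) (n := ∞) (by simp) (isOpen_coordDomain p).uniqueMDiffOn
    have h2 : ContMDiffOn 𝓘(ℝ, E m) (𝓘(ℝ, E m).prod 𝓘(ℝ, E m)) ∞
      (fun y => (⟨y, EuclideanSpace.single i (1 : ℝ)⟩ : TangentBundle 𝓘(ℝ, E m) (E m)))
      (coordDomain m p) := by
      intro y hy
      rw [Bundle.contMDiffWithinAt_totalSpace]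
      refine ⟨contMDiffWithinAt_id, ?_⟩
      simp
      exact contMDiffWithinAt_const
    have h3 := h1.comp h2 (fun y hy => hy)
    refine (h3.congr ?_) y hy
    intro z hz
    simp only [tangentMapWithin, Function.comp]
    rw [mfderivWithin_of_mem_nhds ((isOpen_coordDomain p).mem_nhds hz)]
    rfl
  intro y hy
  rw [← contMDiffWithinAt_iff_contDiffWithinAt]
  let _ : Bundle.RiemannianBundle (fun x : N => TangentSpace (𝓡 m) x) := ⟨g.toRiemannianMetric⟩
  have := ContMDiffWithinAt.inner_bundle (n := ∞) (hv i y hy) (hv j y hy)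
  exact this

/-! ### Partial derivatives in `ℝᵐ` -/

section PartialDerivatives

variable {m : ℕ} {f h : E m → ℝ} {y : E m} {Ω : Set (E m)}

lemma pd_add (i : Fin m) (hf : DifferentiableAt ℝ f y) (hh : DifferentiableAt ℝ h y) :
    pd i (fun z => f z + h z) y = pd i f y + pd i h y := by
  simp only [pd]
  rw [fderiv_fun_add hf hh]
  rfl

lemma pd_sub (i : Fin m) (hf : DifferentiableAt ℝ f y) (hh : DifferentiableAt ℝ h y) :
    pd i (fun z => f z - h z) y = pd i f y - pd i h y := by
  simp only [pd]
  rw [fderiv_fun_sub hf hh]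
  rfl

lemma pd_mul (i : Fin m) (hf : DifferentiableAt ℝ f y) (hh : DifferentiableAt ℝ h y) :
    pd i (fun z => f z * h z) y = pd i f y * h y + f y * pd i h y := by
  simp only [pd]
  rw [fderiv_fun_mul hf hh]
  simp [mul_comm, add_comm]

lemma pd_const_mul (i : Fin m) (c : ℝ) (hf : DifferentiableAt ℝ f y) :
    pd i (fun z => c * f z) y = c * pd i f y := by
  simp only [pd]
  rw [fderiv_const_mul hf]
  rfl

lemma pd_sum {ι : Type*} (s : Finset ι) (i : Fin m) {F : ι → E m → ℝ}
    (hF : ∀ k ∈ s, DifferentiableAt ℝ (F k) y) :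
    pd i (fun z => ∑ k ∈ s, F k z) y = ∑ k ∈ s, pd i (F k) y := by
  simp only [pd]
  rw [fderiv_fun_sum hF]
  simp

lemma pd_sum_mul {ι : Type*} (s : Finset ι) (i : Fin m) {F H : ι → E m → ℝ}
    (hF : ∀ k, DifferentiableAt ℝ (F k) y) (hH : ∀ k, DifferentiableAt ℝ (H k) y) :
    pd i (fun z => ∑ k ∈ s, F k z * H k z) y
      = ∑ k ∈ s, (pd i (F k) y * H k y + F k y * pd i (H k) y) := by
  rw [pd_sum (F := fun k z => F k z * H k z) s i fun k _ => (hF k).mul (hH k)]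
  exact Finset.sum_congr rfl fun k _ => pd_mul i (hF k) (hH k)

lemma differentiableAt_sum_mul {ι : Type*} (s : Finset ι) {F H : ι → E m → ℝ}
    (hF : ∀ k, DifferentiableAt ℝ (F k) y) (hH : ∀ k, DifferentiableAt ℝ (H k) y) :
    DifferentiableAt ℝ (fun z => ∑ k ∈ s, F k z * H k z) y :=
  DifferentiableAt.fun_sum fun k _ => (hF k).mul (hH k)

lemma pd_comp (i : Fin m) {F : ℝ → ℝ} {F' : ℝ} (hF : HasDerivAt F F' (f y))
    (hf : DifferentiableAt ℝ f y) : pd i (fun z => F (f z)) y = F' * pd i f y := by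
  simp only [pd]
  have := (hF.hasFDerivAt.comp y hf.hasFDerivAt).fderiv
  change fderiv ℝ (F ∘ f) y _ = _
  rw [this]
  simp [mul_comm]

lemma pd_congr (i : Fin m) (hfh : f =ᶠ[nhds y] h) : pd i f y = pd i h y := by
  simp only [pd, hfh.fderiv_eq]

lemma pd_congr_on (i : Fin m) (hΩ : IsOpen Ω) (hy : y ∈ Ω) (hfh : ∀ z ∈ Ω, f z = h z) :
    pd i f y = pd i h y :=
  pd_congr i (Filter.eventuallyEq_of_mem (hΩ.mem_nhds hy) hfh)

lemma fderiv_apply_eq_sum_pd (v : E m) : fderiv ℝ f y v = ∑ i, v i * pd i f y := by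
  conv_lhs => rw [sum_single v]
  simp [pd]

lemma _root_.ContDiffOn.differentiableAt_of_isOpen {n : WithTop ℕ∞} (hf : ContDiffOn ℝ n f Ω)
    (hΩ : IsOpen Ω) (hy : y ∈ Ω) (hn : n ≠ 0) : DifferentiableAt ℝ f y :=
  (hf.contDiffAt (hΩ.mem_nhds hy)).differentiableAt hn

lemma contDiffOn_pd_of_le {k n : WithTop ℕ∞} (i : Fin m) (hf : ContDiffOn ℝ n f Ω)
    (hΩ : IsOpen Ω) (hk : k + 1 ≤ n) : ContDiffOn ℝ k (pd i f) Ω :=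
  (hf.fderiv_of_isOpen hΩ hk).clm_apply contDiffOn_const

lemma contDiffOn_pd (i : Fin m) (hf : ContDiffOn ℝ ∞ f Ω) (hΩ : IsOpen Ω) :
    ContDiffOn ℝ ∞ (pd i f) Ω :=
  contDiffOn_pd_of_le i hf hΩ (by simp)

lemma contDiff_pd (i : Fin m) (hf : ContDiff ℝ ∞ f) : ContDiff ℝ ∞ (pd i f) := by
  rw [← contDiffOn_univ] at hf ⊢
  exact contDiffOn_pd i hf isOpen_univ

lemma pd_comm (i j : Fin m) (hf : ContDiffOn ℝ ∞ f Ω) (hΩ : IsOpen Ω) (hy : y ∈ Ω) :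
    pd i (pd j f) y = pd j (pd i f) y := by
  have hf' : ContDiffAt ℝ ∞ f y := hf.contDiffAt (hΩ.mem_nhds hy)
  have hs := hf'.isSymmSndFDerivAt (by
    simp only [minSmoothness_of_isRCLikeNormedField]
    exact WithTop.coe_le_coe.2 (le_top : (2 : ℕ∞) ≤ ⊤))
  have hd : DifferentiableAt ℝ (fderiv ℝ f) y :=
    ((hf.fderiv_of_isOpen hΩ (m := ∞) (by simp)).contDiffAt
      (hΩ.mem_nhds hy)).differentiableAt (by simp)
  have key : ∀ i j : Fin m, pd i (pd j f) y = fderiv ℝ (fderiv ℝ f) y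
      (EuclideanSpace.single i (1 : ℝ)) (EuclideanSpace.single j (1 : ℝ)) := by
    intro i j
    change fderiv ℝ (fun z => fderiv ℝ f z (EuclideanSpace.single j (1 : ℝ))) y _ = _
    rw [fderiv_clm_apply hd (differentiableAt_const _)]
    simp
  rw [key, key]
  exact hs _ _

lemma tsupport_pd_subset (i : Fin m) (f : E m → ℝ) : tsupport (pd i f) ⊆ tsupport f := by
  refine closure_minimal (fun z hz => ?_) (isClosed_tsupport f)
  by_contra h
  have h0 : f =ᶠ[nhds z] fun _ => 0 := notMem_tsupport_iff_eventuallyEq.1 h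
  apply hz
  simp [pd, h0.fderiv_eq]

lemma _root_.HasCompactSupport.pd (i : Fin m) (hf : HasCompactSupport f) :
    HasCompactSupport (pd i f) :=
  hf.of_isClosed_subset (isClosed_tsupport _) (tsupport_pd_subset i f)

/-- The product of a function that is continuous on `Ω` and a function supported in `Ω`
is continuous, whatever the values of the first factor outside `Ω`. -/
lemma continuous_mul_of_tsupport_subset (hΩ : IsOpen Ω) (hf : ContinuousOn f Ω)
    (hh : Continuous h) (hs : tsupport h ⊆ Ω) : Continuous fun z => f z * h z := by
  rw [continuous_iff_continuousAt]
  intro z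
  by_cases hz : z ∈ tsupport h
  · exact (hf.continuousAt (hΩ.mem_nhds (hs hz))).mul hh.continuousAt
  · have h0 : h =ᶠ[nhds z] fun _ => 0 := notMem_tsupport_iff_eventuallyEq.1 hz
    have : (fun z => f z * h z) =ᶠ[nhds z] fun _ => 0 := by
      filter_upwards [h0] with w hw
      simp [hw]
    exact continuousAt_const.congr this.symm

lemma contDiff_mul_of_tsupport_subset {n : WithTop ℕ∞} (hΩ : IsOpen Ω) (hf : ContDiffOn ℝ n f Ω)
    (hh : ContDiff ℝ n h) (hs : tsupport h ⊆ Ω) : ContDiff ℝ n fun z => f z * h z := by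
  rw [contDiff_iff_contDiffAt]
  intro z
  by_cases hz : z ∈ tsupport h
  · exact (hf.contDiffAt (hΩ.mem_nhds (hs hz))).mul hh.contDiffAt
  · have h0 : h =ᶠ[nhds z] fun _ => 0 := notMem_tsupport_iff_eventuallyEq.1 hz
    have : (fun z => f z * h z) =ᶠ[nhds z] fun _ => 0 := by
      filter_upwards [h0] with w hw
      simp [hw]
    exact contDiffAt_const.congr_of_eventuallyEq this

lemma integrable_mul_of_tsupport_subset (hΩ : IsOpen Ω) (hf : ContinuousOn f Ω)
    (hh : Continuous h) (hc : HasCompactSupport h) (hs : tsupport h ⊆ Ω) :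
    Integrable fun z => f z * h z :=
  (continuous_mul_of_tsupport_subset hΩ hf hh hs).integrable_of_hasCompactSupport
    (hc.mul_left)

/-- Integration by parts against a function with compact support in `Ω`. -/
lemma integral_mul_pd_eq_neg (i : Fin m) (hΩ : IsOpen Ω) (hf : ContDiffOn ℝ 1 f Ω)
    (hh : ContDiff ℝ 1 h) (hc : HasCompactSupport h) (hs : tsupport h ⊆ Ω) :
    ∫ z, f z * pd i h z = -∫ z, pd i f z * h z := by
  have hpf : ContinuousOn (pd i f) Ω :=
    (contDiffOn_pd_of_le (k := 0) i hf hΩ (by simp)).continuousOn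
  have hph : Continuous (pd i h) := by
    rw [← contDiffOn_univ] at hh
    exact continuousOn_univ.1 (contDiffOn_pd_of_le (k := 0) i hh isOpen_univ (by simp)).continuousOn
  refine integral_mul_fderiv_eq_neg_fderiv_mul_of_integrable
    (integrable_mul_of_tsupport_subset hΩ hpf hh.continuous hc hs)
    (integrable_mul_of_tsupport_subset hΩ hf.continuousOn hph (hc.pd i)
      ((tsupport_pd_subset i h).trans hs))
    (integrable_mul_of_tsupport_subset hΩ hf.continuousOn hh.continuous hc hs) ?_ ?_
  · exact fun x hx => hf.differentiableAt_of_isOpen hΩ (hs hx) (by simp)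
  · exact fun x _ => (hh.differentiable (by simp)) x

end PartialDerivatives

/-! ### Matrices of smooth functions -/

section SmoothMatrix

variable {m : ℕ} {y : E m} {Ω : Set (E m)} {ι : Type*} [Fintype ι] [DecidableEq ι]
  {A : E m → Matrix ι ι ℝ}

lemma contDiffOn_det (hA : ∀ i j, ContDiffOn ℝ ∞ (fun z => A z i j) Ω) :
    ContDiffOn ℝ ∞ (fun z => (A z).det) Ω := by
  simp only [Matrix.det_apply']
  refine ContDiffOn.sum fun σ _ => contDiffOn_const.mul ?_
  exact contDiffOn_prod fun i _ => hA _ _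

lemma contDiffOn_inv (hA : ∀ i j, ContDiffOn ℝ ∞ (fun z => A z i j) Ω)
    (hdet : ∀ z ∈ Ω, (A z).det ≠ 0) (i j : ι) :
    ContDiffOn ℝ ∞ (fun z => (A z)⁻¹ i j) Ω := by
  have h : ∀ z, (A z)⁻¹ i j = ((A z).det)⁻¹ * ((A z).updateRow j (Pi.single i 1)).det := by
    intro z
    rw [Matrix.inv_def, Matrix.smul_apply, Matrix.adjugate_apply, Ring.inverse_eq_inv', smul_eq_mul]
  simp only [h]
  refine ((contDiffOn_det hA).inv hdet).mul (contDiffOn_det fun k l => ?_)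
  by_cases hk : k = j
  · subst hk
    simp only [Matrix.updateRow_self]
    exact contDiffOn_const
  · simp only [Matrix.updateRow_ne hk]
    exact hA k l

/-- Jacobi's formula for the derivative of a determinant. -/
lemma pd_det (i : Fin m) (hA : ∀ k l, DifferentiableAt ℝ (fun z => A z k l) y) :
    pd i (fun z => (A z).det) y
      = ∑ l, ∑ k, (A y).adjugate l k * pd i (fun z => A z k l) y := by
  have h1 : pd i (fun z => (A z).det) y = ∑ l, ((A y).updateCol l
      (fun k => pd i (fun z => A z k l) y)).det := by
    simp only [Matrix.det_apply']
    have hP : ∀ σ : Equiv.Perm ι, DifferentiableAt ℝ (fun z => ∏ k, A z (σ k) k) y :=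
      fun σ => ((contDiff_prod (𝕜 := ℝ) (n := 1) (t := Finset.univ)
        (f := fun k (w : ι → ℝ) => w k) fun k _ => contDiff_apply ℝ ℝ k).differentiable
          (by simp)).differentiableAt.comp y (differentiableAt_pi.2 fun k => hA (σ k) k)
    rw [pd_sum (F := fun (σ : Equiv.Perm ι) z => ((Equiv.Perm.sign σ : ℤ) : ℝ) *
      ∏ k, A z (σ k) k) _ _ fun σ _ => (hP σ).const_mul _, Finset.sum_comm]
    refine Finset.sum_congr rfl fun σ _ => ?_
    rw [pd_const_mul _ _ (hP σ), ← Finset.mul_sum]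
    congr 1
    have h2 := (HasFDerivAt.finsetProd (u := Finset.univ)
      (g := fun k z => A z (σ k) k) (x := y)
      fun k _ => (hA (σ k) k).hasFDerivAt).fderiv
    change fderiv ℝ (fun z => ∏ k, A z (σ k) k) y _ = _
    rw [h2]
    simp only [_root_.sum_apply, _root_.smul_apply, smul_eq_mul]
    refine Finset.sum_congr rfl fun l _ => ?_
    rw [← Finset.mul_prod_erase _ _ (Finset.mem_univ l), mul_comm]
    simp only [Matrix.updateCol_self]
    congr 1
    refine Finset.prod_congr rfl fun k hk => ?_
    rw [Matrix.updateCol_ne (Finset.ne_of_mem_erase hk)]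
  rw [h1]
  refine Finset.sum_congr rfl fun l _ => ?_
  rw [← Matrix.cramer_apply, Matrix.cramer_eq_adjugate_mulVec]
  rfl

end SmoothMatrix

/-! ### Calculus in the coordinates of a chart -/

section ChartCalculus

variable {m : ℕ} {N : Type*} [TopologicalSpace N]
  [ChartedSpace (EuclideanSpace ℝ (Fin m)) N] [IsManifold (𝓡 m) ∞ N]
  (g : Metric m N) (p : N)

/-- The density `√(det gᵢⱼ)` of the Riemannian volume in the chart around `p`. -/
def density (y : E m) : ℝ := Real.sqrt (gram g p y).det

/-- The components `Xᵏ = ∑ₗ gᵏˡ ∂ₗh` of the gradient of a function `h` of the coordinates. -/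
def gradC (h : E m → ℝ) (k : Fin m) (y : E m) : ℝ := ∑ l, (gram g p y)⁻¹ k l * pd l h y

/-- The divergence `∑ᵢ ∂ᵢXⁱ + ∑ᵢₖ Γᵏₖᵢ Xⁱ` of a vector field with components `Xⁱ`. -/
def divC (X : Fin m → E m → ℝ) (y : E m) : ℝ :=
  ∑ i, pd i (X i) y + ∑ i, ∑ k, christoffel g p k k i y * X i y

/-- The Laplace–Beltrami operator in coordinates, the divergence of the gradient. -/
def lapC (h : E m → ℝ) (y : E m) : ℝ := divC g p (gradC g p h) y

/-- The endomorphism `∇X`, with components `∇ᵢXᵏ = ∂ᵢXᵏ + ∑ₗ Γᵏᵢₗ Xˡ`, for the gradient `X` of `h`;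
lowering an index it is the Hessian of `h`. -/
def hessC (h : E m → ℝ) (k i : Fin m) (y : E m) : ℝ :=
  pd i (gradC g p h k) y + ∑ l, christoffel g p k i l y * gradC g p h l y

/-- The squared length `∑ₖ Xᵏ ∂ₖh` of the gradient of `h`. -/
def gradSqC (h : E m → ℝ) (y : E m) : ℝ := ∑ k, gradC g p h k y * pd k h y

variable {g p} {y : E m} {v : E m → ℝ}

lemma det_gram_pos (hy : y ∈ coordDomain m p) : 0 < (gram g p y).det := (posDef_gram g hy).det_pos

lemma density_pos (hy : y ∈ coordDomain m p) : 0 < density g p y :=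
  Real.sqrt_pos.2 (det_gram_pos hy)

lemma gram_inv_mul (hy : y ∈ coordDomain m p) : (gram g p y)⁻¹ * gram g p y = 1 :=
  Matrix.nonsing_inv_mul _ (det_gram_pos hy).ne'.isUnit

lemma gram_mul_inv (hy : y ∈ coordDomain m p) : gram g p y * (gram g p y)⁻¹ = 1 :=
  Matrix.mul_nonsing_inv _ (det_gram_pos hy).ne'.isUnit

lemma sum_gram_mul_inv (hy : y ∈ coordDomain m p) (i j : Fin m) :
    ∑ k, gram g p y i k * (gram g p y)⁻¹ k j = if i = j then 1 else 0 := by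
  rw [← Matrix.mul_apply, gram_mul_inv hy, Matrix.one_apply]

lemma sum_inv_mul_gram (hy : y ∈ coordDomain m p) (i j : Fin m) :
    ∑ k, (gram g p y)⁻¹ i k * gram g p y k j = if i = j then 1 else 0 := by
  rw [← Matrix.mul_apply, gram_inv_mul hy, Matrix.one_apply]

lemma gram_inv_symm (i j : Fin m) : (gram g p y)⁻¹ i j = (gram g p y)⁻¹ j i := by
  have h : (gram g p y).transpose = gram g p y := by
    ext i j
    exact gram_symm g p y j i
  conv_lhs => rw [← h, ← Matrix.transpose_nonsing_inv, Matrix.transpose_apply]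

lemma sum_gram_mul_gradC (hy : y ∈ coordDomain m p) (k : Fin m) :
    ∑ l, gram g p y k l * gradC g p v l y = pd k v y := by
  simp only [gradC, Finset.mul_sum]
  rw [Finset.sum_comm]
  simp only [← mul_assoc, ← Finset.sum_mul, sum_gram_mul_inv hy]
  simp

lemma gradSqC_eq_sum_gram (hy : y ∈ coordDomain m p) :
    gradSqC g p v y = ∑ k, ∑ l, gram g p y k l * gradC g p v k y * gradC g p v l y := by
  refine Finset.sum_congr rfl fun k _ => ?_
  rw [← sum_gram_mul_gradC (g := g) hy, Finset.mul_sum]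
  exact Finset.sum_congr rfl fun l _ => by ring

lemma contDiffOn_gram_inv (i j : Fin m) :
    ContDiffOn ℝ ∞ (fun y => (gram g p y)⁻¹ i j) (coordDomain m p) :=
  contDiffOn_inv (contDiffOn_gram g p) (fun _ hz => (det_gram_pos hz).ne') i j

lemma contDiffOn_density : ContDiffOn ℝ ∞ (density g p) (coordDomain m p) :=
  (contDiffOn_det (contDiffOn_gram g p)).sqrt fun _ hz => (det_gram_pos hz).ne'

lemma contDiffOn_christoffel (k i j : Fin m) :
    ContDiffOn ℝ ∞ (christoffel g p k i j) (coordDomain m p) := by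
  have h := fun i k l : Fin m => contDiffOn_pd i (contDiffOn_gram g p k l) (isOpen_coordDomain p)
  exact contDiffOn_const.mul (ContDiffOn.sum fun l _ => (contDiffOn_gram_inv k l).mul
    (((h i j l).add (h j i l)).sub (h l i j)))

lemma contDiffOn_gradC (hv : ContDiffOn ℝ ∞ v (coordDomain m p)) (k : Fin m) :
    ContDiffOn ℝ ∞ (gradC g p v k) (coordDomain m p) :=
  ContDiffOn.sum fun l _ => (contDiffOn_gram_inv k l).mul
    (contDiffOn_pd l hv (isOpen_coordDomain p))

lemma contDiffOn_hessC (hv : ContDiffOn ℝ ∞ v (coordDomain m p)) (k i : Fin m) :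
    ContDiffOn ℝ ∞ (hessC g p v k i) (coordDomain m p) :=
  (contDiffOn_pd i (contDiffOn_gradC hv k) (isOpen_coordDomain p)).add
    (ContDiffOn.sum fun l _ => (contDiffOn_christoffel k i l).mul (contDiffOn_gradC hv l))

lemma contDiffOn_divC {X : Fin m → E m → ℝ}
    (hX : ∀ i, ContDiffOn ℝ ∞ (X i) (coordDomain m p)) :
    ContDiffOn ℝ ∞ (divC g p X) (coordDomain m p) :=
  (ContDiffOn.sum fun i _ => contDiffOn_pd i (hX i) (isOpen_coordDomain p)).add
    (ContDiffOn.sum fun i _ => ContDiffOn.sum fun k _ =>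
      (contDiffOn_christoffel k k i).mul (hX i))

lemma contDiffOn_lapC (hv : ContDiffOn ℝ ∞ v (coordDomain m p)) :
    ContDiffOn ℝ ∞ (lapC g p v) (coordDomain m p) :=
  contDiffOn_divC fun i => contDiffOn_gradC hv i

lemma _root_.ContDiffOn.diffAt {f : E m → ℝ} (hf : ContDiffOn ℝ ∞ f (coordDomain m p))
    (hy : y ∈ coordDomain m p) : DifferentiableAt ℝ f y :=
  hf.differentiableAt_of_isOpen (isOpen_coordDomain p) hy (by simp)

lemma pd_gram_symm (i k l : Fin m) :
    pd i (fun z => gram g p z k l) y = pd i (fun z => gram g p z l k) y := by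
  simp only [gram_symm g p _ k l]

lemma christoffel_symm (k i j : Fin m) : christoffel g p k i j = christoffel g p k j i := by
  ext y
  simp only [christoffel]
  congr 1
  refine Finset.sum_congr rfl fun l _ => ?_
  rw [pd_gram_symm l i j]
  ring

lemma sum_gram_mul_christoffel (hy : y ∈ coordDomain m p) (l i j : Fin m) :
    ∑ k, gram g p y l k * christoffel g p k i j y
      = (1 / 2) * (pd i (fun z => gram g p z j l) y + pd j (fun z => gram g p z i l) y
      - pd l (fun z => gram g p z i j) y) := by
  simp only [christoffel, Finset.mul_sum]
  rw [Finset.sum_comm]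
  have h : ∀ k j : Fin m, ∀ c : ℝ, gram g p y l j * (1 / 2 * ((gram g p y)⁻¹ j k * c))
      = gram g p y l j * (gram g p y)⁻¹ j k * (1 / 2 * c) := fun _ _ _ => by ring
  simp only [h, ← Finset.sum_mul, sum_gram_mul_inv hy]
  simp

/-- `∂ᵢ √(det g) = √(det g) ∑ₖ Γᵏₖᵢ`. -/
lemma pd_density (hy : y ∈ coordDomain m p) (i : Fin m) :
    pd i (density g p) y = density g p y * ∑ k, christoffel g p k k i y := by
  have hA := fun k l => (contDiffOn_gram g p k l).diffAt hy
  have h1 : ∑ k, christoffel g p k k i y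
      = (1 / 2) * ∑ k, ∑ l, (gram g p y)⁻¹ k l * pd i (fun z => gram g p z l k) y := by
    simp only [christoffel, ← Finset.mul_sum]
    congr 1
    have : ∑ k, ∑ l, (gram g p y)⁻¹ k l * pd k (fun z => gram g p z i l) y
        = ∑ k, ∑ l, (gram g p y)⁻¹ k l * pd l (fun z => gram g p z k i) y := by
      rw [Finset.sum_comm]
      refine Finset.sum_congr rfl fun k _ => Finset.sum_congr rfl fun l _ => ?_
      rw [gram_inv_symm, pd_gram_symm]
    simp only [mul_add, mul_sub, Finset.sum_add_distrib, Finset.sum_sub_distrib, this]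
    simp only [pd_gram_symm i]
    rw [add_sub_cancel_left]
  have h2 := pd_comp i (Real.hasDerivAt_sqrt (det_gram_pos (g := g) hy).ne')
    ((contDiffOn_det (contDiffOn_gram g p)).diffAt hy)
  have h3 : (gram g p y).adjugate = (gram g p y).det • (gram g p y)⁻¹ := by
    rw [Matrix.inv_def, Ring.inverse_eq_inv', smul_smul, mul_inv_cancel₀ (det_gram_pos hy).ne',
      one_smul]
  change pd i (fun z => Real.sqrt (gram g p z).det) y = Real.sqrt (gram g p y).det * _
  rw [h2, pd_det i hA, h3, h1]
  simp only [Matrix.smul_apply, smul_eq_mul, mul_assoc, ← Finset.mul_sum]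
  have h4 : Real.sqrt (gram g p y).det * Real.sqrt (gram g p y).det = (gram g p y).det :=
    Real.mul_self_sqrt (det_gram_pos hy).le
  have h5 := (density_pos (g := g) hy).ne'
  simp only [density] at h5
  field_simp
  rw [pow_two, h4]

/-- The divergence in divergence form, `∑ᵢ ∂ᵢ(√(det g) Xⁱ) = √(det g) div X`. -/
lemma sum_pd_density_mul {X : Fin m → E m → ℝ} (hy : y ∈ coordDomain m p)
    (hX : ∀ i, DifferentiableAt ℝ (X i) y) :
    ∑ i, pd i (fun z => density g p z * X i z) y = density g p y * divC g p X y := by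
  have h : ∀ i, pd i (fun z => density g p z * X i z) y
      = density g p y * (pd i (X i) y + ∑ k, christoffel g p k k i y * X i y) := by
    intro i
    rw [pd_mul i (contDiffOn_density.diffAt hy) (hX i), pd_density hy, ← Finset.sum_mul]
    ring
  simp only [h, ← Finset.mul_sum, Finset.sum_add_distrib, divC]

end ChartCalculus

/-! ### The Bochner formula -/

section Bochner

/-- The contraction of indices behind the Bochner formula. The arrays are the values at a point of
`X`, `∂X`, `∂∂X`, of the Christoffel symbols `Γ`, of `∂Γ`, of `M = ∇X` and of `∂M`, the derivative
index coming first in `ddX`, `dΓ` and `dM`. The left side is `div (M X) - X · ∇ tr M`, the right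
side is `tr (M²) + Ric(X, X)`. -/
lemma bochner_contraction {ι : Type*} [Fintype ι] (X : ι → ℝ) (M dX : ι → ι → ℝ)
    (Γ : ι → ι → ι → ℝ) (ddX : ι → ι → ι → ℝ) (dΓ : ι → ι → ι → ι → ℝ)
    (dM : ι → ι → ι → ℝ)
    (hΓ : ∀ k i j, Γ k i j = Γ k j i) (hdΓ : ∀ a k i j, dΓ a k i j = dΓ a k j i)
    (hdd : ∀ i l k, ddX i l k = ddX l i k)
    (hM : ∀ k i, dX i k = M k i - ∑ l, Γ k i l * X l)
    (hdM : ∀ j i l, dM j i l = ddX j l i + ∑ k, (dΓ j i l k * X k + Γ i l k * dX j k)) :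
    ∑ i, ∑ l, (dM i i l * X l + M i l * dX i l) + ∑ i, ∑ k, Γ k k i * ∑ l, M i l * X l
      - ∑ l, X l * ∑ i, dM l i i
    = ∑ i, ∑ l, M i l * M l i
      + ∑ i, ∑ j, (∑ k, (dΓ k k i j - dΓ j k i k)
        + ∑ k, ∑ l, (Γ k k l * Γ l i j - Γ k j l * Γ l i k)) * X i * X j := by
  have e1 : ∑ i, ∑ l, (dM i i l * X l + M i l * dX i l) - ∑ l, X l * ∑ i, dM l i i
      = ∑ i, ∑ l, ∑ k, ((dΓ i i l k - dΓ l i i k) * X k * X l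
        + Γ i l k * M k i * X l - Γ i i k * M k l * X l - M i l * Γ l i k * X k
        + ∑ s, (Γ i i k * Γ k l s - Γ i l k * Γ k i s) * X s * X l)
        + ∑ i, ∑ l, M i l * M l i := by
    have h0 : ∑ l, X l * ∑ i, dM l i i = ∑ i, ∑ l, X l * dM l i i := by
      simp only [Finset.mul_sum]
      exact Finset.sum_comm
    rw [h0, ← Finset.sum_sub_distrib, ← Finset.sum_add_distrib]
    refine Finset.sum_congr rfl fun i _ => ?_
    rw [← Finset.sum_sub_distrib, ← Finset.sum_add_distrib]
    refine Finset.sum_congr rfl fun l _ => ?_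
    have h1 : dM i i l - dM l i i = ∑ k, ((dΓ i i l k - dΓ l i i k) * X k
        + Γ i l k * M k i - Γ i i k * M k l
        + ∑ s, (Γ i i k * Γ k l s - Γ i l k * Γ k i s) * X s) := by
      rw [hdM, hdM, hdd i l, add_sub_add_left_eq_sub, ← Finset.sum_sub_distrib]
      refine Finset.sum_congr rfl fun k _ => ?_
      rw [hM, hM]
      simp only [sub_mul, Finset.sum_sub_distrib, mul_assoc, ← Finset.mul_sum]
      ring
    have h2 : dM i i l * X l + M i l * dX i l - X l * dM l i i
        = (dM i i l - dM l i i) * X l + M i l * dX i l := by ring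
    rw [h2, h1, hM, mul_sub, Finset.sum_mul, Finset.mul_sum]
    have h3 : ∀ a b c : ℝ, a + (b - c) = (a - c) + b := fun _ _ _ => by ring
    rw [h3, ← Finset.sum_sub_distrib]
    congr 1
    refine Finset.sum_congr rfl fun k _ => ?_
    simp only [add_mul, sub_mul, Finset.sum_mul]
    ring
  have e2 : ∑ i, ∑ l, ∑ k, Γ i l k * M k i * X l = ∑ i, ∑ l, ∑ k, M i l * Γ l i k * X k := by
    calc ∑ i, ∑ l, ∑ k, Γ i l k * M k i * X l
        = ∑ i, ∑ k, ∑ l, Γ i l k * M k i * X l :=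
          Finset.sum_congr rfl fun i _ => Finset.sum_comm
      _ = ∑ k, ∑ i, ∑ l, Γ i l k * M k i * X l := Finset.sum_comm
      _ = _ := by
          refine Finset.sum_congr rfl fun i _ => Finset.sum_congr rfl fun l _ =>
            Finset.sum_congr rfl fun k _ => ?_
          rw [hΓ]
          ring
  have e3 : ∑ i, ∑ k, Γ k k i * ∑ l, M i l * X l = ∑ i, ∑ l, ∑ k, Γ i i k * M k l * X l := by
    simp only [Finset.mul_sum]
    rw [Finset.sum_comm]
    refine Finset.sum_congr rfl fun i _ => ?_
    rw [Finset.sum_comm]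
    exact Finset.sum_congr rfl fun l _ => Finset.sum_congr rfl fun k _ => by ring
  have e4 : ∑ i, ∑ l, ∑ k, (dΓ i i l k - dΓ l i i k) * X k * X l
      = ∑ i, ∑ j, (∑ k, (dΓ k k i j - dΓ j k i k)) * X i * X j := by
    calc ∑ i, ∑ l, ∑ k, (dΓ i i l k - dΓ l i i k) * X k * X l
        = ∑ l, ∑ i, ∑ k, (dΓ i i l k - dΓ l i i k) * X k * X l := Finset.sum_comm
      _ = ∑ l, ∑ k, ∑ i, (dΓ i i l k - dΓ l i i k) * X k * X l :=
          Finset.sum_congr rfl fun l _ => Finset.sum_comm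
      _ = ∑ k, ∑ l, ∑ i, (dΓ i i l k - dΓ l i i k) * X k * X l := Finset.sum_comm
      _ = _ := by
          refine Finset.sum_congr rfl fun i _ => Finset.sum_congr rfl fun j _ => ?_
          simp only [Finset.sum_mul]
          refine Finset.sum_congr rfl fun k _ => ?_
          rw [hdΓ k k j i, hdΓ j k k i]
  have e5 : ∑ i, ∑ l, ∑ k, ∑ s, (Γ i i k * Γ k l s - Γ i l k * Γ k i s) * X s * X l
      = ∑ i, ∑ j, (∑ k, ∑ l, (Γ k k l * Γ l i j - Γ k j l * Γ l i k)) * X i * X j := by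
    calc ∑ i, ∑ l, ∑ k, ∑ s, (Γ i i k * Γ k l s - Γ i l k * Γ k i s) * X s * X l
        = ∑ l, ∑ i, ∑ k, ∑ s, (Γ i i k * Γ k l s - Γ i l k * Γ k i s) * X s * X l :=
          Finset.sum_comm
      _ = ∑ l, ∑ i, ∑ s, ∑ k, (Γ i i k * Γ k l s - Γ i l k * Γ k i s) * X s * X l :=
          Finset.sum_congr rfl fun l _ => Finset.sum_congr rfl fun i _ => Finset.sum_comm
      _ = ∑ l, ∑ s, ∑ i, ∑ k, (Γ i i k * Γ k l s - Γ i l k * Γ k i s) * X s * X l :=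
          Finset.sum_congr rfl fun l _ => Finset.sum_comm
      _ = ∑ s, ∑ l, ∑ i, ∑ k, (Γ i i k * Γ k l s - Γ i l k * Γ k i s) * X s * X l :=
          Finset.sum_comm
      _ = _ := by
          refine Finset.sum_congr rfl fun i _ => Finset.sum_congr rfl fun j _ => ?_
          simp only [Finset.sum_mul]
          refine Finset.sum_congr rfl fun k _ => Finset.sum_congr rfl fun l _ => ?_
          rw [hΓ l j i, hΓ l k i]
  rw [add_sub_right_comm, e1, e3]
  simp only [Finset.sum_add_distrib, Finset.sum_sub_distrib, add_mul] at e2 e4 e5 ⊢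
  linarith

open Matrix MatrixOrder in
/-- Cauchy–Schwarz for an endomorphism `M` that is self-adjoint for the inner product `G`:
`|MX|² ≤ tr(M²) |X|²`. -/
lemma sum_mulVec_sq_le {ι : Type*} [Fintype ι] [DecidableEq ι] {G M : Matrix ι ι ℝ}
    (hG : G.PosDef) (hM : (G * M)ᵀ = G * M) (X : ι → ℝ) :
    0 ≤ (M * M).trace ∧ (M *ᵥ X) ⬝ᵥ (G *ᵥ (M *ᵥ X)) ≤ (M * M).trace * (X ⬝ᵥ (G *ᵥ X)) := by
  -- in a basis that is orthonormal for `G` the endomorphism becomes a symmetric matrix `Q`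
  obtain ⟨P, hP⟩ : ∃ P : Matrix ι ι ℝ, G = Pᵀ * P := by
    obtain ⟨P, hP⟩ := CStarAlgebra.nonneg_iff_eq_star_mul_self.mp hG.posSemidef.nonneg
    exact ⟨P, hP⟩
  have hdet : IsUnit P.det := by
    have h := hG.det_pos
    rw [hP, Matrix.det_mul] at h
    exact isUnit_iff_ne_zero.2 fun h0 => by simp [h0] at h
  have hPi : P⁻¹ * P = 1 := Matrix.nonsing_inv_mul _ hdet
  have hPi' : P * P⁻¹ = 1 := Matrix.mul_nonsing_inv _ hdet
  have hPt : P⁻¹ᵀ * Pᵀ = 1 := by rw [← Matrix.transpose_mul, hPi', Matrix.transpose_one]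
  set Q := P * M * P⁻¹ with hQ
  have hQt : Qᵀ = Q := by
    have h1 : Mᵀ * (Pᵀ * P) = Pᵀ * P * M := by
      have hGt : Gᵀ = G := by rw [hP, Matrix.transpose_mul, Matrix.transpose_transpose]
      rw [← hP, ← hM, Matrix.transpose_mul, hGt]
    calc Qᵀ = P⁻¹ᵀ * (Mᵀ * (Pᵀ * P)) * P⁻¹ := by
          simp only [hQ, Matrix.transpose_mul, Matrix.mul_assoc, hPi', Matrix.mul_one]
      _ = (P⁻¹ᵀ * Pᵀ) * (P * M) * P⁻¹ := by rw [h1]; simp only [Matrix.mul_assoc]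
      _ = Q := by rw [hPt, Matrix.one_mul]
  have htr : (M * M).trace = ∑ i, ∑ j, Q i j ^ 2 := by
    have h1 : (M * M).trace = (Q * Q).trace := by
      have : Q * Q = P * (M * M) * P⁻¹ := by
        calc Q * Q = P * M * (P⁻¹ * P) * M * P⁻¹ := by simp only [hQ, Matrix.mul_assoc]
          _ = _ := by rw [hPi]; simp only [Matrix.mul_assoc, Matrix.mul_one]
      rw [this, Matrix.trace_mul_comm (P * (M * M)), ← Matrix.mul_assoc, hPi, Matrix.one_mul]
    rw [h1]
    simp only [Matrix.trace, Matrix.diag, Matrix.mul_apply]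
    refine Finset.sum_congr rfl fun i _ => Finset.sum_congr rfl fun j _ => ?_
    rw [pow_two]
    congr 1
    conv_lhs => rw [← hQt, Matrix.transpose_apply]
  have hquad : ∀ Y : ι → ℝ, Y ⬝ᵥ (G *ᵥ Y) = ∑ i, (P *ᵥ Y) i ^ 2 := by
    intro Y
    rw [hP, ← Matrix.mulVec_mulVec, Matrix.dotProduct_mulVec, Matrix.vecMul_transpose]
    simp only [dotProduct, pow_two]
  have hPM : P *ᵥ (M *ᵥ X) = Q *ᵥ (P *ᵥ X) := by
    simp only [Matrix.mulVec_mulVec, hQ, Matrix.mul_assoc, hPi, Matrix.mul_one]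
  refine ⟨htr ▸ Finset.sum_nonneg fun i _ => Finset.sum_nonneg fun j _ => sq_nonneg _, ?_⟩
  rw [hquad, hquad, hPM, htr, Finset.sum_mul]
  exact Finset.sum_le_sum fun i _ => Finset.sum_mul_sq_le_sq_mul_sq _ _ _

variable {m : ℕ} {N : Type*} [TopologicalSpace N]
  [ChartedSpace (EuclideanSpace ℝ (Fin m)) N] [IsManifold (𝓡 m) ∞ N]
  {g : Metric m N} {p : N} {y : E m} {v : E m → ℝ}

lemma sum_pd_gram_mul_gradC (hv : ContDiffOn ℝ ∞ v (coordDomain m p)) (hy : y ∈ coordDomain m p)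
    (i l : Fin m) :
    ∑ k, gram g p y l k * pd i (gradC g p v k) y
      = pd i (pd l v) y - ∑ k, pd i (fun z => gram g p z l k) y * gradC g p v k y := by
  have h := pd_congr_on i (isOpen_coordDomain p) hy
    (fun z hz => (sum_gram_mul_gradC (g := g) (v := v) hz l).symm)
  have hG := fun k => (contDiffOn_gram g p l k).diffAt hy
  have hX := fun k => (contDiffOn_gradC (g := g) hv k).diffAt hy
  rw [h, pd_sum_mul _ _ hG hX, Finset.sum_add_distrib]
  ring

/-- The Hessian `∑ₖ gₗₖ ∇ᵢXᵏ = ∂ᵢ∂ₗv - ∑ⱼ Γʲᵢₗ ∂ⱼv`, in a form visibly symmetric in `i` and `l`. -/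
lemma sum_gram_mul_hessC (hv : ContDiffOn ℝ ∞ v (coordDomain m p)) (hy : y ∈ coordDomain m p)
    (i l : Fin m) :
    ∑ k, gram g p y l k * hessC g p v k i y = pd i (pd l v) y
      + (1 / 2) * ∑ j, (pd j (fun z => gram g p z i l) y - pd i (fun z => gram g p z l j) y
        - pd l (fun z => gram g p z i j) y) * gradC g p v j y := by
  simp only [hessC, mul_add, Finset.sum_add_distrib, sum_pd_gram_mul_gradC hv hy]
  have h : ∑ k, gram g p y l k * ∑ j, christoffel g p k i j y * gradC g p v j y
      = ∑ j, (1 / 2) * (pd i (fun z => gram g p z j l) y + pd j (fun z => gram g p z i l) y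
      - pd l (fun z => gram g p z i j) y) * gradC g p v j y := by
    simp only [← sum_gram_mul_christoffel hy, Finset.mul_sum, Finset.sum_mul]
    rw [Finset.sum_comm]
    exact Finset.sum_congr rfl fun _ _ => Finset.sum_congr rfl fun _ _ => by ring
  rw [h, Finset.mul_sum, sub_add, ← Finset.sum_sub_distrib, sub_eq_add_neg,
    ← Finset.sum_neg_distrib]
  congr 1
  refine Finset.sum_congr rfl fun j _ => ?_
  rw [pd_gram_symm i j l]
  ring

lemma sum_gram_mul_hessC_symm (hv : ContDiffOn ℝ ∞ v (coordDomain m p))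
    (hy : y ∈ coordDomain m p) (i l : Fin m) :
    ∑ k, gram g p y l k * hessC g p v k i y = ∑ k, gram g p y i k * hessC g p v k l y := by
  rw [sum_gram_mul_hessC hv hy, sum_gram_mul_hessC hv hy,
    pd_comm i l hv (isOpen_coordDomain p) hy]
  congr 2
  refine Finset.sum_congr rfl fun j _ => ?_
  rw [pd_gram_symm j i l]
  ring

lemma pd_gradSqC (hv : ContDiffOn ℝ ∞ v (coordDomain m p)) (hy : y ∈ coordDomain m p)
    (i : Fin m) :
    pd i (gradSqC g p v) y
      = 2 * ∑ j, (∑ k, gram g p y i k * hessC g p v k j y) * gradC g p v j y := by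
  have hX := fun k => (contDiffOn_gradC (g := g) hv k).diffAt hy
  have hV := fun k => (contDiffOn_pd k hv (isOpen_coordDomain p)).diffAt hy
  have h1 : pd i (gradSqC g p v) y = ∑ k, (pd i (gradC g p v k) y * pd k v y
      + gradC g p v k y * pd i (pd k v) y) :=
    pd_sum_mul _ _ hX hV
  have h2 : ∑ k, pd i (gradC g p v k) y * pd k v y
      = ∑ l, (∑ k, gram g p y l k * pd i (gradC g p v k) y) * gradC g p v l y := by
    simp only [← sum_gram_mul_gradC (g := g) (v := v) hy, Finset.mul_sum, Finset.sum_mul]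
    rw [Finset.sum_comm]
    refine Finset.sum_congr rfl fun l _ => Finset.sum_congr rfl fun k _ => ?_
    rw [gram_symm g p y k l]
    ring
  rw [h1, Finset.sum_add_distrib, h2]
  simp only [sum_gram_mul_hessC_symm hv hy _ i]
  simp only [sum_gram_mul_hessC hv hy i, sum_pd_gram_mul_gradC hv hy i]
  -- the part of the Christoffel symbols that is antisymmetric in `j` and `k` cancels
  have h3 : ∑ j, ∑ k, pd k (fun z => gram g p z i j) y * gradC g p v k y * gradC g p v j y
      = ∑ j, ∑ k, pd j (fun z => gram g p z i k) y * gradC g p v k y * gradC g p v j y := by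
    rw [Finset.sum_comm]
    exact Finset.sum_congr rfl fun _ _ => Finset.sum_congr rfl fun _ _ => by ring
  simp only [sub_mul, add_mul, mul_add, mul_sub, Finset.sum_add_distrib, Finset.sum_sub_distrib,
    Finset.sum_mul, Finset.mul_sum] at h3 ⊢
  have h4 : ∑ k, gradC g p v k y * pd i (pd k v) y = ∑ k, pd i (pd k v) y * gradC g p v k y :=
    Finset.sum_congr rfl fun k _ => mul_comm _ _
  have h5 : ∀ a : Fin m → Fin m → ℝ, ∑ j, ∑ k, 2 * (1 / 2 * a j k * gradC g p v j y)
      = ∑ j, ∑ k, a j k * gradC g p v j y := fun a =>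
    Finset.sum_congr rfl fun _ _ => Finset.sum_congr rfl fun _ _ => by ring
  have h6 : ∑ k, 2 * (pd i (pd k v) y * gradC g p v k y)
      = 2 * ∑ k, pd i (pd k v) y * gradC g p v k y := by rw [Finset.mul_sum]
  rw [h4, h5, h5, h5, h6, h3]
  ring

lemma gradC_gradSqC (hv : ContDiffOn ℝ ∞ v (coordDomain m p)) (hy : y ∈ coordDomain m p)
    (i : Fin m) :
    gradC g p (gradSqC g p v) i y = 2 * ∑ j, hessC g p v i j y * gradC g p v j y := by
  have h : ∀ j, hessC g p v i j y
      = ∑ l, (gram g p y)⁻¹ i l * ∑ k, gram g p y l k * hessC g p v k j y := by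
    intro j
    simp only [Finset.mul_sum]
    rw [Finset.sum_comm]
    simp only [← mul_assoc, ← Finset.sum_mul, sum_inv_mul_gram hy]
    simp
  have h' : gradC g p (gradSqC g p v) i y
      = ∑ l, (gram g p y)⁻¹ i l * pd l (gradSqC g p v) y := rfl
  rw [h']
  simp only [pd_gradSqC hv hy]
  simp only [h, Finset.sum_mul _ _ (gradC g p v _ y)]
  rw [Finset.sum_comm, Finset.mul_sum]
  refine Finset.sum_congr rfl fun l _ => ?_
  rw [mul_left_comm, Finset.mul_sum]
  simp only [mul_assoc, Finset.sum_mul]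

lemma lapC_eq_sum_hessC : lapC g p v y = ∑ i, hessC g p v i i y := by
  simp only [lapC, divC, hessC, Finset.sum_add_distrib]
  congr 1
  rw [Finset.sum_comm]

lemma pd_hessC (hv : ContDiffOn ℝ ∞ v (coordDomain m p)) (hy : y ∈ coordDomain m p)
    (j i l : Fin m) :
    pd j (hessC g p v i l) y = pd j (pd l (gradC g p v i)) y
      + ∑ k, (pd j (christoffel g p i l k) y * gradC g p v k y
        + christoffel g p i l k y * pd j (gradC g p v k) y) := by
  have hX := fun k => (contDiffOn_gradC (g := g) hv k).diffAt hy
  have hΓ := fun k => (contDiffOn_christoffel (g := g) i l k).diffAt hy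
  change pd j (fun z => pd l (gradC g p v i) z + ∑ k, christoffel g p i l k z * gradC g p v k z) y
    = _
  rw [pd_add j ((contDiffOn_pd l (contDiffOn_gradC hv i) (isOpen_coordDomain p)).diffAt hy)
    (differentiableAt_sum_mul _ hΓ hX), pd_sum_mul _ _ hΓ hX]

/-- The **Bochner formula** `½ Δ|∇v|² - ⟨∇v, ∇Δv⟩ = tr((∇²v)²) + Ric(∇v, ∇v)`. -/
theorem bochner (hv : ContDiffOn ℝ ∞ v (coordDomain m p)) (hy : y ∈ coordDomain m p) :
    (1 / 2) * lapC g p (gradSqC g p v) y - ∑ l, gradC g p v l y * pd l (lapC g p v) y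
      = ∑ i, ∑ l, hessC g p v i l y * hessC g p v l i y
        + ∑ i, ∑ j, ricci g p y i j * gradC g p v i y * gradC g p v j y := by
  have hX := fun k => (contDiffOn_gradC (g := g) hv k).diffAt hy
  have hM := fun k i => (contDiffOn_hessC (g := g) hv k i).diffAt hy
  have h := bochner_contraction (fun k => gradC g p v k y) (fun k i => hessC g p v k i y)
    (fun i k => pd i (gradC g p v k) y) (fun k i j => christoffel g p k i j y)
    (fun j l i => pd j (pd l (gradC g p v i)) y) (fun a k i j => pd a (christoffel g p k i j) y)
    (fun j i l => pd j (hessC g p v i l) y)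
    (fun k i j => by rw [christoffel_symm]) (fun a k i j => by rw [christoffel_symm])
    (fun i l k => pd_comm i l (contDiffOn_gradC hv k) (isOpen_coordDomain p) hy)
    (fun k i => by simp [hessC]) (fun j i l => pd_hessC hv hy j i l)
  simp only [ricci]
  rw [← h]
  have h1 : ∀ l, pd l (lapC g p v) y = ∑ i, pd l (hessC g p v i i) y := by
    intro l
    rw [pd_congr l (Filter.Eventually.of_forall fun z => lapC_eq_sum_hessC (g := g)),
      pd_sum _ _ fun i _ => hM i i]
  have h2 : ∀ i, pd i (gradC g p (gradSqC g p v) i) y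
      = 2 * ∑ j, (pd i (hessC g p v i j) y * gradC g p v j y
        + hessC g p v i j y * pd i (gradC g p v j) y) := by
    intro i
    rw [pd_congr_on i (isOpen_coordDomain p) hy (fun z hz => gradC_gradSqC hv hz i),
      pd_const_mul _ _ (differentiableAt_sum_mul _ (hM i) hX), pd_sum_mul _ _ (hM i) hX]
  simp only [lapC, divC] at h1 ⊢
  simp only [h1, h2, gradC_gradSqC hv hy, ← Finset.mul_sum]
  simp only [mul_left_comm _ (2 : ℝ), ← Finset.mul_sum]
  ring

/-- Bochner's formula and Cauchy–Schwarz for the Hessian: where `Ric ≥ κ g`, the function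
`T = ½ Δ|∇v|² - ⟨∇v, ∇Δv⟩ - κ |∇v|²` satisfies `|∇|∇v|²|² ≤ 4 T |∇v|²`. -/
theorem bochner_inequality (hv : ContDiffOn ℝ ∞ v (coordDomain m p)) (hy : y ∈ coordDomain m p)
    {κ : ℝ} (hκ : ∀ w : Fin m → ℝ, κ * ∑ i, ∑ j, gram g p y i j * w i * w j
      ≤ ∑ i, ∑ j, ricci g p y i j * w i * w j) :
    let T := (1 / 2) * lapC g p (gradSqC g p v) y - ∑ l, gradC g p v l y * pd l (lapC g p v) y
      - κ * gradSqC g p v y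
    0 ≤ T ∧ gradSqC g p (gradSqC g p v) y ≤ 4 * T * gradSqC g p v y := by
  intro T
  have hT : ∑ i, ∑ l, hessC g p v i l y * hessC g p v l i y ≤ T := by
    have h := hκ fun i => gradC g p v i y
    rw [← gradSqC_eq_sum_gram hy] at h
    have h' := bochner (g := g) hv hy
    simp only [T]
    linarith
  have hcs := sum_mulVec_sq_le (posDef_gram g hy) (M := Matrix.of fun k i => hessC g p v k i y)
    (by
      ext i l
      simp only [Matrix.transpose_apply, Matrix.mul_apply, Matrix.of_apply]
      exact sum_gram_mul_hessC_symm hv hy i l) fun k => gradC g p v k y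
  have htr : ((Matrix.of fun k i => hessC g p v k i y) *
      (Matrix.of fun k i => hessC g p v k i y)).trace
      = ∑ i, ∑ l, hessC g p v i l y * hessC g p v l i y := by
    simp [Matrix.trace, Matrix.mul_apply]
  have hq : ∀ Y : Fin m → ℝ, dotProduct Y ((gram g p y).mulVec Y)
      = ∑ k, ∑ l, gram g p y k l * Y k * Y l := by
    intro Y
    simp only [dotProduct, Matrix.mulVec, Finset.mul_sum]
    exact Finset.sum_congr rfl fun _ _ => Finset.sum_congr rfl fun _ _ => by ring
  rw [htr, hq, hq, ← gradSqC_eq_sum_gram hy] at hcs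
  refine ⟨hcs.1.trans hT, ?_⟩
  have he : 0 ≤ gradSqC g p v y := by
    rw [gradSqC_eq_sum_gram hy, ← hq]
    simpa using (posDef_gram g hy).posSemidef.dotProduct_mulVec_nonneg fun k => gradC g p v k y
  have h4 : gradSqC g p (gradSqC g p v) y = 4 * ∑ k, ∑ l, gram g p y k l *
      (Matrix.of (fun k i => hessC g p v k i y)).mulVec (fun k => gradC g p v k y) k *
      (Matrix.of (fun k i => hessC g p v k i y)).mulVec (fun k => gradC g p v k y) l := by
    rw [gradSqC_eq_sum_gram hy]
    simp only [gradC_gradSqC hv hy, Matrix.mulVec, dotProduct, Matrix.of_apply]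
    simp only [Finset.mul_sum (a := (4 : ℝ))]
    exact Finset.sum_congr rfl fun _ _ => Finset.sum_congr rfl fun _ _ => by ring
  rw [h4]
  nlinarith [mul_le_mul_of_nonneg_right hT he, hcs.2]

lemma contDiffOn_ricci (i j : Fin m) :
    ContDiffOn ℝ ∞ (fun y => ricci g p y i j) (coordDomain m p) := by
  have hΓ := fun k i j => contDiffOn_christoffel (g := g) (p := p) k i j
  have hd := fun a k i j => contDiffOn_pd a (hΓ k i j) (isOpen_coordDomain p)
  exact (ContDiffOn.sum fun k _ => (hd k k i j).sub (hd j k i k)).add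
    (ContDiffOn.sum fun k _ => ContDiffOn.sum fun l _ =>
      ((hΓ k k l).mul (hΓ l i j)).sub ((hΓ k j l).mul (hΓ l i k)))

/-- On a compact part of a chart, positive Ricci curvature has a positive lower bound. -/
lemma exists_ricci_lower_bound (hRic : PositiveRicci g) {K : Set (E m)} (hK : IsCompact K)
    (hKD : K ⊆ coordDomain m p) :
    ∃ κ > 0, ∀ y ∈ K, ∀ w : Fin m → ℝ, κ * ∑ i, ∑ j, gram g p y i j * w i * w j
      ≤ ∑ i, ∑ j, ricci g p y i j * w i * w j := by
  -- compare both quadratic forms on the compact set of unit vectors over `K`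
  set S : Set (E m × E m) := K ×ˢ Metric.sphere (0 : E m) 1 with hS
  have hSc : IsCompact S := hK.prod (isCompact_sphere _ _)
  have hcont : ∀ a : E m → Fin m → Fin m → ℝ,
      (∀ i j, ContinuousOn (fun y => a y i j) (coordDomain m p)) →
      ContinuousOn (fun z : E m × E m => ∑ i, ∑ j, a z.1 i j * z.2 i * z.2 j) S := by
    intro a ha
    refine continuousOn_finsetSum _ fun i _ => continuousOn_finsetSum _ fun j _ => ?_
    refine ContinuousOn.mul (ContinuousOn.mul ?_ ?_) ?_
    · exact (ha i j).comp continuousOn_fst fun z hz => hKD hz.1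
    · exact (by fun_prop : Continuous fun z : E m × E m => z.2 i).continuousOn
    · exact (by fun_prop : Continuous fun z : E m × E m => z.2 j).continuousOn
  have hR := hcont (fun y i j => ricci g p y i j) fun i j => (contDiffOn_ricci i j).continuousOn
  have hG := hcont (fun y i j => gram g p y i j) fun i j => (contDiffOn_gram g p i j).continuousOn
  have hpos : ∀ z ∈ S, 0 < ∑ i, ∑ j, ricci g p z.1 i j * z.2 i * z.2 j := by
    intro z hz
    refine hRic p z.1 (hKD hz.1) _ fun h => ?_
    have h1 : ‖z.2‖ = 1 := by simpa using hz.2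
    have h2 : z.2 = 0 := by
      ext i
      exact congrFun h i
    simp [h2] at h1
  obtain ⟨c, hc, hcS⟩ : ∃ c > 0, ∀ z ∈ S, c ≤ ∑ i, ∑ j, ricci g p z.1 i j * z.2 i * z.2 j := by
    rcases S.eq_empty_or_nonempty with h | h
    · exact ⟨1, one_pos, by simp [h]⟩
    · obtain ⟨z, hz, hmin⟩ := hSc.exists_isMinOn h hR
      exact ⟨_, hpos z hz, fun w hw => hmin hw⟩
  obtain ⟨C, hC⟩ := hSc.exists_bound_of_continuousOn hG
  refine ⟨c / (|C| + 1), by positivity, fun y hy w => ?_⟩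
  by_cases hw : w = 0
  · simp [hw]
  set x : E m := WithLp.toLp 2 w with hx
  have hx0 : x ≠ 0 := fun h => hw (by simpa [hx] using h)
  set r := ‖x‖ with hr
  have hr0 : 0 < r := norm_pos_iff.2 hx0
  have hz : (y, r⁻¹ • x) ∈ S := by
    refine ⟨hy, ?_⟩
    simp [norm_smul, abs_of_pos hr0, ← hr, hr0.ne']
  have hscale : ∀ a : Fin m → Fin m → ℝ, ∑ i, ∑ j, a i j * w i * w j
      = r ^ 2 * ∑ i, ∑ j, a i j * (r⁻¹ • x) i * (r⁻¹ • x) j := by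
    intro a
    simp only [Finset.mul_sum]
    refine Finset.sum_congr rfl fun i _ => Finset.sum_congr rfl fun j _ => ?_
    simp only [hx, PiLp.smul_apply, smul_eq_mul]
    field_simp
  rw [hscale (fun i j => gram g p y i j), hscale (fun i j => ricci g p y i j)]
  have h1 := hcS _ hz
  have h2 := (le_abs_self _).trans (hC _ hz)
  simp only at h1 h2
  have h3 : c / (|C| + 1) * (∑ i, ∑ j, gram g p y i j * (r⁻¹ • x) i * (r⁻¹ • x) j) ≤ c := by
    rw [div_mul_eq_mul_div, div_le_iff₀ (by positivity)]
    have := le_abs_self C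
    nlinarith
  calc _ = r ^ 2 * (c / (|C| + 1) *
        (∑ i, ∑ j, gram g p y i j * (r⁻¹ • x) i * (r⁻¹ • x) j)) := by ring
    _ ≤ _ := mul_le_mul_of_nonneg_left (h3.trans h1) (by positivity)

end Bochner

/-! ### Integral operators with concentrating kernels -/

section ConcentratingKernels

open Filter Topology ENNReal

variable {m : ℕ}

/-- The kernels `K k x y` concentrate on the diagonal at the scale `δ k` and have total mass
tending to `c`, uniformly in `x`. -/
structure IsConcentrating (K : ℕ → E m → E m → ℝ) (δ : ℕ → ℝ) (c : ℝ) : Prop where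
  measurable : ∀ k, Measurable (Function.uncurry (K k))
  bound : ∃ C : ℝ, ∀ k x y, |K k x y| ≤ C / δ k ^ m
  support : ∀ k x y, δ k < dist x y → K k x y = 0
  mass : ∀ ε > 0, ∀ᶠ k in atTop, ∀ x, |(∫ y, K k x y) - c| ≤ ε

lemma memLp_two_integrable_closedBall {w : E m → ℝ} (hw : MemLp w 2 volume) (x : E m) (r : ℝ) :
    IntegrableOn w (Metric.closedBall x r) := by
  have : IsFiniteMeasure (volume.restrict (Metric.closedBall x r)) :=
    ⟨by simpa using measure_closedBall_lt_top⟩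
  exact (hw.restrict (Metric.closedBall x r)).integrable (by norm_num)

namespace IsConcentrating

variable {K : ℕ → E m → E m → ℝ} {δ : ℕ → ℝ} {c : ℝ}

lemma integrable_mul (hK : IsConcentrating K δ c) {w : E m → ℝ}
    (hw : MemLp w 2 volume) (k : ℕ) (x : E m) : Integrable fun y => K k x y * w y := by
  obtain ⟨C, hC⟩ := hK.bound
  have h1 : Integrable (fun y => K k x y * w y) (volume.restrict (Metric.closedBall x (δ k))) :=
    (memLp_two_integrable_closedBall hw x (δ k)).bdd_mul
      ((hK.measurable k).of_uncurry_left.aestronglyMeasurable)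
      (ae_of_all _ fun y => (hC k x y))
  refine IntegrableOn.integrable_of_forall_notMem_eq_zero h1 fun y hy => ?_
  rw [hK.support k x y (by simpa [dist_comm] using hy), zero_mul]

lemma aestronglyMeasurable (hK : IsConcentrating K δ c) {w : E m → ℝ}
    (hw : MemLp w 2 volume) (k : ℕ) :
    AEStronglyMeasurable (fun x => ∫ y, K k x y * w y) volume := by
  have h : AEStronglyMeasurable (fun z : E m × E m => K k z.1 z.2 * w z.2)
      (volume.prod volume) :=
    (hK.measurable k).aestronglyMeasurable.mul hw.1.comp_snd
  exact h.integral_prod_right'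

/-- The integral operators with concentrating kernels are uniformly bounded on `L²`: by the
Cauchy–Schwarz inequality on balls of radius `δ k` and Tonelli's theorem, with the bound
`C · vol B(0, 1)`. -/
lemma exists_eLpNorm_le (hK : IsConcentrating K δ c) (hδ : ∀ k, 0 < δ k) :
    ∃ C : ℝ≥0∞, C ≠ ⊤ ∧ ∀ w : E m → ℝ, MemLp w 2 volume → ∀ k,
      eLpNorm (fun x => ∫ y, K k x y * w y) 2 volume ≤ C * eLpNorm w 2 volume := by
  obtain ⟨C, hC⟩ := hK.bound
  set v₁ : ℝ≥0∞ := volume (Metric.closedBall (0 : E m) 1) with hv₁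
  have hv₁' : v₁ ≠ ⊤ := measure_closedBall_lt_top.ne
  refine ⟨ENNReal.ofReal C * v₁, ENNReal.mul_ne_top ENNReal.ofReal_ne_top hv₁', ?_⟩
  intro w hw k
  set A : ℝ≥0∞ := ENNReal.ofReal (C / δ k ^ m) with hA
  have hball : ∀ x : E m, volume (Metric.closedBall x (δ k)) = ENNReal.ofReal (δ k ^ m) * v₁ := by
    intro x
    rw [Measure.addHaar_closedBall' _ _ (hδ k).le, finrank_euclideanSpace_fin]
  have hAV : A * (ENNReal.ofReal (δ k ^ m) * v₁) = ENNReal.ofReal C * v₁ := by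
    rw [← mul_assoc, hA, mul_comm (ENNReal.ofReal _),
      ← ENNReal.ofReal_mul (by have := hδ k; positivity)]
    congr 2
    field_simp [(pow_pos (hδ k) m).ne']
  set V : ℝ≥0∞ := ENNReal.ofReal (δ k ^ m) * v₁ with hV
  obtain ⟨w', hw'm, hw'⟩ : ∃ w' : E m → ℝ, Measurable w' ∧ w =ᵐ[volume] w' :=
    ⟨hw.1.mk w, hw.1.stronglyMeasurable_mk.measurable, hw.1.ae_eq_mk⟩
  have hS : ∀ f : E m → ℝ, eLpNorm f 2 volume = (∫⁻ x, ‖f x‖ₑ ^ (2 : ℝ)) ^ (1 / 2 : ℝ) := by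
    intro f
    rw [eLpNorm_eq_lintegral_rpow_enorm_toReal (by norm_num) (by norm_num)]
    norm_num
  set D : Set (E m × E m) := {z | dist z.2 z.1 ≤ δ k} with hD
  have hDm : MeasurableSet D :=
    (isClosed_le (by fun_prop) continuous_const).measurableSet
  have hDx : ∀ x (f : E m → ℝ≥0∞), ∫⁻ y, D.indicator (fun z => f z.2) (x, y)
      = ∫⁻ y in Metric.closedBall x (δ k), f y := by
    intro x f
    rw [← lintegral_indicator measurableSet_closedBall]
    rfl
  have hpt : ∀ x, ‖∫ y, K k x y * w y‖ₑ ^ (2 : ℝ)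
      ≤ A ^ (2 : ℝ) * V * ∫⁻ y, D.indicator (fun z => ‖w' z.2‖ₑ ^ (2 : ℝ)) (x, y) := by
    intro x
    have h1 : ‖∫ y, K k x y * w y‖ₑ ≤ A * ∫⁻ y, D.indicator (fun z => ‖w' z.2‖ₑ) (x, y) := by
      refine (enorm_integral_le_lintegral_enorm _).trans ?_
      rw [← lintegral_const_mul' _ _ ENNReal.ofReal_ne_top]
      refine lintegral_mono_ae ?_
      filter_upwards [hw'] with y hy
      rw [hy, enorm_mul]
      by_cases hxy : (x, y) ∈ D
      · rw [Set.indicator_of_mem hxy, ← ofReal_norm (K k x y)]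
        gcongr
        exact hC k x y
      · rw [hK.support k x y (by simpa [D, dist_comm] using hxy)]
        simp
    have h2 := eLpNorm_le_eLpNorm_mul_rpow_measure_univ (p := 1) (q := 2) (f := w')
      (μ := volume.restrict (Metric.closedBall x (δ k))) (by norm_num)
      hw'm.aestronglyMeasurable
    rw [eLpNorm_one_eq_lintegral_enorm, Measure.restrict_apply_univ, hball,
      eLpNorm_eq_lintegral_rpow_enorm_toReal (by norm_num) (by norm_num), ← hDx x fun y => ‖w' y‖ₑ]
      at h2
    calc ‖∫ y, K k x y * w y‖ₑ ^ (2 : ℝ)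
        ≤ (A * ((∫⁻ y in Metric.closedBall x (δ k), ‖w' y‖ₑ ^ (2 : ℝ)) ^ (1 / 2 : ℝ)
            * V ^ (1 / 2 : ℝ))) ^ (2 : ℝ) := by
          gcongr
          refine h1.trans ?_
          gcongr
          refine h2.trans (le_of_eq ?_)
          norm_num
      _ = _ := by
          rw [ENNReal.mul_rpow_of_nonneg _ _ (by norm_num), ENNReal.mul_rpow_of_nonneg _ _
            (by norm_num), ← ENNReal.rpow_mul, ← ENNReal.rpow_mul,
            hDx x fun y => ‖w' y‖ₑ ^ (2 : ℝ)]
          norm_num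
          ring
  have hfub : ∫⁻ x, ∫⁻ y, D.indicator (fun z => ‖w' z.2‖ₑ ^ (2 : ℝ)) (x, y)
      = V * ∫⁻ y, ‖w' y‖ₑ ^ (2 : ℝ) := by
    have hm : Measurable (D.indicator fun z => ‖w' z.2‖ₑ ^ (2 : ℝ)) :=
      ((hw'm.comp measurable_snd).enorm.pow_const _).indicator hDm
    rw [lintegral_lintegral_swap
      (f := fun x y => D.indicator (fun z => ‖w' z.2‖ₑ ^ (2 : ℝ)) (x, y)) hm.aemeasurable,
      ← lintegral_const_mul _ (hw'm.enorm.pow_const _)]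
    refine lintegral_congr fun y => ?_
    have h : ∀ x, D.indicator (fun z => ‖w' z.2‖ₑ ^ (2 : ℝ)) (x, y)
        = (Metric.closedBall y (δ k)).indicator (fun _ => ‖w' y‖ₑ ^ (2 : ℝ)) x := by
      intro x
      simp only [Set.indicator, Metric.mem_closedBall, D, Set.mem_ofPred_eq, dist_comm]
    simp only [h]
    rw [lintegral_indicator_const measurableSet_closedBall, hball, mul_comm]
  have hw'' : ∫⁻ x, ‖w x‖ₑ ^ (2 : ℝ) = ∫⁻ x, ‖w' x‖ₑ ^ (2 : ℝ) := by
    refine lintegral_congr_ae ?_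
    filter_upwards [hw'] with y hy
    rw [hy]
  have hVne : V ≠ ⊤ := ENNReal.mul_ne_top ENNReal.ofReal_ne_top hv₁'
  rw [hS, hS]
  calc (∫⁻ x, ‖∫ y, K k x y * w y‖ₑ ^ (2 : ℝ)) ^ (1 / 2 : ℝ)
      ≤ ((A * V) ^ (2 : ℝ) * ∫⁻ y, ‖w y‖ₑ ^ (2 : ℝ)) ^ (1 / 2 : ℝ) := by
        gcongr
        refine (lintegral_mono hpt).trans ?_
        rw [lintegral_const_mul' _ _ (ENNReal.mul_ne_top (by simp [A]) hVne), hfub, hw'']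
        rw [← mul_assoc, ENNReal.mul_rpow_of_nonneg _ _ (by norm_num : (0 : ℝ) ≤ 2)]
        apply le_of_eq
        congr 1
        rw [mul_assoc]
        congr 1
        norm_num [pow_two]
    _ = ENNReal.ofReal C * v₁ * (∫⁻ x, ‖w x‖ₑ ^ (2 : ℝ)) ^ (1 / 2 : ℝ) := by
        rw [ENNReal.mul_rpow_of_nonneg _ _ (by norm_num), ← ENNReal.rpow_mul, hAV]
        norm_num

/-- Integral operators with kernels concentrating on the diagonal converge strongly on `L²`
to multiplication by the limit `c` of their mass: uniformly on continuous functions of compact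
support, and on `L²` by density and the uniform bound. -/
theorem tendsto_eLpNorm (hK : IsConcentrating K δ c) (hδ : ∀ k, 0 < δ k)
    (hδ0 : Tendsto δ atTop (𝓝 0)) {w : E m → ℝ} (hw : MemLp w 2 volume) :
    Tendsto (fun k => eLpNorm (fun x => (∫ y, K k x y * w y) - c * w x) 2 volume) atTop
      (𝓝 0) := by
  obtain ⟨B, hB, hBw⟩ := hK.exists_eLpNorm_le hδ
  rw [ENNReal.tendsto_nhds_zero]
  intro ε hε
  -- split `ε` between the approximation error and the error for a continuous function
  set B' : ℝ≥0∞ := B + ‖c‖ₑ + 1 with hB'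
  have hB'ne : B' ≠ ⊤ := by simp [B', hB]
  have hε2 : ε / 2 ≠ 0 := (ENNReal.half_pos hε.ne').ne'
  obtain ⟨f, hfc, hfw, hfcont, hfL⟩ := hw.exists_hasCompactSupport_eLpNorm_sub_le
    (p := 2) (by norm_num) (ε := ε / 2 / B') (ENNReal.div_ne_zero.2 ⟨hε2, hB'ne⟩)
  have hcont : Tendsto (fun k => eLpNorm (fun x => (∫ y, K k x y * f y) - c * f x) 2 volume)
      atTop (𝓝 0) := by
    set L := Metric.cthickening 1 (tsupport f) with hL
    have hLc : IsCompact L := hfc.isCompact.cthickening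
    have hLv : volume L ≠ ⊤ := hLc.measure_lt_top.ne
    obtain ⟨C, hC⟩ := hK.bound
    set V : ℝ := (volume (Metric.closedBall (0 : E m) 1)).toReal with hV
    have hball : ∀ k (x : E m), (volume (Metric.closedBall x (δ k))).toReal = δ k ^ m * V := by
      intro k x
      rw [Measure.addHaar_closedBall' _ _ (hδ k).le, finrank_euclideanSpace_fin,
        ENNReal.toReal_mul, ENNReal.toReal_ofReal (pow_pos (hδ k) m).le]
    obtain ⟨S, hS⟩ := hfcont.bounded_above_of_compact_support hfc
    have hunif := hfc.uniformContinuous_of_continuous hfcont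
    have key : ∀ η > 0, ∀ᶠ k in atTop, ∀ x, |(∫ y, K k x y * f y) - c * f x| ≤ η := by
      intro η hη
      have hη1 : 0 < η / 2 / (|C| * V + 1) := by positivity
      obtain ⟨r, hr, hrf⟩ := Metric.uniformContinuous_iff.1 hunif _ hη1
      filter_upwards [hK.mass (η / 2 / (|S| + 1)) (by positivity),
        hδ0.eventually (gt_mem_nhds hr)] with k hmass hkr x
      have hi1 := hK.integrable_mul hfL k x
      have hKi : Integrable fun y => K k x y := by
        have h1 : Integrable (fun y => K k x y) (volume.restrict (Metric.closedBall x (δ k))) := by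
          refine Measure.integrableOn_of_bounded (M := C / δ k ^ m)
            measure_closedBall_lt_top.ne
            (hK.measurable k).of_uncurry_left.aestronglyMeasurable (ae_of_all _ fun y => hC k x y)
        refine IntegrableOn.integrable_of_forall_notMem_eq_zero h1 fun y hy => ?_
        exact hK.support k x y (by simpa [dist_comm] using hy)
      have hsplit : (∫ y, K k x y * f y) - c * f x
          = (∫ y, K k x y * (f y - f x)) + ((∫ y, K k x y) - c) * f x := by
        simp only [mul_sub]
        rw [integral_sub hi1 (hKi.mul_const _), integral_mul_const]
        ring
      have h1 : |∫ y, K k x y * (f y - f x)| ≤ η / 2 := by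
        have h0 : ∫ y, K k x y * (f y - f x)
            = ∫ y in Metric.closedBall x (δ k), K k x y * (f y - f x) := by
          refine (setIntegral_eq_integral_of_forall_compl_eq_zero fun y hy => ?_).symm
          rw [hK.support k x y (by simpa [dist_comm] using hy), zero_mul]
        rw [h0]
        have h2 := norm_setIntegral_le_of_norm_le_const (μ := volume)
          (f := fun y => K k x y * (f y - f x)) (s := Metric.closedBall x (δ k))
          (C := |C| / δ k ^ m * (η / 2 / (|C| * V + 1))) measure_closedBall_lt_top fun y hy => by
            rw [Real.norm_eq_abs, abs_mul]
            have hd : |f y - f x| ≤ η / 2 / (|C| * V + 1) := by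
              rw [← Real.dist_eq]
              exact (hrf ((Metric.mem_closedBall.1 hy).trans_lt hkr)).le
            have hc' : |K k x y| ≤ |C| / δ k ^ m := (hC k x y).trans
              (div_le_div_of_nonneg_right (le_abs_self C) (pow_pos (hδ k) m).le)
            have hc0 := (abs_nonneg _).trans hc'
            gcongr
        rw [measureReal_def, hball, Real.norm_eq_abs] at h2
        refine h2.trans ?_
        have hδm := pow_pos (hδ k) m
        have : |C| / δ k ^ m * (η / 2 / (|C| * V + 1)) * (δ k ^ m * V)
            = (η / 2) * ((|C| * V) / (|C| * V + 1)) := by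
          field_simp
        rw [this]
        have hV0 : 0 ≤ |C| * V := by positivity
        have : (|C| * V) / (|C| * V + 1) ≤ 1 := (div_le_one (by positivity)).2 (by linarith)
        nlinarith
      have h2 : |((∫ y, K k x y) - c) * f x| ≤ η / 2 := by
        rw [abs_mul]
        have hfx : |f x| ≤ |S| + 1 := by
          have := (hS x).trans (le_abs_self S)
          rw [Real.norm_eq_abs] at this
          linarith
        calc _ ≤ η / 2 / (|S| + 1) * (|S| + 1) :=
              mul_le_mul (hmass x) hfx (abs_nonneg _) (by positivity)
          _ = η / 2 := by field_simp
      rw [hsplit]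
      exact (abs_add_le _ _).trans (by linarith)
    have hzero : ∀ᶠ k in atTop, ∀ x ∉ L, (∫ y, K k x y * f y) - c * f x = 0 := by
      filter_upwards [hδ0.eventually (gt_mem_nhds one_pos)] with k hk x hx
      have hfx : f x = 0 := by
        by_contra h
        exact hx (Metric.self_subset_cthickening _ (subset_tsupport f h))
      rw [hfx, mul_zero, sub_zero]
      refine integral_eq_zero_of_ae (ae_of_all _ fun y => ?_)
      by_cases hy : f y = 0
      · simp [hy]
      · have : δ k < dist x y := by
          by_contra h
          exact hx (Metric.mem_cthickening_of_dist_le x y 1 _ (subset_tsupport f hy)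
            ((not_lt.1 h).trans hk.le))
        simp [hK.support k x y this]
    rw [ENNReal.tendsto_nhds_zero]
    intro ε' hε'
    obtain ⟨η, hη, hηε⟩ : ∃ η : ℝ, 0 < η ∧
        ENNReal.ofReal η * volume L ^ (1 / 2 : ℝ) ≤ ε' := by
      have hne : volume L ^ (1 / 2 : ℝ) ≠ ⊤ := ENNReal.rpow_ne_top_of_nonneg (by norm_num) hLv
      obtain ⟨η, hη, h⟩ := ENNReal.exists_nnreal_pos_mul_lt hne hε'.ne'
      exact ⟨η, hη, by simpa using h.le⟩
    filter_upwards [key η hη, hzero] with k hk1 hk2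
    have hle : eLpNorm (fun x => (∫ y, K k x y * f y) - c * f x) 2 volume
        ≤ eLpNorm (L.indicator fun _ => η) 2 volume := by
      refine eLpNorm_mono fun x => ?_
      by_cases hx : x ∈ L
      · rw [Set.indicator_of_mem hx, Real.norm_eq_abs, Real.norm_eq_abs, abs_of_pos hη]
        exact hk1 x
      · rw [hk2 x hx]
        simp
    refine hle.trans ?_
    rw [eLpNorm_indicator_const hLc.measurableSet (by norm_num) (by norm_num)]
    refine le_trans (le_of_eq ?_) hηε
    rw [← ofReal_norm, Real.norm_eq_abs, abs_of_pos hη]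
    norm_num
  have hwf : MemLp (w - f) 2 volume := hw.sub hfL
  filter_upwards [ENNReal.tendsto_nhds_zero.1 hcont (ε / 2) (ENNReal.half_pos hε.ne')] with k hk
  have hdec : (fun x => (∫ y, K k x y * w y) - c * w x)
      = (fun x => ∫ y, K k x y * (w - f) y) + ((fun x => (∫ y, K k x y * f y) - c * f x)
        + fun x => -c * (w - f) x) := by
    ext x
    simp only [Pi.add_apply, Pi.sub_apply, mul_sub]
    rw [integral_sub (hK.integrable_mul hw k x) (hK.integrable_mul hfL k x)]
    ring
  have hm1 := hK.aestronglyMeasurable hwf k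
  have hm2 : AEStronglyMeasurable (fun x => (∫ y, K k x y * f y) - c * f x) volume :=
    (hK.aestronglyMeasurable hfL k).sub (hfL.1.const_mul c)
  have hm3 : AEStronglyMeasurable (fun x => -c * (w - f) x) volume := hwf.1.const_mul _
  rw [hdec]
  calc _ ≤ eLpNorm (fun x => ∫ y, K k x y * (w - f) y) 2 volume
        + (eLpNorm (fun x => (∫ y, K k x y * f y) - c * f x) 2 volume
          + eLpNorm (fun x => -c * (w - f) x) 2 volume) := by
        refine (eLpNorm_add_le hm1 (hm2.add hm3) (by norm_num)).trans ?_
        gcongr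
        exact eLpNorm_add_le hm2 hm3 (by norm_num)
    _ ≤ B * (ε / 2 / B') + (ε / 2 + ‖c‖ₑ * (ε / 2 / B')) := by
        gcongr
        · exact (hBw _ hwf k).trans (by gcongr)
        · have : (fun x => -c * (w - f) x) = (-c) • (w - f) := rfl
          rw [this, eLpNorm_const_smul, enorm_neg]
          gcongr
    _ = ε / 2 + (B + ‖c‖ₑ) * (ε / 2 / B') := by ring
    _ ≤ ε / 2 + B' * (ε / 2 / B') := by
        gcongr
        exact le_self_add
    _ ≤ ε / 2 + ε / 2 := by
        gcongr
        exact ENNReal.mul_div_le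
    _ = ε := ENNReal.add_halves ε

end IsConcentrating

end ConcentratingKernels

/-! ### Mollification and Friedrichs' commutator lemma -/

section Mollification

open Filter Topology

variable {m : ℕ}

/-- A fixed smooth bump function of integral one, supported in the closed unit ball. -/
def bump (m : ℕ) : E m → ℝ :=
  (⟨1 / 2, 1, by norm_num, by norm_num⟩ : ContDiffBump (0 : E m)).normed volume

/-- The mollifier `δ⁻ᵐ bump (x / δ)`. -/
def mollifier (δ : ℝ) (x : E m) : ℝ := (δ ^ m)⁻¹ * bump m (δ⁻¹ • x)

/-- The mollification of `z` at scale `δ`. -/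
def mollify (δ : ℝ) (z : E m → ℝ) (x : E m) : ℝ := ∫ y, mollifier δ (x - y) * z y

lemma contDiff_bump : ContDiff ℝ ∞ (bump m) := ContDiffBump.contDiff_normed _

lemma bump_eq_zero {x : E m} (hx : 1 < ‖x‖) : bump m x = 0 := by
  have h := ContDiffBump.support_normed_eq
    (⟨1 / 2, 1, by norm_num, by norm_num⟩ : ContDiffBump (0 : E m)) (μ := volume)
  by_contra h0
  have : x ∈ Metric.ball (0 : E m) 1 := h ▸ (Function.mem_support.2 h0)
  rw [mem_ball_zero_iff] at this
  linarith

lemma hasCompactSupport_bump : HasCompactSupport (bump m) :=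
  ContDiffBump.hasCompactSupport_normed _

lemma integral_bump : ∫ x, bump m x = 1 := ContDiffBump.integral_normed _

variable {δ : ℝ}

lemma contDiff_mollifier : ContDiff ℝ ∞ (mollifier (m := m) δ) :=
  contDiff_const.mul (contDiff_bump.comp (contDiff_id.const_smul _))

lemma mollifier_eq_zero (hδ : 0 < δ) {x : E m} (hx : δ < ‖x‖) : mollifier δ x = 0 := by
  rw [mollifier, bump_eq_zero, mul_zero]
  rw [norm_smul, norm_inv, Real.norm_eq_abs, abs_of_pos hδ, inv_mul_eq_div, one_lt_div hδ]
  exact hx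

lemma mollifier_nonneg (hδ : 0 < δ) (x : E m) : 0 ≤ mollifier δ x :=
  mul_nonneg (inv_nonneg.2 (pow_pos hδ m).le) (ContDiffBump.nonneg_normed _ _)

lemma tsupport_mollifier_subset (hδ : 0 < δ) :
    tsupport (mollifier (m := m) δ) ⊆ Metric.closedBall 0 δ := by
  refine closure_minimal (fun x hx => ?_) Metric.isClosed_closedBall
  rw [mem_closedBall_zero_iff]
  by_contra h
  exact hx (mollifier_eq_zero hδ (not_le.1 h))

lemma hasCompactSupport_mollifier (hδ : 0 < δ) : HasCompactSupport (mollifier (m := m) δ) :=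
  (isCompact_closedBall (0 : E m) δ).of_isClosed_subset (isClosed_tsupport _)
    (tsupport_mollifier_subset hδ)

lemma integral_mollifier (hδ : 0 < δ) : ∫ x : E m, mollifier δ x = 1 := by
  simp only [mollifier]
  rw [integral_const_mul, Measure.integral_comp_inv_smul_of_nonneg _ _ hδ.le, integral_bump,
    finrank_euclideanSpace_fin, smul_eq_mul, mul_one, inv_mul_cancel₀ (pow_pos hδ m).ne']

lemma pd_mollifier (i : Fin m) (x : E m) :
    pd i (mollifier δ) x = (δ ^ m)⁻¹ * (δ⁻¹ * pd i (bump m) (δ⁻¹ • x)) := by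
  have h1 : HasFDerivAt (fun x : E m => bump m (δ⁻¹ • x))
      ((fderiv ℝ (bump m) (δ⁻¹ • x)).comp (δ⁻¹ • ContinuousLinearMap.id ℝ (E m))) x :=
    ((contDiff_bump.differentiable (by simp)) _).hasFDerivAt.comp x
      ((hasFDerivAt_id x).const_smul δ⁻¹)
  change fderiv ℝ (fun x => (δ ^ m)⁻¹ * bump m (δ⁻¹ • x)) x _ = _
  rw [fderiv_const_mul h1.differentiableAt, h1.fderiv]
  simp [pd]

lemma exists_mollifier_bound : ∃ C : ℝ, ∀ δ > 0, ∀ x : E m, |mollifier δ x| ≤ C / δ ^ m ∧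
    ∀ i, |pd i (mollifier δ) x| ≤ C / δ ^ m / δ := by
  obtain ⟨C₀, hC₀⟩ := (contDiff_bump (m := m)).continuous.bounded_above_of_compact_support
    hasCompactSupport_bump
  choose C₁ hC₁ using fun i : Fin m =>
    (contDiff_pd i (contDiff_bump (m := m))).continuous.bounded_above_of_compact_support
      (hasCompactSupport_bump.pd i)
  refine ⟨|C₀| + ∑ i, |C₁ i|, fun δ hδ x => ⟨?_, fun i => ?_⟩⟩
  · rw [mollifier, abs_mul, abs_of_pos (inv_pos.2 (pow_pos hδ m)), div_eq_inv_mul]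
    gcongr
    refine ((hC₀ _).trans (le_abs_self _)).trans ?_
    have := Finset.sum_nonneg fun i (_ : i ∈ Finset.univ) => abs_nonneg (C₁ i)
    linarith
  · rw [pd_mollifier, abs_mul, abs_mul, abs_of_pos (inv_pos.2 (pow_pos hδ m)),
      abs_of_pos (inv_pos.2 hδ)]
    have h1 : |pd i (bump m) (δ⁻¹ • x)| ≤ |C₀| + ∑ i, |C₁ i| := by
      have h2 := Finset.single_le_sum (f := fun i => |C₁ i|) (fun i _ => abs_nonneg _)
        (Finset.mem_univ i)
      have h3 := (hC₁ i (δ⁻¹ • x)).trans (le_abs_self _)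
      rw [Real.norm_eq_abs] at h3
      have := abs_nonneg C₀
      linarith
    calc (δ ^ m)⁻¹ * (δ⁻¹ * |pd i (bump m) (δ⁻¹ • x)|)
        ≤ (δ ^ m)⁻¹ * (δ⁻¹ * (|C₀| + ∑ i, |C₁ i|)) := by gcongr
      _ = _ := by field_simp

lemma mollify_eq_convolution (z : E m → ℝ) :
    mollify δ z = convolution z (mollifier δ) (ContinuousLinearMap.lsmul ℝ ℝ) volume := by
  ext x
  simp only [mollify, convolution, ContinuousLinearMap.lsmul_apply, smul_eq_mul, mul_comm]

lemma contDiff_mollify (hδ : 0 < δ) {z : E m → ℝ} (hz : LocallyIntegrable z) :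
    ContDiff ℝ ∞ (mollify δ z) := by
  rw [mollify_eq_convolution]
  exact (hasCompactSupport_mollifier hδ).contDiff_convolution_right _ hz contDiff_mollifier

lemma pd_mollify (hδ : 0 < δ) {z : E m → ℝ} (hz : LocallyIntegrable z) (i : Fin m) (x : E m) :
    pd i (mollify δ z) x = ∫ y, pd i (mollifier δ) (x - y) * z y := by
  rw [mollify_eq_convolution]
  have h := (hasCompactSupport_mollifier hδ).hasFDerivAt_convolution_right
    (ContinuousLinearMap.lsmul ℝ ℝ) hz (contDiff_mollifier.of_le (by simp)) x
  rw [pd, h.fderiv, convolution_precompR_apply]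
  · simp only [convolution, ContinuousLinearMap.lsmul_apply, smul_eq_mul, mul_comm]
    rfl
  · exact hz
  · exact (hasCompactSupport_mollifier hδ).fderiv ℝ
  · exact contDiff_mollifier.continuous_fderiv (by simp)

lemma pd_mollifier_sub (i : Fin m) (x y : E m) :
    pd i (fun y => mollifier δ (x - y)) y = -pd i (mollifier δ) (x - y) := by
  have h : HasFDerivAt (fun y : E m => mollifier δ (x - y))
      ((fderiv ℝ (mollifier δ) (x - y)).comp (-ContinuousLinearMap.id ℝ (E m))) y :=
    ((contDiff_mollifier.differentiable (by simp)) _).hasFDerivAt.comp y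
      ((hasFDerivAt_id y).const_sub x)
  simp [pd, h.fderiv]

lemma hasCompactSupport_mollifier_sub (hδ : 0 < δ) (x : E m) :
    HasCompactSupport fun y => mollifier δ (x - y) := by
  refine HasCompactSupport.of_support_subset_isCompact (isCompact_closedBall x δ) fun y hy => ?_
  rw [Metric.mem_closedBall, dist_comm, dist_eq_norm]
  by_contra h
  exact hy (mollifier_eq_zero hδ (not_le.1 h))

lemma contDiff_mollifier_sub (x : E m) : ContDiff ℝ ∞ fun y => mollifier δ (x - y) :=
  contDiff_mollifier.comp (contDiff_const.sub contDiff_id)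

/-- Mollification commutes with weak derivatives. -/
lemma pd_mollify_of_weak (hδ : 0 < δ) {z z' : E m → ℝ} (hz : LocallyIntegrable z) (i : Fin m)
    (x : E m)
    (h : ∫ y, z y * pd i (fun y => mollifier δ (x - y)) y = -∫ y, z' y * mollifier δ (x - y)) :
    pd i (mollify δ z) x = mollify δ z' x := by
  rw [pd_mollify hδ hz, mollify]
  simp only [pd_mollifier_sub, mul_neg, integral_neg, neg_inj] at h
  simp only [mul_comm _ (z _), mul_comm _ (z' _)]
  exact h

lemma tsupport_mollify_subset (hδ : 0 < δ) {z : E m → ℝ} {K : Set (E m)}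
    (hz : ∀ y ∉ K, z y = 0) {r : ℝ} (hr : δ ≤ r) :
    tsupport (mollify δ z) ⊆ Metric.cthickening r K := by
  refine closure_minimal (fun x hx => ?_) Metric.isClosed_cthickening
  by_contra h
  refine hx (integral_eq_zero_of_ae (ae_of_all _ fun y => ?_))
  by_cases hy : y ∈ K
  · have : δ < ‖x - y‖ := by
      by_contra h'
      rw [not_lt, ← dist_eq_norm] at h'
      exact h (Metric.mem_cthickening_of_dist_le x y r _ hy (h'.trans hr))
    simp [mollifier_eq_zero hδ this]
  · simp [hz y hy]

lemma isConcentrating_mollifier {δ : ℕ → ℝ} (hδ : ∀ k, 0 < δ k) :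
    IsConcentrating (fun k (x y : E m) => mollifier (δ k) (x - y)) δ 1 where
  measurable k := by
    have : Continuous fun z : E m × E m => mollifier (δ k) (z.1 - z.2) :=
      contDiff_mollifier.continuous.comp (by fun_prop)
    exact this.measurable
  bound := by
    obtain ⟨C, hC⟩ := exists_mollifier_bound (m := m)
    exact ⟨C, fun k x y => (hC _ (hδ k) _).1⟩
  support k x y h := mollifier_eq_zero (hδ k) (by rwa [← dist_eq_norm])
  mass ε hε := by
    refine Eventually.of_forall fun k x => ?_
    rw [integral_sub_left_eq_self (fun y => mollifier (δ k) y) volume x,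
      integral_mollifier (hδ k), sub_self, abs_zero]
    exact hε.le

/-- **Friedrichs' commutator lemma**, on the level of kernels. The commutator of mollification with
`w ↦ ∂ᵢ(a w)` has the kernel below: `a x - a y = O(δ)` compensates the factor `δ⁻¹` lost by the
derivative of the mollifier, and integration by parts shows that the mass tends to zero. -/
lemma isConcentrating_commutator {δ : ℕ → ℝ} (hδ : ∀ k, 0 < δ k) (hδ0 : Tendsto δ atTop (𝓝 0))
    {a : E m → ℝ} (ha : ContDiff ℝ ∞ a) (hac : HasCompactSupport a) (i : Fin m) :
    IsConcentrating (fun k (x y : E m) => pd i a x * mollifier (δ k) (x - y)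
      + (a x - a y) * pd i (mollifier (δ k)) (x - y)) δ 0 where
  measurable k := by
    have h1 : Continuous fun z : E m × E m => mollifier (δ k) (z.1 - z.2) :=
      contDiff_mollifier.continuous.comp (by fun_prop)
    have h2 : Continuous fun z : E m × E m => pd i (mollifier (δ k)) (z.1 - z.2) :=
      (contDiff_pd i contDiff_mollifier).continuous.comp (by fun_prop)
    have h3 := (contDiff_pd i ha).continuous
    have h4 := ha.continuous
    have : Continuous fun z : E m × E m => pd i a z.1 * mollifier (δ k) (z.1 - z.2)
      + (a z.1 - a z.2) * pd i (mollifier (δ k)) (z.1 - z.2) := by fun_prop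
    exact this.measurable
  bound := by
    obtain ⟨C, hC⟩ := exists_mollifier_bound (m := m)
    obtain ⟨A, hA⟩ := (contDiff_pd i ha).continuous.bounded_above_of_compact_support (hac.pd i)
    obtain ⟨L, hL⟩ := ContDiff.lipschitzWith_of_hasCompactSupport hac ha (by simp)
    refine ⟨|A| * |C| + L * |C|, fun k x y => ?_⟩
    have hd := hδ k
    have hC' : C / δ k ^ m ≤ |C| / δ k ^ m := by
      gcongr
      exact le_abs_self C
    have h1 : |pd i a x * mollifier (δ k) (x - y)| ≤ |A| * (|C| / δ k ^ m) := by
      rw [abs_mul]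
      exact mul_le_mul ((hA x).trans (le_abs_self A)) ((hC _ (hδ k) _).1.trans hC')
        (abs_nonneg _) (abs_nonneg _)
    have h2 : |(a x - a y) * pd i (mollifier (δ k)) (x - y)| ≤ L * (|C| / δ k ^ m) := by
      rw [abs_mul]
      by_cases hxy : δ k < ‖x - y‖
      · have : pd i (mollifier (δ k)) (x - y) = 0 := by
          refine image_eq_zero_of_notMem_tsupport fun h => ?_
          have := tsupport_mollifier_subset (hδ k) (tsupport_pd_subset i _ h)
          rw [mem_closedBall_zero_iff] at this
          linarith
        rw [this, abs_zero, mul_zero]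
        positivity
      · have h3 : |a x - a y| ≤ L * δ k := by
          have := hL.dist_le_mul x y
          rw [Real.dist_eq, dist_eq_norm] at this
          exact this.trans (mul_le_mul_of_nonneg_left (not_lt.1 hxy) L.2)
        have h4 : |pd i (mollifier (δ k)) (x - y)| ≤ |C| / δ k ^ m / δ k :=
          ((hC _ (hδ k) (x - y)).2 i).trans (by gcongr)
        calc _ ≤ L * δ k * (|C| / δ k ^ m / δ k) :=
              mul_le_mul h3 h4 (abs_nonneg _) (by positivity)
          _ = _ := by field_simp
    refine (abs_add_le _ _).trans ((add_le_add h1 h2).trans (le_of_eq ?_))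
    ring
  support k x y h := by
    rw [dist_eq_norm] at h
    have : pd i (mollifier (δ k)) (x - y) = 0 := by
      refine image_eq_zero_of_notMem_tsupport fun h' => ?_
      have := tsupport_mollifier_subset (hδ k) (tsupport_pd_subset i _ h')
      rw [mem_closedBall_zero_iff] at this
      linarith
    rw [this, mollifier_eq_zero (hδ k) h]
    ring
  mass ε hε := by
    have hpc := (contDiff_pd i ha).continuous
    have hunif := (hac.pd i).uniformContinuous_of_continuous hpc
    obtain ⟨r, hr, hrf⟩ := Metric.uniformContinuous_iff.1 hunif ε hε
    filter_upwards [hδ0.eventually (gt_mem_nhds hr)] with k hk x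
    have hm1 : Integrable fun y : E m => mollifier (δ k) (x - y) :=
      (contDiff_mollifier_sub x).continuous.integrable_of_hasCompactSupport
        (hasCompactSupport_mollifier_sub (hδ k) x)
    have hparts : ∫ y, (a x - a y) * pd i (mollifier (δ k)) (x - y)
        = -∫ y, pd i a y * mollifier (δ k) (x - y) := by
      have h := integral_mul_pd_eq_neg (f := fun y => a x - a y) i isOpen_univ
        (contDiff_const.sub (ha.of_le (by simp))).contDiffOn
        ((contDiff_mollifier_sub (δ := δ k) x).of_le (by simp))
        (hasCompactSupport_mollifier_sub (hδ k) x) (Set.subset_univ _)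
      have hpd : ∀ y, pd i (fun y => a x - a y) y = -pd i a y := by
        intro y
        rw [pd_sub i (differentiableAt_const _) ((ha.differentiable (by simp)) y)]
        simp [pd]
      simp only [pd_mollifier_sub, hpd, mul_neg, neg_mul, integral_neg, neg_neg] at h
      linarith
    have hi1 : Integrable fun y => pd i a y * mollifier (δ k) (x - y) :=
      integrable_mul_of_tsupport_subset isOpen_univ hpc.continuousOn
        (contDiff_mollifier_sub x).continuous (hasCompactSupport_mollifier_sub (hδ k) x)
        (Set.subset_univ _)
    have hi2 : Integrable fun y => (a x - a y) * pd i (mollifier (δ k)) (x - y) := by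
      have := integrable_mul_of_tsupport_subset isOpen_univ (f := fun y => a x - a y)
        (continuous_const.sub ha.continuous).continuousOn
        (contDiff_pd i (contDiff_mollifier_sub (δ := δ k) x)).continuous
        ((hasCompactSupport_mollifier_sub (hδ k) x).pd i) (Set.subset_univ _)
      refine this.neg.congr (ae_of_all _ fun y => ?_)
      simp [pd_mollifier_sub]
    rw [integral_add (hm1.const_mul _) hi2, hparts, ← sub_eq_add_neg,
      ← integral_sub (hm1.const_mul _) hi1, sub_zero]
    have hbd : ∀ y, ‖pd i a x * mollifier (δ k) (x - y) - pd i a y * mollifier (δ k) (x - y)‖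
        ≤ ε * mollifier (δ k) (x - y) := by
      intro y
      have h0 := mollifier_nonneg (hδ k) (x - y)
      rw [← sub_mul, norm_mul, Real.norm_of_nonneg h0]
      by_cases hxy : δ k < ‖x - y‖
      · rw [mollifier_eq_zero (hδ k) hxy, mul_zero, mul_zero]
      · refine mul_le_mul_of_nonneg_right ?_ h0
        rw [Real.norm_eq_abs, ← Real.dist_eq]
        exact (hrf ((dist_eq_norm x y).trans_le (not_lt.1 hxy) |>.trans_lt hk)).le
    rw [← Real.norm_eq_abs]
    refine (norm_integral_le_of_norm_le (hm1.const_mul ε) (ae_of_all _ hbd)).trans ?_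
    rw [integral_const_mul, integral_sub_left_eq_self (fun y => mollifier (δ k) y) volume x,
      integral_mollifier (hδ k), mul_one]

/-- Mollifications of a square integrable function converge to it in `L²`. -/
lemma tendsto_eLpNorm_mollify {δ : ℕ → ℝ} (hδ : ∀ k, 0 < δ k) (hδ0 : Tendsto δ atTop (𝓝 0))
    {w : E m → ℝ} (hw : MemLp w 2 volume) :
    Tendsto (fun k => eLpNorm (fun y => mollify (δ k) w y - w y) 2 volume) atTop (𝓝 0) := by
  simpa [mollify] using (isConcentrating_mollifier hδ).tendsto_eLpNorm hδ hδ0 hw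

/-- **Friedrichs approximation**: a function `z ∈ L²` with compact support in `Ω`, with weak
derivatives `zd j ∈ L²` and with `∑ᵢⱼ ∂ᵢ(aⁱʲ ∂ⱼ z) = h ∈ L²` weakly, is approximated by smooth
functions in such a way that the first derivatives and `∑ᵢⱼ ∂ᵢ(aⁱʲ ∂ⱼ ·)` converge in `L²`. The
approximations are the mollifications of `z`. No ellipticity is needed. -/
theorem exists_friedrichs_approx {Ω K : Set (E m)} (hΩ : IsOpen Ω) (hK : IsCompact K)
    (hKΩ : K ⊆ Ω) {a : Fin m → Fin m → E m → ℝ} (ha : ∀ i j, ContDiffOn ℝ ∞ (a i j) Ω)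
    {z h : E m → ℝ} {zd : Fin m → E m → ℝ} (hz : MemLp z 2 volume)
    (hzd : ∀ j, MemLp (zd j) 2 volume) (hh : MemLp h 2 volume) (hz0 : ∀ y ∉ K, z y = 0)
    (hzd0 : ∀ j, ∀ y ∉ K, zd j y = 0)
    (hweak : ∀ ψ : E m → ℝ, ContDiff ℝ ∞ ψ → HasCompactSupport ψ → ∀ j,
      ∫ y, z y * pd j ψ y = -∫ y, zd j y * ψ y)
    (hdiv : ∀ ψ : E m → ℝ, ContDiff ℝ ∞ ψ → HasCompactSupport ψ →
      ∑ i, ∑ j, ∫ y, a i j y * zd j y * pd i ψ y = -∫ y, h y * ψ y) :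
    ∃ K' : Set (E m), IsCompact K' ∧ K' ⊆ Ω ∧ ∃ Z : ℕ → E m → ℝ,
      (∀ k, ContDiff ℝ ∞ (Z k)) ∧ (∀ k, tsupport (Z k) ⊆ K') ∧
      Tendsto (fun k => eLpNorm (fun y => Z k y - z y) 2 volume) atTop (𝓝 0) ∧
      (∀ j, Tendsto (fun k => eLpNorm (fun y => pd j (Z k) y - zd j y) 2 volume) atTop (𝓝 0)) ∧
      Tendsto (fun k => eLpNorm (fun y =>
        (∑ i, pd i (fun y => ∑ j, a i j y * pd j (Z k) y) y) - h y) 2 volume) atTop (𝓝 0) := by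
  obtain ⟨r, hr, hrΩ⟩ := hK.exists_cthickening_subset_open hΩ hKΩ
  set K' := Metric.cthickening r K with hK'
  have hK'c : IsCompact K' := hK.cthickening
  obtain ⟨L, hLc, hKL, hLΩ⟩ := exists_compact_between hK'c hΩ hrΩ
  obtain ⟨θ, hθ1, hθ0, -⟩ := exists_contMDiffMap_one_nhds_of_subset_interior (n := (⊤ : ℕ∞))
    𝓘(ℝ, E m) hK'c.isClosed hKL
  have hθs : ContDiff ℝ ∞ (θ : E m → ℝ) := θ.contMDiff.contDiff
  have hθt : tsupport (θ : E m → ℝ) ⊆ L :=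
    closure_minimal (fun x hx => by by_contra h; exact hx (hθ0 x h)) hLc.isClosed
  have hθc : HasCompactSupport (θ : E m → ℝ) := hLc.of_isClosed_subset (isClosed_tsupport _) hθt
  -- coefficients cut off away from the support of `z` and its mollifications, defined on `ℝᵐ`
  set b : Fin m → Fin m → E m → ℝ := fun i j y => a i j y * θ y with hb
  have hbs : ∀ i j, ContDiff ℝ ∞ (b i j) := fun i j =>
    contDiff_mul_of_tsupport_subset hΩ (ha i j) hθs (hθt.trans hLΩ)
  have hbc : ∀ i j, HasCompactSupport (b i j) := fun i j => hθc.mul_left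
  have hKK' : K ⊆ K' := Metric.self_subset_cthickening K
  have hbz : ∀ i j y, b i j y * zd j y = a i j y * zd j y := by
    intro i j y
    by_cases hy : y ∈ K
    · have h1 : θ y = 1 := hθ1.self_of_nhdsSet y (hKK' hy)
      simp only [b, h1, mul_one]
    · simp only [hzd0 j y hy, mul_zero]
  set δ : ℕ → ℝ := fun k => r / (k + 1) with hδdef
  have hδ : ∀ k, 0 < δ k := fun k => by positivity
  have hδr : ∀ k, δ k ≤ r := fun k => div_le_self hr.le (by linarith [Nat.cast_nonneg (α := ℝ) k])
  have hδ0 : Tendsto δ atTop (𝓝 0) := by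
    have := (tendsto_one_div_add_atTop_nhds_zero_nat (𝕜 := ℝ)).const_mul r
    simpa [hδdef, div_eq_mul_inv] using this
  have hzl : LocallyIntegrable z := hz.locallyIntegrable (by norm_num)
  have hzdl : ∀ j, LocallyIntegrable (zd j) := fun j => (hzd j).locallyIntegrable (by norm_num)
  have hpd : ∀ k j, pd j (mollify (δ k) z) = mollify (δ k) (zd j) := by
    intro k j
    ext x
    exact pd_mollify_of_weak (hδ k) hzl j x
      (hweak _ (contDiff_mollifier_sub x) (hasCompactSupport_mollifier_sub (hδ k) x) j)
  have hsupp : ∀ k, tsupport (mollify (δ k) z) ⊆ K' := fun k =>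
    tsupport_mollify_subset (hδ k) hz0 (hδr k)
  have hmol : ∀ w : E m → ℝ, MemLp w 2 volume →
      Tendsto (fun k => eLpNorm (fun y => mollify (δ k) w y - w y) 2 volume) atTop (𝓝 0) :=
    fun w hw => tendsto_eLpNorm_mollify hδ hδ0 hw
  refine ⟨K', hK'c, hrΩ, fun k => mollify (δ k) z, fun k => contDiff_mollify (hδ k) hzl, hsupp,
    hmol z hz, fun j => ?_, ?_⟩
  · simp only [hpd]
    exact hmol _ (hzd j)
  -- the commutator of mollification and the differential operator
  set T : Fin m → Fin m → ℕ → E m → ℝ := fun i j k x =>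
    ∫ y, (pd i (b i j) x * mollifier (δ k) (x - y)
      + (b i j x - b i j y) * pd i (mollifier (δ k)) (x - y)) * zd j y with hT
  have hconc := fun i j => isConcentrating_commutator hδ hδ0 (hbs i j) (hbc i j) i
  have hTt : ∀ i j, Tendsto (fun k => eLpNorm (T i j k) 2 volume) atTop (𝓝 0) := by
    intro i j
    simpa [T] using (hconc i j).tendsto_eLpNorm hδ hδ0 (hzd j)
  have hTm : ∀ i j k, AEStronglyMeasurable (T i j k) volume := fun i j k =>
    (hconc i j).aestronglyMeasurable (hzd j) k
  have hkey : ∀ k, (fun y => (∑ i, pd i (fun y => ∑ j, a i j y * pd j (mollify (δ k) z) y) y) - h y)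
      = (∑ q : Fin m × Fin m, T q.1 q.2 k) + fun x => mollify (δ k) h x - h x := by
    intro k
    ext x
    have hmz := contDiff_mollify (hδ k) hzl
    have hcut : ∀ i, pd i (fun y => ∑ j, a i j y * pd j (mollify (δ k) z) y) x
        = pd i (fun y => ∑ j, b i j y * pd j (mollify (δ k) z) y) x := by
      intro i
      refine pd_congr i ?_
      by_cases hx : x ∈ K'
      · have : ∀ᶠ y in 𝓝 x, θ y = 1 := hθ1.filter_mono (nhds_le_nhdsSet hx)
        filter_upwards [this] with y hy
        simp [b, hy]
      · have : ∀ᶠ y in 𝓝 x, y ∉ K' := hK'c.isClosed.isOpen_compl.mem_nhds hx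
        filter_upwards [this] with y hy
        refine Finset.sum_congr rfl fun j _ => ?_
        have h0 : pd j (mollify (δ k) z) y = 0 :=
          image_eq_zero_of_notMem_tsupport fun h' => hy (hsupp k (tsupport_pd_subset j _ h'))
        rw [h0, mul_zero, mul_zero]
    -- `∂ᵢ(b (η ∗ ∂ⱼz)) = T + η ∗ ∂ᵢ(b ∂ⱼz)`, and the equation sums the last terms to `η ∗ h`
    have hexp : ∀ i j, pd i (b i j) x * mollify (δ k) (zd j) x
        + b i j x * pd i (mollify (δ k) (zd j)) x
        = T i j k x + ∫ y, pd i (mollifier (δ k)) (x - y) * (b i j y * zd j y) := by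
      intro i j
      have hl := hzdl j
      have i1 : Integrable fun y => mollifier (δ k) (x - y) * zd j y :=
        hl.integrable_smul_left_of_hasCompactSupport
          (contDiff_mollifier_sub x).continuous (hasCompactSupport_mollifier_sub (hδ k) x)
      have hcs : HasCompactSupport fun y => pd i (mollifier (δ k)) (x - y) := by
        convert! ((hasCompactSupport_mollifier_sub (hδ k) x).pd i).neg using 1
        ext y
        simp [pd_mollifier_sub]
      have hcc : Continuous fun y => pd i (mollifier (δ k)) (x - y) :=
        (contDiff_pd i contDiff_mollifier).continuous.comp (by fun_prop)
      have i2 : Integrable fun y => pd i (mollifier (δ k)) (x - y) * zd j y :=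
        hl.integrable_smul_left_of_hasCompactSupport hcc hcs
      have i3 : Integrable fun y => pd i (mollifier (δ k)) (x - y) * b i j y * zd j y :=
        hl.integrable_smul_left_of_hasCompactSupport (hcc.mul (hbs i j).continuous)
          hcs.mul_right
      simp only [T]
      have e : ∀ y, (pd i (b i j) x * mollifier (δ k) (x - y)
          + (b i j x - b i j y) * pd i (mollifier (δ k)) (x - y)) * zd j y
          = pd i (b i j) x * (mollifier (δ k) (x - y) * zd j y)
            + b i j x * (pd i (mollifier (δ k)) (x - y) * zd j y)
            - pd i (mollifier (δ k)) (x - y) * b i j y * zd j y := fun y => by ring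
      simp only [e, ← mul_assoc (pd i (mollifier (δ k)) (x - _))]
      rw [integral_sub (f := fun y => pd i (b i j) x * (mollifier (δ k) (x - y) * zd j y)
            + b i j x * (pd i (mollifier (δ k)) (x - y) * zd j y))
          ((i1.const_mul _).add (i2.const_mul _)) i3,
        integral_add (i1.const_mul _) (i2.const_mul _), integral_const_mul, integral_const_mul,
        pd_mollify (hδ k) hl, mollify]
      ring
    have hdiv' : ∑ i, ∑ j, ∫ y, pd i (mollifier (δ k)) (x - y) * (b i j y * zd j y)
        = mollify (δ k) h x := by
      have h1 := hdiv _ (contDiff_mollifier_sub (δ := δ k) x)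
        (hasCompactSupport_mollifier_sub (hδ k) x)
      simp only [pd_mollifier_sub, mul_neg, integral_neg, Finset.sum_neg_distrib, neg_inj] at h1
      simp only [hbz, mollify, mul_comm _ (h _)]
      rw [← h1]
      exact Finset.sum_congr rfl fun i _ => Finset.sum_congr rfl fun j _ =>
        integral_congr_ae (ae_of_all _ fun y => mul_comm _ _)
    simp only [hcut, Pi.add_apply, Finset.sum_apply, Fintype.sum_prod_type]
    rw [← add_sub_assoc, ← hdiv', ← Finset.sum_add_distrib]
    congr 1
    refine Finset.sum_congr rfl fun i _ => ?_
    rw [← Finset.sum_add_distrib]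
    have hd1 : ∀ j, DifferentiableAt ℝ (b i j) x := fun j => (hbs i j).differentiable (by simp) x
    have hd2 : ∀ j, DifferentiableAt ℝ (pd j (mollify (δ k) z)) x := fun j =>
      (contDiff_pd j hmz).differentiable (by simp) x
    rw [pd_sum_mul _ _ hd1 hd2]
    refine Finset.sum_congr rfl fun j _ => ?_
    rw [← hexp, hpd]
  simp only [hkey]
  have hbound : ∀ k, eLpNorm ((∑ q : Fin m × Fin m, T q.1 q.2 k)
      + fun x => mollify (δ k) h x - h x) 2 volume
      ≤ (∑ q : Fin m × Fin m, eLpNorm (T q.1 q.2 k) 2 volume)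
        + eLpNorm (fun x => mollify (δ k) h x - h x) 2 volume := by
    intro k
    refine (eLpNorm_add_le (Finset.aestronglyMeasurable_sum _ fun q _ => hTm _ _ _) ?_
      (by norm_num)).trans ?_
    · exact (contDiff_mollify (hδ k) (hh.locallyIntegrable
        (by norm_num))).continuous.aestronglyMeasurable.sub hh.1
    · gcongr
      exact eLpNorm_sum_le (fun q _ => hTm _ _ _) (by norm_num)
  refine tendsto_of_tendsto_of_tendsto_of_le_of_le tendsto_const_nhds ?_ (fun _ => zero_le)
    hbound
  have := (tendsto_finsetSum (Finset.univ : Finset (Fin m × Fin m))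
    fun q _ => hTt q.1 q.2).add (hmol h hh)
  simpa using this

end Mollification

/-! ### Changes of coordinates -/

section Transition

variable {m : ℕ} {N : Type*} [TopologicalSpace N]
  [ChartedSpace (EuclideanSpace ℝ (Fin m)) N] [IsManifold (𝓡 m) ∞ N]
  (g : Metric m N) {p q : N} {y : E m}

/-- The change of coordinates from the chart around `p` to the chart around `q`; meaningful on
`transDomain m p q` only. -/
def trans (m : ℕ) {N : Type*} [TopologicalSpace N]
    [ChartedSpace (EuclideanSpace ℝ (Fin m)) N] (p q : N) (y : E m) : E m :=
  coord m q (param m p y)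

/-- The domain of the change of coordinates `trans m p q`. -/
def transDomain (m : ℕ) {N : Type*} [TopologicalSpace N]
    [ChartedSpace (EuclideanSpace ℝ (Fin m)) N] (p q : N) : Set (E m) :=
  coordDomain m p ∩ param m p ⁻¹' chartDomain m q

lemma isOpen_transDomain (p q : N) : IsOpen (transDomain m p q) :=
  (contMDiffOn_param p).continuousOn.isOpen_inter_preimage (isOpen_coordDomain p)
    (isOpen_chartDomain q)

lemma trans_mem (hy : y ∈ transDomain m p q) : trans m p q y ∈ transDomain m q p := by
  refine ⟨coord_mem hy.2, ?_⟩
  rw [Set.mem_preimage, trans, param_coord hy.2]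
  exact param_mem hy.1

lemma param_trans (hy : y ∈ transDomain m p q) : param m q (trans m p q y) = param m p y :=
  param_coord hy.2

lemma trans_trans (hy : y ∈ transDomain m p q) : trans m q p (trans m p q y) = y := by
  rw [trans, param_trans hy, coord_param hy.1]

lemma contDiffOn_trans (p q : N) : ContDiffOn ℝ ∞ (trans m p q) (transDomain m p q) := by
  rw [← contMDiffOn_iff_contDiffOn]
  exact (contMDiffOn_coord q).comp ((contMDiffOn_param p).mono Set.inter_subset_left)
    fun _ hy => hy.2

lemma hasFDerivAt_trans (hy : y ∈ transDomain m p q) :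
    HasFDerivAt (trans m p q) (fderiv ℝ (trans m p q) y) y :=
  (((contDiffOn_trans p q).contDiffAt
    ((isOpen_transDomain p q).mem_nhds hy)).differentiableAt (by simp)).hasFDerivAt

/-- Rewriting the base point of the metric, for tangent vectors given as elements of `ℝᵐ`. -/
lemma inner_point_congr {x x' : N} (h : x = x') (v w : E m) :
    g.inner x (v : TangentSpace (𝓡 m) x) (w : TangentSpace (𝓡 m) x)
      = g.inner x' (v : TangentSpace (𝓡 m) x') (w : TangentSpace (𝓡 m) x') := by
  subst h
  rfl

/-- The chain rule for a change of coordinates, all tangent spaces being copies of `ℝᵐ`. -/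
lemma dparam_trans (hy : y ∈ transDomain m p q) (v : E m) :
    (show E m from dparam m q (trans m p q y) (fderiv ℝ (trans m p q) y v))
      = (show E m from dparam m p y v) := by
  have h1 : param m p =ᶠ[nhds y] param m q ∘ trans m p q := by
    filter_upwards [(isOpen_transDomain p q).mem_nhds hy] with z hz
    exact (param_trans hz).symm
  have h2 : mfderiv 𝓘(ℝ, E m) (𝓡 m) (param m p) y
      = mfderiv 𝓘(ℝ, E m) (𝓡 m) (param m q ∘ trans m p q) y := h1.mfderiv_eq
  have h3 := mfderiv_comp y (I := 𝓘(ℝ, E m)) (I' := 𝓘(ℝ, E m)) (I'' := 𝓡 m)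
    (mdifferentiableAt_param (trans_mem hy).1)
    (hasFDerivAt_trans hy).differentiableAt.mdifferentiableAt
  rw [mfderiv_eq_fderiv] at h3
  have h4 := h2.trans h3
  exact (DFunLike.congr_fun h4 v).symm

lemma inner_dparam_trans (hy : y ∈ transDomain m p q) (v w : E m) :
    g.inner (param m q (trans m p q y)) (dparam m q (trans m p q y) (fderiv ℝ (trans m p q) y v))
      (dparam m q (trans m p q y) (fderiv ℝ (trans m p q) y w))
    = g.inner (param m p y) (dparam m p y v) (dparam m p y w) := by
  have h := inner_point_congr g (param_trans hy)
    (dparam m q (trans m p q y) (fderiv ℝ (trans m p q) y v))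
    (dparam m q (trans m p q y) (fderiv ℝ (trans m p q) y w))
  refine h.trans ?_
  have e1 := dparam_trans hy v
  have e2 := dparam_trans hy w
  simp only at e1 e2
  rw [e1, e2]

/-- The densities of two charts differ by the Jacobian determinant of the change of coordinates. -/
lemma density_trans (hy : y ∈ transDomain m p q) :
    density g p y = |(fderiv ℝ (trans m p q) y).det| * density g q (trans m p q y) := by
  set L := fderiv ℝ (trans m p q) y with hL
  set B := (EuclideanSpace.basisFun (Fin m) ℝ).toBasis with hB
  set J : Matrix (Fin m) (Fin m) ℝ := LinearMap.toMatrix B B (L : E m →ₗ[ℝ] E m) with hJ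
  have hJa : ∀ k i, J k i = L (EuclideanSpace.single i (1 : ℝ)) k := by
    intro k i
    simp [J, B, LinearMap.toMatrix_apply]
  have hgram : gram g p y = J.transpose * gram g q (trans m p q y) * J := by
    ext i j
    have h := inner_dparam_trans g hy (EuclideanSpace.single i (1 : ℝ))
      (EuclideanSpace.single j (1 : ℝ))
    rw [inner_dparam] at h
    refine h.symm.trans ?_
    simp only [Matrix.mul_apply, Matrix.transpose_apply, hJa, Finset.sum_mul]
    rw [Finset.sum_comm]
    exact Finset.sum_congr rfl fun _ _ => Finset.sum_congr rfl fun _ _ => by rw [← hL]; ring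
  have hdet : J.det = L.det := by
    rw [hJ, LinearMap.det_toMatrix]
  rw [density, density, hgram, Matrix.det_mul, Matrix.det_mul, Matrix.det_transpose, hdet,
    mul_right_comm, Real.sqrt_mul (mul_self_nonneg _), Real.sqrt_mul_self_eq_abs]

end Transition

/-! ### The Riemannian volume in charts -/

section Volume

open Set ENNReal

variable {m : ℕ} {N : Type*} [TopologicalSpace N]
  [ChartedSpace (EuclideanSpace ℝ (Fin m)) N] [IsManifold (𝓡 m) ∞ N]
  [MeasurableSpace N] [BorelSpace N] (g : Metric m N) (p q : N)

/-- The Riemannian measure `√(det gᵢⱼ) dy` on the domain of the coordinates, as a measure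
on `ℝᵐ`. -/
def coordMeasure : Measure (E m) :=
  (volume.restrict (coordDomain m p)).withDensity fun y => ENNReal.ofReal (density g p y)

lemma chartVolume_eq_map : chartVolume g p = (coordMeasure g p).map (param m p) := rfl

lemma aemeasurable_density :
    AEMeasurable (fun y => ENNReal.ofReal (density g p y))
      (volume.restrict (coordDomain m p)) :=
  (contDiffOn_density.continuousOn.aemeasurable (isOpen_coordDomain p).measurableSet).ennreal_ofReal

lemma coordMeasure_ac : coordMeasure g p ≪ volume.restrict (coordDomain m p) :=
  withDensity_absolutelyContinuous _ _

lemma ac_coordMeasure : volume.restrict (coordDomain m p) ≪ coordMeasure g p := by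
  refine withDensity_absolutelyContinuous' (aemeasurable_density g p) ?_
  filter_upwards [ae_restrict_mem (isOpen_coordDomain p).measurableSet] with y hy
  simpa using density_pos hy

lemma aemeasurable_param : AEMeasurable (param m p) (coordMeasure g p) :=
  ((contMDiffOn_param p).continuousOn.aemeasurable
    (isOpen_coordDomain p).measurableSet).mono_ac (coordMeasure_ac g p)

lemma ae_mem_coordDomain : ∀ᵐ y ∂coordMeasure g p, y ∈ coordDomain m p :=
  (coordMeasure_ac g p).ae_le (ae_restrict_mem (isOpen_coordDomain p).measurableSet)

lemma chartVolume_compl : chartVolume g p (chartDomain m p)ᶜ = 0 := by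
  rw [chartVolume_eq_map, Measure.map_apply_of_aemeasurable (aemeasurable_param g p)
    (isOpen_chartDomain p).measurableSet.compl]
  refine measure_mono_null (fun y hy => ?_) (ae_mem_coordDomain g p)
  exact fun h => hy (param_mem h)

lemma chartVolume_restrict : (chartVolume g p).restrict (chartDomain m p) = chartVolume g p :=
  Measure.restrict_eq_self_of_ae_mem (chartVolume_compl g p)

lemma lintegral_chartVolume {F : N → ℝ≥0∞} (hF : AEMeasurable F (chartVolume g p)) :
    ∫⁻ x, F x ∂chartVolume g p
      = ∫⁻ y in coordDomain m p, ENNReal.ofReal (density g p y) * F (param m p y) := by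
  rw [chartVolume_eq_map] at hF ⊢
  rw [lintegral_map' hF (aemeasurable_param g p), coordMeasure,
    lintegral_withDensity_eq_lintegral_mul_non_measurable₀ _ (aemeasurable_density g p)]
  · rfl
  · exact ae_of_all _ fun _ => ENNReal.ofReal_lt_top

/-- The measures of two charts agree on the overlap of their domains, by the change of variables
formula. -/
lemma chartVolume_overlap {S : Set N} (hS : MeasurableSet S) (hp : S ⊆ chartDomain m p)
    (hq : S ⊆ chartDomain m q) : chartVolume g p S = chartVolume g q S := by
  have key : ∀ p q : N, S ⊆ chartDomain m q → chartVolume g p S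
      = ∫⁻ y in transDomain m p q, ENNReal.ofReal (density g p y) *
        S.indicator 1 (param m p y) := by
    intro p q hq
    rw [← lintegral_indicator_one hS, lintegral_chartVolume g p
      ((measurable_one.indicator hS).aemeasurable),
      ← lintegral_indicator (isOpen_coordDomain p).measurableSet, ← lintegral_indicator
        (isOpen_transDomain p q).measurableSet]
    refine lintegral_congr fun y => ?_
    by_cases h1 : y ∈ coordDomain m p
    · by_cases h2 : param m p y ∈ chartDomain m q
      · rw [indicator_of_mem h1, indicator_of_mem (show y ∈ transDomain m p q from ⟨h1, h2⟩)]
      · have h3 : param m p y ∉ S := fun h => h2 (hq h)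
        simp [indicator, h3]
    · rw [indicator_of_notMem h1, indicator_of_notMem fun h => h1 h.1]
  rw [key p q hq, key q p hp]
  have himg : trans m p q '' transDomain m p q = transDomain m q p := by
    ext z
    constructor
    · rintro ⟨y, hy, rfl⟩
      exact trans_mem hy
    · exact fun hz => ⟨trans m q p z, trans_mem hz, trans_trans hz⟩
  have hinj : InjOn (trans m p q) (transDomain m p q) := by
    intro y hy z hz h
    rw [← trans_trans hy, h, trans_trans hz]
  rw [← himg, lintegral_image_eq_lintegral_abs_det_fderiv_mul volume
    (isOpen_transDomain p q).measurableSet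
    (fun y hy => (hasFDerivAt_trans hy).hasFDerivWithinAt) hinj]
  refine setLIntegral_congr_fun (isOpen_transDomain p q).measurableSet fun y hy => ?_
  rw [param_trans hy, ← mul_assoc, ← ENNReal.ofReal_mul (abs_nonneg _), ← density_trans g hy]

lemma chartVolume_le_vol : chartVolume g p ≤ vol g := le_iSup (chartVolume g) p

/-- The Riemannian volume restricts to the measure of each chart. -/
theorem vol_restrict : (vol g).restrict (chartDomain m p) = chartVolume g p := by
  have hA : MeasurableSet (chartDomain m p) := (isOpen_chartDomain p).measurableSet
  refine le_antisymm ?_ ?_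
  · have h1 : vol g ≤ chartVolume g p + (vol g).restrict (chartDomain m p)ᶜ := by
      refine iSup_le fun q => Measure.le_iff.2 fun S hS => ?_
      rw [← measure_inter_add_sdiff S hA, Measure.add_apply, Measure.restrict_apply hS]
      refine add_le_add ?_ (chartVolume_le_vol g q _)
      have hB : MeasurableSet (chartDomain m q) := (isOpen_chartDomain q).measurableSet
      calc chartVolume g q (S ∩ chartDomain m p)
          = chartVolume g q (S ∩ chartDomain m p ∩ chartDomain m q) := by
            rw [← Measure.restrict_apply (hS.inter hA), chartVolume_restrict]
        _ = chartVolume g p (S ∩ chartDomain m p ∩ chartDomain m q) :=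
            chartVolume_overlap g q p ((hS.inter hA).inter hB) (fun _ hx => hx.2)
              fun _ hx => hx.1.2
        _ ≤ chartVolume g p S := measure_mono fun _ hx => hx.1.1
    have h2 := Measure.restrict_mono le_rfl h1 (s := chartDomain m p)
    rwa [Measure.restrict_add, chartVolume_restrict, Measure.restrict_restrict hA,
      inter_compl_self, Measure.restrict_empty, add_zero] at h2
  · rw [← chartVolume_restrict]
    exact Measure.restrict_mono le_rfl (chartVolume_le_vol g p)

lemma aemeasurable_coord : AEMeasurable (coord m p) (chartVolume g p) := by
  rw [← chartVolume_restrict]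
  exact (contMDiffOn_coord p).continuousOn.aemeasurable (isOpen_chartDomain p).measurableSet

lemma map_coord_chartVolume : (chartVolume g p).map (coord m p) = coordMeasure g p := by
  have h := aemeasurable_coord g p
  rw [chartVolume_eq_map] at h ⊢
  rw [AEMeasurable.map_map_of_aemeasurable h (aemeasurable_param g p)]
  have : coord m p ∘ param m p =ᵐ[coordMeasure g p] id := by
    filter_upwards [ae_mem_coordDomain g p] with y hy using coord_param hy
  rw [Measure.map_congr this, Measure.map_id]

/-- Null sets may be tested in the charts, with respect to Lebesgue measure. -/
lemma ae_vol_of_forall_chart [CompactSpace N] {P : N → Prop}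
    (h : ∀ p : N, ∀ᵐ y, y ∈ coordDomain m p → P (param m p y)) : ∀ᵐ x ∂vol g, P x := by
  have h1 : ∀ p : N, ∀ᵐ x ∂(vol g).restrict (chartDomain m p), P x := by
    intro p
    have h2 : ∀ᵐ y ∂coordMeasure g p, P (param m p y) :=
      (coordMeasure_ac g p).ae_le ((ae_restrict_iff' (isOpen_coordDomain p).measurableSet).2 (h p))
    rw [← map_coord_chartVolume] at h2
    have h3 := ae_of_ae_map (aemeasurable_coord g p) h2
    rw [vol_restrict]
    have h4 : ∀ᵐ x ∂chartVolume g p, x ∈ chartDomain m p := chartVolume_compl g p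
    filter_upwards [h3, h4] with x hx hx'
    rwa [param_coord hx'] at hx
  obtain ⟨t, ht⟩ := (isCompact_univ (X := N)).elim_finite_subcover (fun p : N => chartDomain m p)
    (fun p => isOpen_chartDomain p) fun x _ => mem_iUnion.2 ⟨x, mem_chartDomain x⟩
  have h5 : ∀ᵐ x ∂(vol g).restrict (⋃ p ∈ t, chartDomain m p), P x := by
    rw [ae_restrict_biUnion_finset_iff]
    exact fun p _ => h1 p
  rwa [univ_subset_iff.1 ht, Measure.restrict_univ] at h5

lemma ae_chart_of_ae_vol {P : N → Prop} (h : ∀ᵐ x ∂vol g, P x) :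
    ∀ᵐ y, y ∈ coordDomain m p → P (param m p y) := by
  have h1 : ∀ᵐ x ∂chartVolume g p, P x := by
    rw [← vol_restrict]
    exact ae_restrict_of_ae h
  have h2 := (ac_coordMeasure g p).ae_le (ae_of_ae_map (aemeasurable_param g p) h1)
  exact (ae_restrict_iff' (isOpen_coordDomain p).measurableSet).1 h2

lemma aestronglyMeasurable_chartVolume_iff {F : N → ℝ} :
    AEStronglyMeasurable F (chartVolume g p)
      ↔ AEStronglyMeasurable (fun y => F (param m p y)) (coordMeasure g p) := by
  constructor
  · intro h
    exact h.comp_aemeasurable (aemeasurable_param g p)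
  · intro h
    rw [← map_coord_chartVolume] at h
    have h1 := h.comp_aemeasurable (aemeasurable_coord g p)
    refine h1.congr ?_
    have h4 : ∀ᵐ x ∂chartVolume g p, x ∈ chartDomain m p := chartVolume_compl g p
    filter_upwards [h4] with x hx
    simp [Function.comp, param_coord hx]

lemma aestronglyMeasurable_vol_of_chart [CompactSpace N] {F : N → ℝ}
    (h : ∀ p : N, AEStronglyMeasurable (fun y => F (param m p y))
      (volume.restrict (coordDomain m p))) : AEStronglyMeasurable F (vol g) := by
  obtain ⟨t, ht⟩ := (isCompact_univ (X := N)).elim_finite_subcover (fun p : N => chartDomain m p)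
    (fun p => isOpen_chartDomain p) fun x _ => mem_iUnion.2 ⟨x, mem_chartDomain x⟩
  have h1 : AEStronglyMeasurable F ((vol g).restrict (⋃ p : t, chartDomain m (p : N))) := by
    refine AEStronglyMeasurable.iUnion fun p => ?_
    rw [vol_restrict, aestronglyMeasurable_chartVolume_iff]
    exact (h p).mono_ac (coordMeasure_ac g p)
  have h2 : ⋃ p : t, chartDomain m (p : N) = univ := by
    rw [← univ_subset_iff]
    refine ht.trans ?_
    simp [iUnion_subtype]
  rwa [h2, Measure.restrict_univ] at h1

/-- Integrals over the domain of a chart, in coordinates. -/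
lemma setIntegral_vol (F : N → ℝ) : ∫ x in chartDomain m p, F x ∂vol g
    = ∫ y in coordDomain m p, density g p y * F (param m p y) := by
  have h1 : ∫ y in coordDomain m p, density g p y * F (param m p y)
      = ∫ y, F (param m p y) ∂coordMeasure g p := by
    rw [coordMeasure, integral_withDensity_eq_integral_toReal_smul₀ (aemeasurable_density g p)
      (ae_of_all _ fun _ => ENNReal.ofReal_lt_top)]
    refine setIntegral_congr_fun (isOpen_coordDomain p).measurableSet fun y hy => ?_
    simp only [ENNReal.toReal_ofReal (density_pos (g := g) hy).le, smul_eq_mul]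
  rw [vol_restrict, h1]
  by_cases hF : AEStronglyMeasurable F (chartVolume g p)
  · exact integral_map (aemeasurable_param g p) hF
  · rw [integral_non_aestronglyMeasurable hF, integral_non_aestronglyMeasurable]
    rwa [← aestronglyMeasurable_chartVolume_iff]

lemma integral_vol_of_support_subset {F : N → ℝ} (hF : ∀ x ∉ chartDomain m p, F x = 0) :
    ∫ x, F x ∂vol g = ∫ y in coordDomain m p, density g p y * F (param m p y) := by
  rw [← setIntegral_vol, setIntegral_eq_integral_of_forall_compl_eq_zero hF]

lemma exists_nhds_vol_lt_top (x : N) : ∃ U ∈ nhds x, vol g U < ⊤ := by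
  obtain ⟨r, hr, hrD⟩ := Metric.nhds_basis_closedBall.mem_iff.1
    ((isOpen_coordDomain (m := m) x).mem_nhds (coord_mem (mem_chartDomain x)))
  set U : Set N := chartDomain m x ∩ coord m x ⁻¹' Metric.ball (coord m x x) r with hU
  have hUo : IsOpen U := (contMDiffOn_coord x).continuousOn.isOpen_inter_preimage
    (isOpen_chartDomain x) Metric.isOpen_ball
  refine ⟨U, hUo.mem_nhds ⟨mem_chartDomain x, Metric.mem_ball_self hr⟩, ?_⟩
  obtain ⟨C, hC⟩ := (isCompact_closedBall (coord m x x) r).exists_bound_of_continuousOn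
    (contDiffOn_density (g := g) (p := x).continuousOn.mono hrD)
  have h1 : vol g U = chartVolume g x U := by
    rw [← vol_restrict, Measure.restrict_apply hUo.measurableSet, inter_eq_left.2 inter_subset_left]
  rw [h1, ← lintegral_indicator_one hUo.measurableSet, lintegral_chartVolume g x
    ((measurable_one.indicator hUo.measurableSet).aemeasurable)]
  calc ∫⁻ y in coordDomain m x, ENNReal.ofReal (density g x y) * U.indicator 1 (param m x y)
      ≤ ∫⁻ y, (Metric.closedBall (coord m x x) r).indicator (fun _ => ENNReal.ofReal C) y := by
        refine (setLIntegral_mono' (isOpen_coordDomain x).measurableSet fun y hy => ?_).trans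
          (setLIntegral_le_lintegral _ _)
        by_cases h : param m x y ∈ U
        · have h2 : y ∈ Metric.closedBall (coord m x x) r := by
            have := h.2
            rw [mem_preimage, coord_param hy] at this
            exact Metric.ball_subset_closedBall this
          rw [indicator_of_mem h, indicator_of_mem h2, Pi.one_apply, mul_one]
          exact ENNReal.ofReal_le_ofReal ((le_abs_self _).trans (hC y h2))
        · simp [h]
    _ < ⊤ := by
        rw [lintegral_indicator_const measurableSet_closedBall]
        exact ENNReal.mul_lt_top ENNReal.ofReal_lt_top measure_closedBall_lt_top

instance isFiniteMeasure_vol [CompactSpace N] : IsFiniteMeasure (vol g) := by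
  refine ⟨isCompact_univ.measure_lt_top_of_nhdsWithin fun x _ => ?_⟩
  obtain ⟨U, hU, h⟩ := exists_nhds_vol_lt_top g x
  exact ⟨U, mem_nhdsWithin_of_mem_nhds hU, h⟩

lemma vol_pos_of_isOpen {U : Set N} (hU : IsOpen U) (hne : U.Nonempty) : 0 < vol g U := by
  obtain ⟨x, hx⟩ := hne
  rw [pos_iff_ne_zero]
  intro h
  have h1 : ∀ᵐ z ∂vol g, z ∉ U := by
    rw [ae_iff]
    simpa using h
  have h2 := ae_chart_of_ae_vol g x h1
  set V : Set (E m) := coordDomain m x ∩ param m x ⁻¹' U with hV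
  have hVo : IsOpen V := (contMDiffOn_param x).continuousOn.isOpen_inter_preimage
    (isOpen_coordDomain x) hU
  have hVne : V.Nonempty := ⟨coord m x x, coord_mem (mem_chartDomain x), by
    rw [mem_preimage, param_coord (mem_chartDomain x)]
    exact hx⟩
  refine (hVo.measure_pos volume hVne).ne' ?_
  refine measure_mono_null (fun y hy => ?_) h2
  exact fun h => h hy.1 hy.2

end Volume

/-! ### Functions on the manifold and in charts -/

section Functions

open Set

variable {m : ℕ} {N : Type*} [TopologicalSpace N]
  [ChartedSpace (EuclideanSpace ℝ (Fin m)) N] [IsManifold (𝓡 m) ∞ N] {p : N} {y : E m}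
  {n : WithTop ℕ∞}

lemma contDiffOn_comp_param {h : N → ℝ} (hh : ContMDiff (𝓡 m) 𝓘(ℝ) n h) (hn : n ≤ ∞) (p : N) :
    ContDiffOn ℝ n (fun y => h (param m p y)) (coordDomain m p) := by
  rw [← contMDiffOn_iff_contDiffOn]
  exact hh.comp_contMDiffOn ((contMDiffOn_param p).of_le hn)

lemma contMDiff_of_chart {h : N → ℝ} (hn : n ≤ ∞)
    (hh : ∀ p : N, ContDiffOn ℝ n (fun y => h (param m p y)) (coordDomain m p)) :
    ContMDiff (𝓡 m) 𝓘(ℝ) n h := by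
  intro x
  have h1 : ContMDiffAt (𝓡 m) 𝓘(ℝ) n ((fun y => h (param m x y)) ∘ coord m x) x := by
    have h2 := ((hh x).contDiffAt
      ((isOpen_coordDomain x).mem_nhds (coord_mem (mem_chartDomain x)))).contMDiffAt
    exact h2.comp x ((contMDiffAt_coord (mem_chartDomain x)).of_le hn)
  refine h1.congr_of_eventuallyEq ?_
  filter_upwards [(isOpen_chartDomain x).mem_nhds (mem_chartDomain (m := m) x)] with z hz
  simp [Function.comp, param_coord hz]

/-- A function on `N` in the coordinates of the chart around `p`, extended by zero. -/
def inChart (m : ℕ) {N : Type*} [TopologicalSpace N]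
    [ChartedSpace (EuclideanSpace ℝ (Fin m)) N] (p : N) (h : N → ℝ) : E m → ℝ :=
  (coordDomain m p).indicator fun y => h (param m p y)

/-- A function of the coordinates of the chart around `p` as a function on `N`,
extended by zero. -/
def ofChart (m : ℕ) {N : Type*} [TopologicalSpace N]
    [ChartedSpace (EuclideanSpace ℝ (Fin m)) N] (p : N) (ψ : E m → ℝ) : N → ℝ :=
  (chartDomain m p).indicator fun x => ψ (coord m p x)

lemma inChart_apply (h : N → ℝ) (hy : y ∈ coordDomain m p) :
    inChart m p h y = h (param m p y) := indicator_of_mem hy _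

lemma ofChart_param (ψ : E m → ℝ) (hy : y ∈ coordDomain m p) :
    ofChart m p ψ (param m p y) = ψ y := by
  rw [ofChart, indicator_of_mem (param_mem hy), coord_param hy]

lemma isCompact_image_coord [CompactSpace N] {h : N → ℝ} (hs : tsupport h ⊆ chartDomain m p) :
    IsCompact (coord m p '' tsupport h) :=
  (isClosed_tsupport h).isCompact.image_of_continuousOn
    ((contMDiffOn_coord p).continuousOn.mono hs)

lemma image_coord_subset {h : N → ℝ} (hs : tsupport h ⊆ chartDomain m p) :
    coord m p '' tsupport h ⊆ coordDomain m p := by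
  rintro _ ⟨x, hx, rfl⟩
  exact coord_mem (hs hx)

lemma inChart_eq_zero {h : N → ℝ} (hy : y ∉ coord m p '' tsupport h) : inChart m p h y = 0 := by
  by_cases hyD : y ∈ coordDomain m p
  · rw [inChart_apply h hyD]
    by_contra h0
    exact hy ⟨_, subset_tsupport h h0, coord_param hyD⟩
  · exact indicator_of_notMem hyD _

lemma tsupport_inChart_subset [CompactSpace N] {h : N → ℝ}
    (hs : tsupport h ⊆ chartDomain m p) :
    tsupport (inChart m p h) ⊆ coord m p '' tsupport h :=
  closure_minimal (fun _ hy => by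
    by_contra h0
    exact hy (inChart_eq_zero h0)) (isCompact_image_coord hs).isClosed

lemma hasCompactSupport_inChart [CompactSpace N] {h : N → ℝ}
    (hs : tsupport h ⊆ chartDomain m p) : HasCompactSupport (inChart m p h) :=
  (isCompact_image_coord hs).of_isClosed_subset (isClosed_tsupport _) (tsupport_inChart_subset hs)

lemma contDiff_inChart [CompactSpace N] {h : N → ℝ} (hs : tsupport h ⊆ chartDomain m p)
    (hh : ContMDiff (𝓡 m) 𝓘(ℝ) n h) (hn : n ≤ ∞) : ContDiff ℝ n (inChart m p h) := by
  rw [contDiff_iff_contDiffAt]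
  intro y
  by_cases hy : y ∈ coordDomain m p
  · refine ((contDiffOn_comp_param hh hn p).contDiffAt
      ((isOpen_coordDomain p).mem_nhds hy)).congr_of_eventuallyEq ?_
    filter_upwards [(isOpen_coordDomain p).mem_nhds hy] with z hz using inChart_apply h hz
  · have hy' : y ∉ coord m p '' tsupport h := fun h' => hy (image_coord_subset hs h')
    refine (contDiffAt_const (c := 0)).congr_of_eventuallyEq ?_
    filter_upwards [(isCompact_image_coord hs).isClosed.isOpen_compl.mem_nhds hy'] with z hz
      using inChart_eq_zero hz

lemma pd_inChart (h : N → ℝ) (hy : y ∈ coordDomain m p) (i : Fin m) :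
    pd i (inChart m p h) y = pd i (fun y => h (param m p y)) y :=
  pd_congr_on i (isOpen_coordDomain p) hy fun _ hz => inChart_apply h hz

lemma isCompact_image_param {ψ : E m → ℝ} (hc : HasCompactSupport ψ)
    (hs : tsupport ψ ⊆ coordDomain m p) : IsCompact (param m p '' tsupport ψ) :=
  hc.isCompact.image_of_continuousOn ((contMDiffOn_param p).continuousOn.mono hs)

lemma ofChart_eq_zero {ψ : E m → ℝ} {x : N} (hx : x ∉ param m p '' tsupport ψ) :
    ofChart m p ψ x = 0 := by
  by_cases hxD : x ∈ chartDomain m p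
  · rw [ofChart, indicator_of_mem hxD]
    by_contra h0
    exact hx ⟨_, subset_tsupport ψ h0, param_coord hxD⟩
  · exact indicator_of_notMem hxD _

lemma tsupport_ofChart_subset [T2Space N] {ψ : E m → ℝ} (hc : HasCompactSupport ψ)
    (hs : tsupport ψ ⊆ coordDomain m p) : tsupport (ofChart m p ψ) ⊆ param m p '' tsupport ψ :=
  closure_minimal (fun _ hy => by
    by_contra h0
    exact hy (ofChart_eq_zero h0)) (isCompact_image_param hc hs).isClosed

lemma tsupport_ofChart_subset_chartDomain [T2Space N] {ψ : E m → ℝ} (hc : HasCompactSupport ψ)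
    (hs : tsupport ψ ⊆ coordDomain m p) : tsupport (ofChart m p ψ) ⊆ chartDomain m p := by
  refine (tsupport_ofChart_subset hc hs).trans ?_
  rintro _ ⟨z, hz, rfl⟩
  exact param_mem (hs hz)

lemma contMDiff_ofChart [T2Space N] {ψ : E m → ℝ} (hc : HasCompactSupport ψ)
    (hs : tsupport ψ ⊆ coordDomain m p) (hψ : ContDiff ℝ n ψ) (hn : n ≤ ∞) :
    ContMDiff (𝓡 m) 𝓘(ℝ) n (ofChart m p ψ) := by
  intro x
  by_cases hx : x ∈ chartDomain m p
  · have h1 : ContMDiffAt (𝓡 m) 𝓘(ℝ) n (ψ ∘ coord m p) x :=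
      hψ.contMDiff.contMDiffAt.comp x ((contMDiffAt_coord hx).of_le hn)
    refine h1.congr_of_eventuallyEq ?_
    filter_upwards [(isOpen_chartDomain p).mem_nhds hx] with z hz using indicator_of_mem hz _
  · have hx' : x ∉ param m p '' tsupport ψ := by
      rintro ⟨z, hz, rfl⟩
      exact hx (param_mem (hs hz))
    refine (contMDiffAt_const (c := 0)).congr_of_eventuallyEq ?_
    filter_upwards [(isCompact_image_param hc hs).isClosed.isOpen_compl.mem_nhds hx'] with z hz
      using ofChart_eq_zero hz

/-- A finite smooth partition of unity subordinate to the charts. -/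
lemma exists_partition_of_unity (m : ℕ) (N : Type*) [TopologicalSpace N] [T2Space N]
    [CompactSpace N] [ChartedSpace (EuclideanSpace ℝ (Fin m)) N] [IsManifold (𝓡 m) ∞ N] :
    ∃ (t : Finset N) (χ : t → N → ℝ), (∀ a, ContMDiff (𝓡 m) 𝓘(ℝ) ∞ (χ a)) ∧
      (∀ a, tsupport (χ a) ⊆ chartDomain m (a : N)) ∧ ∀ x, ∑ a, χ a x = 1 := by
  obtain ⟨t, ht⟩ := (isCompact_univ (X := N)).elim_finite_subcover (fun p : N => chartDomain m p)
    (fun p => isOpen_chartDomain p) fun x _ => mem_iUnion.2 ⟨x, mem_chartDomain x⟩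
  obtain ⟨f, hf⟩ := SmoothPartitionOfUnity.exists_isSubordinate (𝓡 m) isClosed_univ
    (fun a : t => chartDomain m (a : N)) (fun a => isOpen_chartDomain _) (by
      refine ht.trans ?_
      simp [iUnion_subtype])
  refine ⟨t, fun a => f a, fun a => (f a).contMDiff, fun a => hf a, fun x => ?_⟩
  have h := f.sum_eq_one (mem_univ x)
  rwa [finsum_eq_sum_of_fintype] at h

end Functions

/-! ### Gradient, Laplacian and Green's formula -/

section Gradient

open Set

variable {m : ℕ} {N : Type*} [TopologicalSpace N]
  [ChartedSpace (EuclideanSpace ℝ (Fin m)) N] [IsManifold (𝓡 m) ∞ N] (g : Metric m N) {p : N}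
  {y : E m}

/-- Riesz representation in a tangent space with the inner product `g`. -/
lemma exists_riesz (x : N) (l : TangentSpace (𝓡 m) x →L[ℝ] ℝ) :
    ∃ v : TangentSpace (𝓡 m) x, ∀ w, g.inner x v w = l w := by
  have : FiniteDimensional ℝ (TangentSpace (𝓡 m) x) := inferInstanceAs (FiniteDimensional ℝ (E m))
  let B : TangentSpace (𝓡 m) x →ₗ[ℝ] Module.Dual ℝ (TangentSpace (𝓡 m) x) :=
    { toFun := fun v => (g.inner x v).toLinearMap
      map_add' := fun v w => by
        ext z
        simp
      map_smul' := fun c v => by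
        ext z
        simp }
  have hinj : Function.Injective B := by
    rw [injective_iff_map_eq_zero]
    intro v hv
    by_contra h
    have h1 := g.pos x v h
    have h2 : g.inner x v v = 0 := DFunLike.congr_fun hv v
    linarith
  have hsurj : Function.Surjective B :=
    (LinearMap.injective_iff_surjective_of_finrank_eq_finrank
      (Subspace.dual_finrank_eq (K := ℝ) (V := TangentSpace (𝓡 m) x)).symm).1 hinj
  obtain ⟨v, hv⟩ := hsurj l.toLinearMap
  exact ⟨v, fun w => DFunLike.congr_fun hv w⟩

/-- The gradient of a function: the vector field dual to its differential. It is zero where the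
function is not differentiable. -/
def grad (h : N → ℝ) (x : N) : TangentSpace (𝓡 m) x :=
  (exists_riesz g x (mfderiv (𝓡 m) 𝓘(ℝ) h x)).choose

lemma inner_grad (h : N → ℝ) (x : N) (w : TangentSpace (𝓡 m) x) :
    g.inner x (grad g h x) w = mfderiv (𝓡 m) 𝓘(ℝ) h x w :=
  (exists_riesz g x (mfderiv (𝓡 m) 𝓘(ℝ) h x)).choose_spec w

/-- The inner product `⟨∇ψ, ∇h⟩` of two gradients. -/
def gradInner (ψ h : N → ℝ) (x : N) : ℝ := g.inner x (grad g ψ x) (grad g h x)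

variable {g}

lemma inner_grad_coordVec {h : N → ℝ} (hh : ContMDiff (𝓡 m) 𝓘(ℝ) 1 h) (hy : y ∈ coordDomain m p)
    (i : Fin m) : g.inner (param m p y) (grad g h (param m p y)) (coordVec m p y i)
      = pd i (fun y => h (param m p y)) y := by
  rw [inner_grad]
  have h1 := mfderiv_comp y (I := 𝓘(ℝ, E m)) (I' := 𝓡 m) (I'' := 𝓘(ℝ))
    ((hh.mdifferentiable (by simp)) (param m p y)) (mdifferentiableAt_param hy)
  rw [mfderiv_eq_fderiv] at h1
  exact (DFunLike.congr_fun h1 (EuclideanSpace.single i (1 : ℝ))).symm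

/-- The inner product of two tangent vectors in terms of their covariant components. -/
lemma inner_eq_sum_inv (hy : y ∈ coordDomain m p) (v w : TangentSpace (𝓡 m) (param m p y)) :
    g.inner (param m p y) v w = ∑ k, (∑ l, (gram g p y)⁻¹ k l *
      g.inner (param m p y) v (coordVec m p y l)) * g.inner (param m p y) w (coordVec m p y k) := by
  have : FiniteDimensional ℝ (TangentSpace (𝓡 m) (param m p y)) :=
    inferInstanceAs (FiniteDimensional ℝ (E m))
  have hsurj : Function.Surjective (dparam m p y).toLinearMap :=
    (LinearMap.injective_iff_surjective_of_finrank_eq_finrank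
      (show Module.finrank ℝ (E m) = Module.finrank ℝ (TangentSpace (𝓡 m) (param m p y)) from
        rfl)).1 (injective_dparam hy)
  obtain ⟨a, ha⟩ := hsurj v
  change dparam m p y a = v at ha
  subst ha
  have h1 : ∀ l, g.inner (param m p y) (dparam m p y a) (coordVec m p y l)
      = ∑ j, gram g p y l j * a j := by
    intro l
    rw [dparam_apply]
    simp only [map_sum, map_smul, _root_.sum_apply, _root_.smul_apply, smul_eq_mul]
    exact Finset.sum_congr rfl fun j _ => by rw [gram_symm, gram_apply, mul_comm]
  have h2 : ∀ k, ∑ l, (gram g p y)⁻¹ k l *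
      g.inner (param m p y) (dparam m p y a) (coordVec m p y l) = a k := by
    intro k
    simp only [h1, Finset.mul_sum]
    rw [Finset.sum_comm]
    simp only [← mul_assoc, ← Finset.sum_mul, sum_inv_mul_gram hy]
    simp
  simp only [h2]
  rw [dparam_apply, g.symm]
  simp only [map_sum, map_smul, smul_eq_mul]

/-- The inner product of an arbitrary tangent vector with a gradient, in coordinates. -/
lemma inner_grad_param {h : N → ℝ} (hh : ContMDiff (𝓡 m) 𝓘(ℝ) 1 h) (hy : y ∈ coordDomain m p)
    (w : TangentSpace (𝓡 m) (param m p y)) :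
    g.inner (param m p y) (grad g h (param m p y)) w
      = ∑ k, gradC g p (fun y => h (param m p y)) k y *
        g.inner (param m p y) w (coordVec m p y k) := by
  rw [inner_eq_sum_inv hy]
  simp only [inner_grad_coordVec hh hy]
  rfl

lemma gradInner_param {ψ h : N → ℝ} (hψ : ContMDiff (𝓡 m) 𝓘(ℝ) 1 ψ)
    (hh : ContMDiff (𝓡 m) 𝓘(ℝ) 1 h) (hy : y ∈ coordDomain m p) :
    gradInner g ψ h (param m p y)
      = ∑ k, gradC g p (fun y => h (param m p y)) k y * pd k (fun y => ψ (param m p y)) y := by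
  rw [gradInner, g.symm, inner_grad_param hh hy]
  simp only [inner_grad_coordVec hψ hy]

lemma gradInner_self_param {h : N → ℝ} (hh : ContMDiff (𝓡 m) 𝓘(ℝ) 1 h)
    (hy : y ∈ coordDomain m p) :
    gradInner g h h (param m p y) = gradSqC g p (fun y => h (param m p y)) y :=
  gradInner_param hh hh hy

lemma gradInner_comm (ψ h : N → ℝ) (x : N) : gradInner g ψ h x = gradInner g h ψ x :=
  g.symm _ _ _

lemma inner_self_nonneg (x : N) (v : TangentSpace (𝓡 m) x) : 0 ≤ g.inner x v v := by
  by_cases h : v = 0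
  · rw [h, map_zero]
  · exact (g.pos x v h).le

lemma gradInner_self_nonneg (h : N → ℝ) (x : N) : 0 ≤ gradInner g h h x :=
  inner_self_nonneg _ _

lemma grad_add {h k : N → ℝ} {x : N} (hh : MDifferentiableAt (𝓡 m) 𝓘(ℝ) h x)
    (hk : MDifferentiableAt (𝓡 m) 𝓘(ℝ) k x) (w : TangentSpace (𝓡 m) x) :
    g.inner x (grad g (fun z => h z + k z) x) w
      = g.inner x (grad g h x) w + g.inner x (grad g k x) w := by
  simp only [inner_grad]
  exact DFunLike.congr_fun (hh.hasMFDerivAt.add hk.hasMFDerivAt).mfderiv w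

lemma grad_sum {ι : Type*} (s : Finset ι) {h : ι → N → ℝ}
    (hh : ∀ a ∈ s, ContMDiff (𝓡 m) 𝓘(ℝ) 1 (h a)) (x : N) (w : TangentSpace (𝓡 m) x) :
    g.inner x (grad g (fun z => ∑ a ∈ s, h a z) x) w = ∑ a ∈ s, g.inner x (grad g (h a) x) w := by
  classical
  induction s using Finset.induction_on with
  | empty =>
    simp only [inner_grad, Finset.sum_empty, mfderiv_const]
    rfl
  | insert b s hb ih =>
    have h1 : MDifferentiableAt (𝓡 m) 𝓘(ℝ) (h b) x :=
      (hh b (Finset.mem_insert_self b s)).mdifferentiable (by simp) x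
    have h2 : MDifferentiableAt (𝓡 m) 𝓘(ℝ) (fun z => ∑ a ∈ s, h a z) x := by
      refine (contMDiff_finsetSum (n := 1) fun a ha => ?_).mdifferentiable (by simp) x
      exact hh a (Finset.mem_insert_of_mem ha)
    simp only [Finset.sum_insert hb]
    rw [grad_add h1 h2, ih fun a ha => hh a (Finset.mem_insert_of_mem ha)]

lemma contMDiff_gradInner {ψ h : N → ℝ} (hψ : ContMDiff (𝓡 m) 𝓘(ℝ) ∞ ψ)
    (hh : ContMDiff (𝓡 m) 𝓘(ℝ) ∞ h) : ContMDiff (𝓡 m) 𝓘(ℝ) ∞ (gradInner g ψ h) := by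
  refine contMDiff_of_chart le_rfl fun p => ?_
  have h1 := contDiffOn_comp_param hψ le_rfl p
  have h2 := contDiffOn_comp_param hh le_rfl p
  refine ContDiffOn.congr (f := fun y => ∑ k, gradC g p (fun y => h (param m p y)) k y *
      pd k (fun y => ψ (param m p y)) y) ?_ fun y hy =>
    gradInner_param (hψ.of_le (by simp)) (hh.of_le (by simp)) hy
  exact ContDiffOn.sum fun k _ => (contDiffOn_gradC h2 k).mul
    (contDiffOn_pd k h1 (isOpen_coordDomain p))

lemma continuous_gradInner {ψ h : N → ℝ} (hψ : ContMDiff (𝓡 m) 𝓘(ℝ) 1 ψ)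
    (hh : ContMDiff (𝓡 m) 𝓘(ℝ) ∞ h) : Continuous (gradInner g ψ h) := by
  refine (contMDiff_of_chart (m := m) (n := 0) (by simp) fun p => ?_).continuous
  have h1 := contDiffOn_comp_param hψ (by simp) p
  have h2 := contDiffOn_comp_param hh le_rfl p
  refine ContDiffOn.congr (f := fun y => ∑ k, gradC g p (fun y => h (param m p y)) k y *
      pd k (fun y => ψ (param m p y)) y) ?_ fun y hy =>
    gradInner_param hψ (hh.of_le (by simp)) hy
  exact ContDiffOn.sum fun k _ => ((contDiffOn_gradC h2 k).of_le (by simp)).mul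
    (contDiffOn_pd_of_le k h1 (isOpen_coordDomain p) (by simp))

variable (g) in
/-- The Laplace–Beltrami operator, computed at each point in the preferred chart at this point.
By `lap_param` every chart gives the same value for smooth functions. -/
def lap (h : N → ℝ) (x : N) : ℝ := lapC g x (fun y => h (param m x y)) (coord m x x)

lemma gradC_congr {h k : E m → ℝ} (hhk : ∀ z ∈ coordDomain m p, h z = k z)
    (hy : y ∈ coordDomain m p) (i : Fin m) : gradC g p h i y = gradC g p k i y := by
  simp only [gradC]
  exact Finset.sum_congr rfl fun l _ => by rw [pd_congr_on l (isOpen_coordDomain p) hy hhk]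

lemma lapC_congr {h k : E m → ℝ} (hhk : ∀ z ∈ coordDomain m p, h z = k z)
    (hy : y ∈ coordDomain m p) : lapC g p h y = lapC g p k y := by
  simp only [lapC, divC, gradC_congr hhk hy]
  congr 1
  exact Finset.sum_congr rfl fun i _ =>
    pd_congr_on i (isOpen_coordDomain p) hy fun z hz => gradC_congr hhk hz i

variable [MeasurableSpace N] [BorelSpace N] [T2Space N] [CompactSpace N]

/-- Green's formula for a function `ψ` supported in a chart, with the Laplacian of this chart. -/
lemma green_chart {ψ h : N → ℝ} (hψ : ContMDiff (𝓡 m) 𝓘(ℝ) 1 ψ)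
    (hs : tsupport ψ ⊆ chartDomain m p) (hh : ContMDiff (𝓡 m) 𝓘(ℝ) ∞ h) :
    ∫ y in coordDomain m p, density g p y *
        (ψ (param m p y) * lapC g p (fun y => h (param m p y)) y)
      = -∫ x, gradInner g ψ h x ∂vol g := by
  set hp : E m → ℝ := fun y => h (param m p y) with hhp
  have hhp' : ContDiffOn ℝ ∞ hp (coordDomain m p) := contDiffOn_comp_param hh le_rfl p
  set Ψ := inChart m p ψ with hΨ
  have hΨc : HasCompactSupport Ψ := hasCompactSupport_inChart hs
  have hΨs : tsupport Ψ ⊆ coordDomain m p :=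
    (tsupport_inChart_subset hs).trans (image_coord_subset hs)
  have hΨd : ContDiff ℝ 1 Ψ := contDiff_inChart hs hψ (by simp)
  have hF : ∀ i, ContDiffOn ℝ ∞ (fun z => density g p z * gradC g p hp i z) (coordDomain m p) :=
    fun i => contDiffOn_density.mul (contDiffOn_gradC hhp' i)
  have hout : ∀ y ∉ coordDomain m p, Ψ y = 0 ∧ ∀ i, pd i Ψ y = 0 := fun y hy =>
    ⟨image_eq_zero_of_notMem_tsupport fun h => hy (hΨs h), fun i =>
      image_eq_zero_of_notMem_tsupport fun h => hy (hΨs (tsupport_pd_subset i Ψ h))⟩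
  have hL : ∫ y in coordDomain m p, density g p y * (ψ (param m p y) * lapC g p hp y)
      = ∑ i, ∫ y, pd i (fun z => density g p z * gradC g p hp i z) y * Ψ y := by
    rw [← integral_finsetSum]
    · rw [← setIntegral_eq_integral_of_forall_compl_eq_zero (s := coordDomain m p)
        (f := fun y => ∑ i, pd i (fun z => density g p z * gradC g p hp i z) y * Ψ y)]
      · refine setIntegral_congr_fun (isOpen_coordDomain (m := m) p).measurableSet fun y hy => ?_
        simp only [← Finset.sum_mul]
        rw [sum_pd_density_mul hy fun i => (contDiffOn_gradC hhp' i).diffAt hy, hΨ,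
          inChart_apply ψ hy, lapC]
        ring
      · intro y hy
        simp [(hout y hy).1]
    · intro i _
      exact integrable_mul_of_tsupport_subset (isOpen_coordDomain p)
        (contDiffOn_pd i (hF i) (isOpen_coordDomain p)).continuousOn hΨd.continuous hΨc hΨs
  have hzero : ∀ x ∉ chartDomain m p, gradInner g ψ h x = 0 := by
    intro x hx
    have h0 : ψ =ᶠ[nhds x] fun _ => 0 :=
      notMem_tsupport_iff_eventuallyEq.1 fun h' => hx (hs h')
    rw [gradInner, inner_grad, h0.mfderiv_eq, mfderiv_const]
    rfl
  rw [hL, integral_vol_of_support_subset g p hzero]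
  have hR : ∫ y in coordDomain m p, density g p y * gradInner g ψ h (param m p y)
      = ∑ i, ∫ y, (density g p y * gradC g p hp i y) * pd i Ψ y := by
    rw [← integral_finsetSum]
    · rw [← setIntegral_eq_integral_of_forall_compl_eq_zero (s := coordDomain m p)
        (f := fun y => ∑ i, (density g p y * gradC g p hp i y) * pd i Ψ y)]
      · refine setIntegral_congr_fun (isOpen_coordDomain (m := m) p).measurableSet fun y hy => ?_
        rw [gradInner_param hψ (hh.of_le (by simp)) hy, Finset.mul_sum]
        refine Finset.sum_congr rfl fun i _ => ?_
        rw [hΨ, pd_inChart ψ hy]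
        ring
      · intro y hy
        simp [(hout y hy).2]
    · intro i _
      have hpc : Continuous (pd i Ψ) := by
        rw [← contDiffOn_univ] at hΨd
        exact continuousOn_univ.1
          (contDiffOn_pd_of_le (k := 0) i hΨd isOpen_univ (by simp)).continuousOn
      exact integrable_mul_of_tsupport_subset (isOpen_coordDomain p) (hF i).continuousOn
        hpc (hΨc.pd i) ((tsupport_pd_subset i Ψ).trans hΨs)
  rw [hR, ← Finset.sum_neg_distrib]
  refine Finset.sum_congr rfl fun i _ => ?_
  rw [integral_mul_pd_eq_neg i (isOpen_coordDomain p) ((hF i).of_le (by simp)) hΨd hΨc hΨs, neg_neg]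

/-- The Laplacian of a smooth function does not depend on the chart. Both expressions satisfy the
same integration by parts formula against test functions supported in the overlap. -/
lemma lapC_coord_eq {q : N} {h : N → ℝ} (hh : ContMDiff (𝓡 m) 𝓘(ℝ) ∞ h) {x : N}
    (hp : x ∈ chartDomain m p) (hq : x ∈ chartDomain m q) :
    lapC g p (fun y => h (param m p y)) (coord m p x)
      = lapC g q (fun y => h (param m q y)) (coord m q x) := by
  set U : Set N := chartDomain m p ∩ chartDomain m q with hU
  have hUo : IsOpen U := (isOpen_chartDomain p).inter (isOpen_chartDomain q)
  set L : N → N → ℝ := fun p x => lapC g p (fun y => h (param m p y)) (coord m p x) with hL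
  have hLc : ∀ p, ContinuousOn (L p) (chartDomain m p) := fun p =>
    (contDiffOn_lapC (contDiffOn_comp_param hh le_rfl p)).continuousOn.comp
      (contMDiffOn_coord p).continuousOn fun x hx => coord_mem hx
  have hFc : ContinuousOn (fun x => L p x - L q x) U :=
    ((hLc p).mono inter_subset_left).sub ((hLc q).mono inter_subset_right)
  have hae : ∀ᵐ x ∂vol g, x ∈ U → L p x - L q x = 0 := by
    refine hUo.ae_eq_zero_of_integral_contMDiff_smul_eq_zero (𝓡 m)
      (hFc.locallyIntegrableOn hUo.measurableSet) fun ψ hψ _ hs => ?_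
    have key : ∀ r, U ⊆ chartDomain m r →
        ∫ x, ψ x * L r x ∂vol g = -∫ x, gradInner g ψ h x ∂vol g := by
      intro r hr
      rw [← green_chart (g := g) (hψ.of_le (by simp)) (hs.trans hr) hh,
        integral_vol_of_support_subset g r]
      · refine setIntegral_congr_fun (isOpen_coordDomain r).measurableSet fun y hy => ?_
        simp only [L, coord_param hy]
      · intro x hx
        rw [image_eq_zero_of_notMem_tsupport fun h' => hx (hr (hs h')), zero_mul]
    have hint : ∀ r, U ⊆ chartDomain m r → Integrable (fun x => ψ x * L r x) (vol g) := by
      intro r hr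
      have hc : Continuous fun x => ψ x * L r x := by
        rw [continuous_iff_continuousAt]
        intro z
        by_cases hz : z ∈ tsupport ψ
        · exact hψ.continuous.continuousAt.mul
            ((hLc r).continuousAt ((isOpen_chartDomain r).mem_nhds (hr (hs hz))))
        · have h0 : ψ =ᶠ[nhds z] fun _ => 0 := notMem_tsupport_iff_eventuallyEq.1 hz
          refine (continuousAt_const (y := (0 : ℝ))).congr ?_
          filter_upwards [h0] with w hw
          simp [hw]
      exact hc.integrable_of_hasCompactSupport (HasCompactSupport.of_compactSpace _)
    simp only [smul_eq_mul, mul_sub]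
    rw [integral_sub (hint p inter_subset_left) (hint q inter_subset_right),
      key p inter_subset_left, key q inter_subset_right, sub_self]
  by_contra hne
  -- equality almost everywhere and continuity give equality at `x`
  set V : Set N := U ∩ (fun x => L p x - L q x) ⁻¹' {0}ᶜ with hV
  have hVo : IsOpen V := hFc.isOpen_inter_preimage hUo isOpen_compl_singleton
  have hxV : x ∈ V := ⟨⟨hp, hq⟩, fun h0 => hne (sub_eq_zero.1 h0)⟩
  refine (vol_pos_of_isOpen g hVo ⟨x, hxV⟩).ne' (measure_mono_null (fun z hz => ?_) hae)
  exact fun h0 => hz.2 (h0 hz.1)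

lemma lap_param {h : N → ℝ} (hh : ContMDiff (𝓡 m) 𝓘(ℝ) ∞ h) (hy : y ∈ coordDomain m p) :
    lap g h (param m p y) = lapC g p (fun y => h (param m p y)) y := by
  have := lapC_coord_eq (g := g) hh (mem_chartDomain (param m p y)) (param_mem hy)
  rw [coord_param hy] at this
  exact this

lemma contMDiff_lap {h : N → ℝ} (hh : ContMDiff (𝓡 m) 𝓘(ℝ) ∞ h) :
    ContMDiff (𝓡 m) 𝓘(ℝ) ∞ (lap g h) :=
  contMDiff_of_chart le_rfl fun p =>
    (contDiffOn_lapC (g := g) (contDiffOn_comp_param hh le_rfl p)).congr fun _ hy => lap_param hh hy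

lemma _root_.Continuous.integrable_vol {F : N → ℝ} (hF : Continuous F) : Integrable F (vol g) :=
  hF.integrable_of_hasCompactSupport (HasCompactSupport.of_compactSpace _)

/-- **Green's formula** `∫ ψ Δh = -∫ ⟨∇ψ, ∇h⟩`, from charts by a partition of unity. -/
theorem green {ψ h : N → ℝ} (hψ : ContMDiff (𝓡 m) 𝓘(ℝ) 1 ψ) (hh : ContMDiff (𝓡 m) 𝓘(ℝ) ∞ h) :
    ∫ x, ψ x * lap g h x ∂vol g = -∫ x, gradInner g ψ h x ∂vol g := by
  obtain ⟨t, χ, hχ, hχs, hχ1⟩ := exists_partition_of_unity m N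
  have hc : ∀ a, ContMDiff (𝓡 m) 𝓘(ℝ) 1 fun x => χ a x * ψ x := fun a =>
    ((hχ a).of_le (by simp)).mul hψ
  have hs : ∀ a, tsupport (fun x => χ a x * ψ x) ⊆ chartDomain m (a : N) := fun a =>
    (tsupport_mul_subset_left).trans (hχs a)
  have h1 : ∀ x, ψ x = ∑ a, χ a x * ψ x := fun x => by rw [← Finset.sum_mul, hχ1, one_mul]
  have h2 : ∀ x, gradInner g ψ h x = ∑ a, gradInner g (fun x => χ a x * ψ x) h x := by
    intro x
    have := grad_sum (g := g) Finset.univ (fun a _ => hc a) x (grad g h x)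
    rw [← funext h1] at this
    exact this
  have hlap := (contMDiff_lap (g := g) hh).continuous
  have h3 : ∀ x, ψ x * lap g h x = ∑ a, (χ a x * ψ x) * lap g h x := by
    intro x
    rw [← Finset.sum_mul, ← h1]
  simp only [h2]
  simp only [h3]
  have hint : ∀ a, Integrable (fun x => (χ a x * ψ x) * lap g h x) (vol g) := fun a =>
    ((hc a).continuous.mul hlap).integrable_vol
  rw [integral_finsetSum _ fun a _ => hint a,
    integral_finsetSum _ fun a _ => (continuous_gradInner (hc a) hh).integrable_vol,
    ← Finset.sum_neg_distrib]
  refine Finset.sum_congr rfl fun a _ => ?_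
  rw [← green_chart (hc a) (hs a) hh, integral_vol_of_support_subset g (a : N)]
  · refine setIntegral_congr_fun (isOpen_coordDomain _).measurableSet fun y hy => ?_
    simp only [lap_param hh hy]
  · intro x hx
    have : (fun x => χ a x * ψ x) x = 0 :=
      image_eq_zero_of_notMem_tsupport (f := fun x => χ a x * ψ x) fun h' => hx (hs a h')
    simp only at this
    rw [this, zero_mul]

end Gradient

/-! ### The Bochner inequality on the manifold -/

section GlobalBochner

variable {m : ℕ} {N : Type*} [TopologicalSpace N]
  [ChartedSpace (EuclideanSpace ℝ (Fin m)) N] [IsManifold (𝓡 m) ∞ N] {g : Metric m N} {p : N}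
  {y : E m}

/-- The chain rule for the squared length of the gradient. -/
lemma gradInner_comp_self {F : ℝ → ℝ} {h : N → ℝ} (hh : ContMDiff (𝓡 m) 𝓘(ℝ) ∞ h)
    (hFh : ContMDiff (𝓡 m) 𝓘(ℝ) ∞ fun x => F (h x)) {x : N} {F' : ℝ}
    (hF : HasDerivAt F F' (h x)) :
    gradInner g (fun x => F (h x)) (fun x => F (h x)) x = F' ^ 2 * gradInner g h h x := by
  obtain ⟨p, y, hy, rfl⟩ : ∃ p, ∃ y ∈ coordDomain m p, param m p y = x :=
    ⟨x, _, coord_mem (mem_chartDomain x), param_coord (mem_chartDomain x)⟩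
  rw [gradInner_self_param (hFh.of_le (by simp)) hy, gradInner_self_param (hh.of_le (by simp)) hy]
  have hd : ∀ i, pd i (fun y => F (h (param m p y))) y
      = F' * pd i (fun y => h (param m p y)) y := fun i =>
    pd_comp (f := fun y => h (param m p y)) i hF ((contDiffOn_comp_param hh le_rfl p).diffAt hy)
  simp only [gradSqC, gradC, hd, Finset.mul_sum, Finset.sum_mul]
  exact Finset.sum_congr rfl fun k _ => Finset.sum_congr rfl fun l _ => by ring

/-- The Bochner inequality with a uniform positive constant, which exists because finitely many
compact parts of charts cover the manifold. -/
theorem exists_bochner [CompactSpace N] [T2Space N] [MeasurableSpace N] [BorelSpace N]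
    (hRic : PositiveRicci g) :
    ∃ κ > 0, ∀ v : N → ℝ, ContMDiff (𝓡 m) 𝓘(ℝ) ∞ v → ∀ x,
      let T := (1 / 2) * lap g (gradInner g v v) x - gradInner g v (lap g v) x
        - κ * gradInner g v v x
      0 ≤ T ∧ gradInner g (gradInner g v v) (gradInner g v v) x
        ≤ 4 * T * gradInner g v v x := by
  obtain ⟨t, χ, -, hχs, hχ1⟩ := exists_partition_of_unity m N
  choose κ hκ0 hκ using fun a : t => exists_ricci_lower_bound (g := g) (p := (a : N)) hRic
    (isCompact_image_coord (hχs a)) (image_coord_subset (hχs a))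
  have hS : 0 ≤ ∑ a, (κ a)⁻¹ := Finset.sum_nonneg fun a _ => (inv_pos.2 (hκ0 a)).le
  refine ⟨(∑ a, (κ a)⁻¹ + 1)⁻¹, inv_pos.2 (by linarith), fun v hv x => ?_⟩
  obtain ⟨a, ha⟩ : ∃ a, χ a x ≠ 0 := by
    by_contra! h
    simpa [h] using hχ1 x
  have hle : (∑ a, (κ a)⁻¹ + 1)⁻¹ ≤ κ a := by
    refine inv_le_of_inv_le₀ (hκ0 a) ?_
    have := Finset.single_le_sum (f := fun a => (κ a)⁻¹)
      (fun b _ => (inv_pos.2 (hκ0 b)).le) (Finset.mem_univ a)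
    linarith
  obtain ⟨y, hyK, rfl⟩ : ∃ y ∈ coord m (a : N) '' tsupport (χ a), param m (a : N) y = x :=
    have hx : x ∈ tsupport (χ a) := subset_tsupport _ ha
    ⟨_, ⟨x, hx, rfl⟩, param_coord (hχs a hx)⟩
  have hy : y ∈ coordDomain m (a : N) := image_coord_subset (hχs a) hyK
  have hv' := contDiffOn_comp_param hv le_rfl (a : N)
  have he : ContMDiff (𝓡 m) 𝓘(ℝ) ∞ (gradInner g v v) := contMDiff_gradInner hv hv
  have hval : ∀ z ∈ coordDomain m (a : N), gradInner g v v (param m a z)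
      = gradSqC g (a : N) (fun y => v (param m a y)) z := fun z hz =>
    gradInner_self_param (hv.of_le (by simp)) hz
  have h1 := bochner_inequality (g := g) hv' hy (κ := (∑ a, (κ a)⁻¹ + 1)⁻¹) (fun w => by
    refine le_trans (mul_le_mul_of_nonneg_right hle ?_) (hκ a y hyK w)
    have := (posDef_gram g hy).posSemidef.dotProduct_mulVec_nonneg w
    simp only [dotProduct, Matrix.mulVec, star_trivial, Finset.mul_sum] at this
    refine this.trans_eq (Finset.sum_congr rfl fun i _ => Finset.sum_congr rfl fun j _ => ?_)
    ring)
  have e1 : lap g (gradInner g v v) (param m a y)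
      = lapC g (a : N) (gradSqC g (a : N) fun y => v (param m a y)) y := by
    rw [lap_param he hy, lapC_congr hval hy]
  have e2 : gradInner g v (lap g v) (param m a y)
      = ∑ l, gradC g (a : N) (fun y => v (param m a y)) l y
        * pd l (lapC g (a : N) fun y => v (param m a y)) y := by
    rw [gradInner_comm, gradInner_param ((contMDiff_lap hv).of_le (by simp))
      (hv.of_le (by simp)) hy]
    exact Finset.sum_congr rfl fun l _ => by
      rw [pd_congr_on l (isOpen_coordDomain _) hy fun z hz => lap_param hv hz]
  have e3 : gradInner g (gradInner g v v) (gradInner g v v) (param m a y)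
      = gradSqC g (a : N) (gradSqC g (a : N) fun y => v (param m a y)) y := by
    rw [gradInner_self_param (he.of_le (by simp)) hy]
    simp only [gradSqC, gradC_congr hval hy]
    exact Finset.sum_congr rfl fun l _ => by rw [pd_congr_on l (isOpen_coordDomain _) hy hval]
  simp only [e1, e2, e3, hval y hy]
  exact h1

/-- The stability inequality with the potential `q`, tested with `√(|∇v|² + δ²)`: the Bochner
inequality absorbs the Dirichlet energy of the test function, and Green's formula turns the
remaining terms into `∫ (Δv)²`. -/
theorem integral_lap_sq_of_stable [CompactSpace N] [T2Space N] [MeasurableSpace N] [BorelSpace N]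
    {κ : ℝ} (hκ : ∀ v : N → ℝ, ContMDiff (𝓡 m) 𝓘(ℝ) ∞ v → ∀ x,
      let T := (1 / 2) * lap g (gradInner g v v) x - gradInner g v (lap g v) x
        - κ * gradInner g v v x
      0 ≤ T ∧ gradInner g (gradInner g v v) (gradInner g v v) x
        ≤ 4 * T * gradInner g v v x)
    {q : N → ℝ} (hq : ∀ F : N → ℝ, Continuous F → Integrable (fun x => q x * F x) (vol g))
    (hstab : ∀ φ : N → ℝ, ContMDiff (𝓡 m) 𝓘(ℝ) ∞ φ →
      0 ≤ ∫ x, gradInner g φ φ x ∂vol g + ∫ x, q x * φ x ^ 2 ∂vol g)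
    {v : N → ℝ} (hv : ContMDiff (𝓡 m) 𝓘(ℝ) ∞ v) :
    κ * ∫ x, gradInner g v v x ∂vol g
      ≤ ∫ x, lap g v x ^ 2 ∂vol g + ∫ x, q x * gradInner g v v x ∂vol g := by
  set e := gradInner g v v with he
  have hes : ContMDiff (𝓡 m) 𝓘(ℝ) ∞ e := contMDiff_gradInner hv hv
  have he0 : ∀ x, 0 ≤ e x := gradInner_self_nonneg v
  have hlv := contMDiff_lap (g := g) hv
  have ie : Integrable e (vol g) := hes.continuous.integrable_vol
  have ile : Integrable (lap g e) (vol g) := (contMDiff_lap hes).continuous.integrable_vol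
  have ig : Integrable (gradInner g v (lap g v)) (vol g) :=
    (contMDiff_gradInner hv hlv).continuous.integrable_vol
  -- `∫ Δe = 0`, Green's formula with the constant function `1`
  have hle : ∫ x, lap g e x ∂vol g = 0 := by
    have h := green (g := g) (ψ := fun _ => 1) contMDiff_const hes
    simp only [one_mul, gradInner, inner_grad, mfderiv_const] at h
    rw [h, neg_eq_zero]
    exact integral_eq_zero_of_ae (Filter.Eventually.of_forall fun x => rfl)
  have hgl : ∫ x, gradInner g v (lap g v) x ∂vol g = -∫ x, lap g v x ^ 2 ∂vol g := by
    have h := green (g := g) (hlv.of_le (by simp)) hv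
    simp only [gradInner_comm _ v, ← pow_two] at h
    rw [h, neg_neg]
  set A : ℝ := ∫ x, lap g v x ^ 2 ∂vol g - κ * ∫ x, e x ∂vol g + ∫ x, q x * e x ∂vol g with hA
  -- `δ > 0` makes the test function smooth at the zeros of `∇v`
  have key : ∀ δ > 0, 0 ≤ A + δ ^ 2 * ∫ x, q x ∂vol g := by
    intro δ hδ
    have hpos : ∀ x, 0 < e x + δ ^ 2 := fun x => by have := he0 x; positivity
    have hφ : ContMDiff (𝓡 m) 𝓘(ℝ) ∞ fun x => Real.sqrt (e x + δ ^ 2) := by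
      intro x
      exact (Real.contDiffAt_sqrt (hpos x).ne').contMDiffAt.comp x
        ((hes.add contMDiff_const) x)
    set T : N → ℝ := fun x => (1 / 2) * lap g e x - gradInner g v (lap g v) x - κ * e x with hT
    have i1 : Integrable (fun x => (1 / 2) * lap g e x - gradInner g v (lap g v) x) (vol g) :=
      (ile.const_mul _).sub ig
    have iT : Integrable T (vol g) := i1.sub (ie.const_mul _)
    -- the left side is `|∇e|² / (4 (e + δ²))`
    have hle_T : ∀ x, gradInner g (fun x => Real.sqrt (e x + δ ^ 2))
        (fun x => Real.sqrt (e x + δ ^ 2)) x ≤ T x := by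
      intro x
      obtain ⟨hT0, hTe⟩ := hκ v hv x
      change 0 ≤ T x at hT0
      change gradInner g e e x ≤ 4 * T x * e x at hTe
      have hd : HasDerivAt (fun s => Real.sqrt (s + δ ^ 2)) (1 / (2 * Real.sqrt (e x + δ ^ 2)))
          (e x) := by
        simpa using ((hasDerivAt_id (e x)).add_const (δ ^ 2)).sqrt (hpos x).ne'
      rw [gradInner_comp_self hes hφ hd, div_pow, mul_pow, Real.sq_sqrt (hpos x).le,
        one_pow, one_div_mul_eq_div, div_le_iff₀ (by have := hpos x; positivity)]
      nlinarith [mul_nonneg hT0 (sq_nonneg δ)]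
    have h1 := hstab _ hφ
    have h2 : ∫ x, gradInner g (fun x => Real.sqrt (e x + δ ^ 2))
        (fun x => Real.sqrt (e x + δ ^ 2)) x ∂vol g ≤ ∫ x, T x ∂vol g :=
      integral_mono (contMDiff_gradInner hφ hφ).continuous.integrable_vol iT hle_T
    have h3 : ∫ x, T x ∂vol g = ∫ x, lap g v x ^ 2 ∂vol g - κ * ∫ x, e x ∂vol g := by
      simp only [hT]
      rw [integral_sub i1 (ie.const_mul _),
        integral_sub (ile.const_mul _) ig, integral_const_mul, integral_const_mul, hle, hgl]
      ring
    have h4 : ∫ x, q x * Real.sqrt (e x + δ ^ 2) ^ 2 ∂vol g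
        = ∫ x, q x * e x ∂vol g + δ ^ 2 * ∫ x, q x ∂vol g := by
      rw [← integral_const_mul, ← integral_add (hq e hes.continuous)
        ((hq _ continuous_const).congr (Filter.Eventually.of_forall fun x => mul_comm _ (δ ^ 2)))]
      refine integral_congr_ae (Filter.Eventually.of_forall fun x => ?_)
      simp only [Real.sq_sqrt (hpos x).le]
      ring
    linarith
  have hA0 : 0 ≤ A := by
    have hlim : Filter.Tendsto (fun δ : ℝ => A + δ ^ 2 * ∫ x, q x ∂vol g)
        (nhdsWithin 0 (Set.Ioi 0)) (nhds A) := by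
      have : Continuous fun δ : ℝ => A + δ ^ 2 * ∫ x, q x ∂vol g := by fun_prop
      simpa using (this.tendsto 0).mono_left nhdsWithin_le_nhds
    exact ge_of_tendsto hlim (eventually_mem_nhdsWithin.mono fun δ hδ => key δ hδ)
  linarith

end GlobalBochner

/-! ### Weak gradients -/

section WeakGradient

open Set

/-- A locally integrable function times a test function is integrable. -/
lemma _root_.MeasureTheory.LocallyIntegrableOn.integrable_mul_of_tsupport_subset {m : ℕ}
    {Ω : Set (E m)} {f ψ : E m → ℝ} (hf : LocallyIntegrableOn f Ω) (hψ : Continuous ψ)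
    (hc : HasCompactSupport ψ) (hs : tsupport ψ ⊆ Ω) : Integrable fun y => f y * ψ y := by
  have h1 : IntegrableOn (fun y => f y * ψ y) (tsupport ψ) :=
    (hf.integrableOn_compact_subset hs hc).mul_continuousOn hψ.continuousOn hc
  rw [integrableOn_iff_integrable_of_support_subset] at h1
  · exact h1
  · intro y hy
    exact subset_tsupport ψ (right_ne_zero_of_mul hy)

variable {m : ℕ} {N : Type*} [TopologicalSpace N]
  [ChartedSpace (EuclideanSpace ℝ (Fin m)) N] [IsManifold (𝓡 m) ∞ N]
  {g : Metric m N} {u φ : N → ℝ} {G G' : ∀ x : N, TangentSpace (𝓡 m) x} {p : N} {y : E m}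

/-- The covariant components `g(G, ∂ᵢ)` of a vector field in the chart around `p`. -/
abbrev cov (g : Metric m N) (p : N) (G : ∀ x : N, TangentSpace (𝓡 m) x) (i : Fin m) (y : E m) :
    ℝ :=
  g.inner (param m p y) (G (param m p y)) (coordVec m p y i)

lemma ext_of_cov (hy : y ∈ coordDomain m p) (h : ∀ i, cov g p G i y = cov g p G' i y) :
    G (param m p y) = G' (param m p y) := by
  rw [← sub_eq_zero]
  by_contra hne
  have h1 := g.pos _ _ hne
  rw [inner_eq_sum_inv hy] at h1
  have h2 : ∀ i, g.inner (param m p y) (G (param m p y) - G' (param m p y)) (coordVec m p y i)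
      = 0 := fun i => by
    rw [map_sub, _root_.sub_apply]
    exact sub_eq_zero.2 (h i)
  simp only [h2, mul_zero, Finset.sum_const_zero, lt_self_iff_false] at h1

lemma HasWeakGradient.add_const_mul (hG : HasWeakGradient g u G) (hG' : HasWeakGradient g φ G')
    (t : ℝ) : HasWeakGradient g (fun x => u x + t * φ x) fun x => G x + t • G' x := by
  intro p
  refine ⟨(hG p).1.add ((hG' p).1.smul t), fun i => ?_⟩
  obtain ⟨h1, h2⟩ := (hG p).2 i
  obtain ⟨h1', h2'⟩ := (hG' p).2 i
  have hc : ∀ y, cov g p (fun x => G x + t • G' x) i y = cov g p G i y + t * cov g p G' i y := by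
    intro y
    simp [cov, map_add, map_smul]
  refine ⟨(h1.add (h1'.smul t)).congr (Filter.Eventually.of_forall fun y => (hc y).symm), ?_⟩
  intro ψ hψ hψc hψs
  have hp := contDiff_pd i hψ
  have hpc := hψc.pd i
  have hps := (tsupport_pd_subset i ψ).trans hψs
  have e1 := (hG p).1.integrable_mul_of_tsupport_subset hp.continuous hpc hps
  have e2 := (hG' p).1.integrable_mul_of_tsupport_subset hp.continuous hpc hps
  have e3 := h1.integrable_mul_of_tsupport_subset hψ.continuous hψc hψs
  have e4 := h1'.integrable_mul_of_tsupport_subset hψ.continuous hψc hψs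
  change ∫ y, (u (param m p y) + t * φ (param m p y)) * pd i ψ y
    = -∫ y, cov g p (fun x => G x + t • G' x) i y * ψ y
  simp only [hc, add_mul, mul_assoc]
  rw [integral_add e1 (e2.const_mul t), integral_add e3 (e4.const_mul t), integral_const_mul,
    integral_const_mul, h2 ψ hψ hψc hψs, h2' ψ hψ hψc hψs]
  ring

lemma hasWeakGradient_grad (hφ : ContMDiff (𝓡 m) 𝓘(ℝ) ∞ φ) : HasWeakGradient g φ (grad g φ) := by
  intro p
  have hφp := contDiffOn_comp_param hφ le_rfl p
  have hcov : ∀ i, ∀ y ∈ coordDomain m p, cov g p (grad g φ) i y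
      = pd i (fun y => φ (param m p y)) y := fun i y hy =>
    inner_grad_coordVec (hφ.of_le (by simp)) hy i
  have hd := fun i => contDiffOn_pd i hφp (isOpen_coordDomain p)
  refine ⟨hφp.continuousOn.locallyIntegrableOn (isOpen_coordDomain p).measurableSet, fun i =>
    ⟨((hd i).continuousOn.congr (hcov i)).locallyIntegrableOn
      (isOpen_coordDomain p).measurableSet, fun ψ hψ hψc hψs => ?_⟩⟩
  rw [integral_mul_pd_eq_neg i (isOpen_coordDomain p) (hφp.of_le (by simp)) (hψ.of_le (by simp))
    hψc hψs]
  congr 1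
  refine integral_congr_ae (Filter.Eventually.of_forall fun y => ?_)
  by_cases hy : y ∈ coordDomain m p
  · simp only [← hcov i y hy]
  · have : ψ y = 0 := image_eq_zero_of_notMem_tsupport fun h => hy (hψs h)
    simp [this]

variable [MeasurableSpace N] [BorelSpace N]

/-- Weak gradients are unique, by the fundamental lemma of the calculus of variations in charts. -/
lemma HasWeakGradient.ae_eq [CompactSpace N] (hG : HasWeakGradient g u G)
    (hG' : HasWeakGradient g u G') : ∀ᵐ x ∂vol g, G x = G' x := by
  refine ae_vol_of_forall_chart g fun p => ?_
  have h : ∀ i, ∀ᵐ y, y ∈ coordDomain m p → cov g p G i y - cov g p G' i y = 0 := by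
    intro i
    obtain ⟨h1, h2⟩ := (hG p).2 i
    obtain ⟨h1', h2'⟩ := (hG' p).2 i
    refine (isOpen_coordDomain p).ae_eq_zero_of_integral_contDiff_smul_eq_zero (h1.sub h1') ?_
    intro ψ hψ hψc hψs
    have e1 := h1.integrable_mul_of_tsupport_subset hψ.continuous hψc hψs
    have e2 := h1'.integrable_mul_of_tsupport_subset hψ.continuous hψc hψs
    have h3 : ∫ y, ψ y * (cov g p G i y - cov g p G' i y)
        = (∫ y, cov g p G i y * ψ y) - ∫ y, cov g p G' i y * ψ y := by
      rw [← integral_sub e1 e2]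
      exact integral_congr_ae (Filter.Eventually.of_forall fun y => by ring)
    have h4 := (h2 ψ hψ hψc hψs).symm.trans (h2' ψ hψ hψc hψs)
    exact h3.trans (sub_eq_zero.2 (neg_injective h4))
  filter_upwards [ae_all_iff.2 h] with y hy hyD
  exact ext_of_cov hyD fun i => sub_eq_zero.1 (hy i hyD)

lemma HasWeakGradient.aestronglyMeasurable_cov (hG : HasWeakGradient g u G) (p : N) (i : Fin m) :
    AEStronglyMeasurable (cov g p G i) (volume.restrict (coordDomain m p)) :=
  ((hG p).2 i).1.aestronglyMeasurable

lemma aestronglyMeasurable_inner [CompactSpace N]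
    (hG : ∀ p i, AEStronglyMeasurable (cov g p G i) (volume.restrict (coordDomain m p)))
    (hG' : ∀ p i, AEStronglyMeasurable (cov g p G' i) (volume.restrict (coordDomain m p))) :
    AEStronglyMeasurable (fun x => g.inner x (G x) (G' x)) (vol g) := by
  refine aestronglyMeasurable_vol_of_chart g fun p => ?_
  have hm := (isOpen_coordDomain (m := m) p).measurableSet
  have h : AEStronglyMeasurable (fun y => ∑ k, (∑ l, (gram g p y)⁻¹ k l * cov g p G l y)
      * cov g p G' k y) (volume.restrict (coordDomain m p)) := by
    refine Finset.aestronglyMeasurable_fun_sum _ fun k _ =>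
      (Finset.aestronglyMeasurable_fun_sum _ fun l _ => ?_).mul (hG' p k)
    exact ((contDiffOn_gram_inv k l).continuousOn.aestronglyMeasurable hm).mul
      (hG p l)
  refine h.congr ?_
  filter_upwards [ae_restrict_mem hm] with y hy
  rw [inner_eq_sum_inv hy]

lemma abs_inner_le (x : N) (v w : TangentSpace (𝓡 m) x) :
    |g.inner x v w| ≤ (g.inner x v v + g.inner x w w) / 2 := by
  have h1 := inner_self_nonneg (g := g) x (v + w)
  have h2 := inner_self_nonneg (g := g) x (v - w)
  have h3 := g.symm x w v
  simp only [map_add, map_sub, _root_.add_apply, _root_.sub_apply] at h1 h2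
  rw [abs_le]
  constructor <;> linarith

lemma HasWeakGradient.integrable_inner [CompactSpace N] (hG : HasWeakGradient g u G)
    (hG' : HasWeakGradient g φ G') (hi : Integrable (fun x => g.inner x (G x) (G x)) (vol g))
    (hi' : Integrable (fun x => g.inner x (G' x) (G' x)) (vol g)) :
    Integrable (fun x => g.inner x (G x) (G' x)) (vol g) :=
  ((hi.add hi').div_const 2).mono'
    (aestronglyMeasurable_inner hG.aestronglyMeasurable_cov hG'.aestronglyMeasurable_cov)
    (Filter.Eventually.of_forall fun x => abs_inner_le x _ _)

lemma memW12_of_contMDiff [T2Space N] [CompactSpace N] (hφ : ContMDiff (𝓡 m) 𝓘(ℝ) ∞ φ) :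
    MemW12 g φ := by
  refine ⟨?_, grad g φ, hasWeakGradient_grad hφ,
    (contMDiff_gradInner hφ hφ).continuous.integrable_vol⟩
  exact hφ.continuous.memLp_of_hasCompactSupport (HasCompactSupport.of_compactSpace _)

end WeakGradient

/-! ### Differentiation of the potential term -/

section Variation

open Set

variable {W : ℝ → ℝ} {K : ℝ}

/-- Linear growth of `W'`. -/
lemma abs_deriv_le_of_deriv2_le (hW : ContDiff ℝ 2 W) (hK : ∀ t, |deriv (deriv W) t| ≤ K) (s : ℝ) :
    |deriv W s| ≤ |deriv W 0| + K * |s| := by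
  have hd : Differentiable ℝ (deriv W) :=
    (hW.differentiable_deriv_two)
  have h := convex_univ.norm_image_sub_le_of_norm_deriv_le (f := deriv W) (C := K) (x := 0) (y := s)
    (fun x _ => hd x) (fun x _ => hK x) (mem_univ _) (mem_univ _)
  simp only [Real.norm_eq_abs, sub_zero] at h
  have := abs_sub_abs_le_abs_sub (deriv W s) (deriv W 0)
  linarith

/-- Quadratic growth of `W`. -/
lemma abs_le_of_deriv2_le (hW : ContDiff ℝ 2 W) (hK : ∀ t, |deriv (deriv W) t| ≤ K) (s : ℝ) :
    |W s| ≤ |W 0| + (|deriv W 0| + K * |s|) * |s| := by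
  have hK0 : 0 ≤ K := (abs_nonneg _).trans (hK 0)
  have h := (convex_Icc (-|s|) |s|).norm_image_sub_le_of_norm_deriv_le (f := W)
    (C := |deriv W 0| + K * |s|) (x := 0) (y := s)
    (fun x _ => hW.differentiable (by norm_num) x) (fun x hx => ?_) (by simp) (abs_le.1 le_rfl)
  · simp only [Real.norm_eq_abs, sub_zero] at h
    have := abs_sub_abs_le_abs_sub (W s) (W 0)
    linarith
  · refine (abs_deriv_le_of_deriv2_le hW hK x).trans ?_
    have := mul_le_mul_of_nonneg_left (abs_le.2 hx) hK0
    linarith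

variable {α : Type*} [MeasurableSpace α] {ν : Measure α} [IsFiniteMeasure ν] {u φ : α → ℝ}

lemma integrable_comp_of_deriv2_le (hW : ContDiff ℝ 2 W) (hK : ∀ t, |deriv (deriv W) t| ≤ K)
    (hu : MemLp u 2 ν) : Integrable (fun x => W (u x)) ν := by
  have h1 : Integrable u ν := hu.integrable (by norm_num)
  refine Integrable.mono' (g := fun x => |W 0| + (|deriv W 0| * |u x| + K * u x ^ 2))
    ((integrable_const _).add ((h1.abs.const_mul _).add (hu.integrable_sq.const_mul _)))
    (hW.continuous.comp_aestronglyMeasurable hu.1) (Filter.Eventually.of_forall fun x => ?_)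
  refine (abs_le_of_deriv2_le hW hK (u x)).trans (le_of_eq ?_)
  rw [← sq_abs (u x)]
  ring

lemma integrable_deriv_comp (hW : ContDiff ℝ 2 W) (hK : ∀ t, |deriv (deriv W) t| ≤ K)
    (hu : MemLp u 2 ν) : Integrable (fun x => deriv W (u x)) ν := by
  refine Integrable.mono' (g := fun x => |deriv W 0| + K * |u x|)
    ((integrable_const _).add ((hu.integrable (by norm_num)).abs.const_mul _))
    ((hW.continuous_deriv (by norm_num)).comp_aestronglyMeasurable hu.1)
    (Filter.Eventually.of_forall fun x => abs_deriv_le_of_deriv2_le hW hK (u x))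

/-- Two differentiations under the integral sign along `u + tφ` for a bounded `φ`. Bounded
directions suffice, and for them boundedness of `W''` provides the integrable majorants. -/
lemma hasDerivAt_integral_comp (hW : ContDiff ℝ 2 W) (hK : ∀ t, |deriv (deriv W) t| ≤ K)
    (hu : MemLp u 2 ν) (hφ : AEStronglyMeasurable φ ν) {C : ℝ} (hC : ∀ x, |φ x| ≤ C) (t : ℝ) :
    HasDerivAt (fun t => ∫ x, W (u x + t * φ x) ∂ν) (∫ x, deriv W (u x + t * φ x) * φ x ∂ν) t ∧
    HasDerivAt (fun t => ∫ x, deriv W (u x + t * φ x) * φ x ∂ν)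
      (∫ x, deriv (deriv W) (u x + t * φ x) * φ x ^ 2 ∂ν) t := by
  have hK0 : 0 ≤ K := (abs_nonneg _).trans (hK 0)
  have hφL : MemLp φ 2 ν := MemLp.of_bound hφ C (Filter.Eventually.of_forall hC)
  have hut : ∀ t : ℝ, MemLp (fun x => u x + t * φ x) 2 ν := fun t => hu.add (hφL.const_mul t)
  have hW1 : Continuous (deriv W) := hW.continuous_deriv (by norm_num)
  have hd : Differentiable ℝ (deriv W) := hW.differentiable_deriv_two
  have hW2 : Continuous (deriv (deriv W)) := by
    have := (contDiff_succ_iff_deriv (n := 1)).1 (hW.of_le (by norm_num))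
    exact (this.2.2).continuous_deriv le_rfl
  have hlin : ∀ (x : α) (s : ℝ), HasDerivAt (fun s : ℝ => u x + s * φ x) (φ x) s := fun x s => by
    simpa using ((hasDerivAt_id s).mul_const (φ x)).const_add (u x)
  have hint : ∀ t : ℝ, Integrable (fun x => deriv W (u x + t * φ x) * φ x) ν := fun t =>
    (integrable_deriv_comp hW hK (hut t)).mul_bdd (c := C) hφ (Filter.Eventually.of_forall hC)
  constructor
  · refine (hasDerivAt_integral_of_dominated_loc_of_deriv_le
      (F' := fun s x => deriv W (u x + s * φ x) * φ x)
      (bound := fun x => (|deriv W 0| + K * (|u x| + (|t| + 1) * C)) * C)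
      (Metric.ball_mem_nhds t one_pos)
      (Filter.Eventually.of_forall fun s => hW.continuous.comp_aestronglyMeasurable (hut s).1)
      (integrable_comp_of_deriv2_le hW hK (hut t)) (hint t).1
      (Filter.Eventually.of_forall fun x s hs => ?_) ?_
      (Filter.Eventually.of_forall fun x s _ => ?_)).2
    · rw [Real.norm_eq_abs, abs_mul]
      have hs' : |s| ≤ |t| + 1 := by
        have h1 := abs_sub_abs_le_abs_sub s t
        rw [Metric.mem_ball, Real.dist_eq] at hs
        linarith
      have h2 : |u x + s * φ x| ≤ |u x| + (|t| + 1) * C := by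
        refine (abs_add_le _ _).trans ?_
        rw [abs_mul]
        have := mul_le_mul hs' (hC x) (abs_nonneg _) (by positivity)
        linarith
      refine mul_le_mul ((abs_deriv_le_of_deriv2_le hW hK _).trans ?_) (hC x) (abs_nonneg _)
        (by have := (abs_nonneg _).trans h2; positivity)
      have := mul_le_mul_of_nonneg_left h2 hK0
      linarith
    · have h1 : Integrable (fun x => |u x|) ν := (hu.integrable (by norm_num)).abs
      exact ((integrable_const _).add ((h1.add (integrable_const _)).const_mul _)).mul_const _
    · exact ((hW.differentiable (by norm_num) _).hasDerivAt.comp s (hlin x s))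
  · refine (hasDerivAt_integral_of_dominated_loc_of_deriv_le
      (F' := fun s x => deriv (deriv W) (u x + s * φ x) * φ x ^ 2)
      (bound := fun _ => K * C ^ 2) (Metric.ball_mem_nhds t one_pos)
      (Filter.Eventually.of_forall fun s => (hint s).1) (hint t)
      ((hW2.comp_aestronglyMeasurable (hut t).1).mul (hφ.pow 2))
      (Filter.Eventually.of_forall fun x s _ => ?_) (integrable_const _)
      (Filter.Eventually.of_forall fun x s _ => ?_)).2
    · rw [Real.norm_eq_abs, abs_mul, abs_pow]
      exact mul_le_mul (hK _) (pow_le_pow_left₀ (abs_nonneg _) (hC x) 2) (by positivity) hK0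
    · have h := ((hd _).hasDerivAt.comp s (hlin x s)).mul_const (φ x)
      rw [mul_assoc, ← pow_two] at h
      exact h

lemma sigma_pos (hW : IsDoubleWell W) : 0 < sigma W := by
  refine intervalIntegral.intervalIntegral_pos_of_pos_on ?_ (fun x hx => ?_) (by norm_num)
  · exact (Real.continuous_sqrt.comp (hW.contDiff.continuous.div_const 2)).intervalIntegrable _ _
  · have h0 : W x ≠ 0 := fun h => by
      rcases (hW.eq_zero_iff x).1 h with h | h
      · exact hx.1.ne' h
      · exact hx.2.ne h
    exact Real.sqrt_pos.2 (half_pos ((hW.nonneg x).lt_of_ne' h0))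

end Variation

/-! ### Critical points and stability -/

section Energy

variable {m : ℕ} {N : Type*} [TopologicalSpace N] [T2Space N] [CompactSpace N]
  [ChartedSpace (EuclideanSpace ℝ (Fin m)) N] [IsManifold (𝓡 m) ∞ N]
  [MeasurableSpace N] [BorelSpace N] {g : Metric m N} {u φ : N → ℝ}
  {G : ∀ x : N, TangentSpace (𝓡 m) x} {W : ℝ → ℝ} {ε μ K : ℝ}

/-- The choice of a weak gradient in `gradSq` is immaterial up to null sets, so that
`|∇(u + tφ)|²` expands as expected. -/
lemma gradSq_add_mul (hG : HasWeakGradient g u G) (hφ : ContMDiff (𝓡 m) 𝓘(ℝ) ∞ φ) (t : ℝ) :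
    ∀ᵐ x ∂vol g, gradSq g (fun x => u x + t * φ x) x
      = g.inner x (G x) (G x) + 2 * t * g.inner x (G x) (grad g φ x)
        + t ^ 2 * gradInner g φ φ x := by
  have h := hG.add_const_mul (hasWeakGradient_grad (g := g) hφ) t
  have hw : HasWeakGradient g (fun x => u x + t * φ x)
      (weakGradient g fun x => u x + t * φ x) := by
    have hex : ∃ G', HasWeakGradient g (fun x => u x + t * φ x) G' := ⟨_, h⟩
    rw [weakGradient, dif_pos hex]
    exact hex.choose_spec
  filter_upwards [hw.ae_eq h] with x hx
  rw [gradSq, hx]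
  simp only [map_add, map_smul, _root_.add_apply, _root_.smul_apply, smul_eq_mul, gradInner]
  rw [g.symm x (grad g φ x) (G x)]
  ring

/-- The energy along the line `u + tφ`, for a smooth direction `φ`. -/
lemma forcedEnergy_add_mul (hW : ContDiff ℝ 2 W) (hK : ∀ t, |deriv (deriv W) t| ≤ K)
    (hu : MemLp u 2 (vol g)) (hG : HasWeakGradient g u G)
    (hGi : Integrable (fun x => g.inner x (G x) (G x)) (vol g))
    (hφ : ContMDiff (𝓡 m) 𝓘(ℝ) ∞ φ) (t : ℝ) :
    forcedEnergy g W ε μ (fun x => u x + t * φ x)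
      = 1 / (2 * sigma W) * (ε / 2 * (∫ x, g.inner x (G x) (G x) ∂vol g
          + 2 * t * ∫ x, g.inner x (G x) (grad g φ x) ∂vol g
          + t ^ 2 * ∫ x, gradInner g φ φ x ∂vol g)
        + (∫ x, W (u x + t * φ x) ∂vol g) / ε)
        - μ / (2 * sigma W) * (∫ x, u x ∂vol g + t * ∫ x, φ x ∂vol g) := by
  have hφi : Integrable φ (vol g) := hφ.continuous.integrable_vol
  have hφL : MemLp φ 2 (vol g) := (memW12_of_contMDiff hφ).1
  have i3 : Integrable (gradInner g φ φ) (vol g) :=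
    (contMDiff_gradInner hφ hφ).continuous.integrable_vol
  have i2 : Integrable (fun x => g.inner x (G x) (grad g φ x)) (vol g) :=
    hG.integrable_inner (hasWeakGradient_grad hφ) hGi i3
  have iW : Integrable (fun x => W (u x + t * φ x)) (vol g) :=
    integrable_comp_of_deriv2_le hW hK (hu.add (hφL.const_mul t))
  have i12 : Integrable (fun x => g.inner x (G x) (G x)
      + 2 * t * g.inner x (G x) (grad g φ x)) (vol g) := hGi.add (i2.const_mul _)
  have i123 : Integrable (fun x => g.inner x (G x) (G x)
      + 2 * t * g.inner x (G x) (grad g φ x) + t ^ 2 * gradInner g φ φ x) (vol g) :=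
    i12.add (i3.const_mul _)
  have h1 : ∫ x, (ε * gradSq g (fun x => u x + t * φ x) x / 2 + W (u x + t * φ x) / ε) ∂vol g
      = ∫ x, (ε / 2 * (g.inner x (G x) (G x) + 2 * t * g.inner x (G x) (grad g φ x)
        + t ^ 2 * gradInner g φ φ x) + W (u x + t * φ x) / ε) ∂vol g := by
    refine integral_congr_ae ?_
    filter_upwards [gradSq_add_mul hG hφ t] with x hx
    rw [hx]
    ring
  rw [forcedEnergy, energy, h1, integral_add (i123.const_mul _) (iW.div_const _),
    integral_const_mul, integral_div, integral_add i12 (i3.const_mul _),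
    integral_add hGi (i2.const_mul _), integral_const_mul, integral_const_mul,
    integral_add (hu.integrable (by norm_num)) (hφi.const_mul t), integral_const_mul]

/-- The nonlinearity `f = (W'/ε - μ)/ε`: critical points of the forced energy are the weak solutions
of `Δu = f(u)`. -/
def nonlinearity (W : ℝ → ℝ) (ε μ : ℝ) (s : ℝ) : ℝ := (deriv W s / ε - μ) / ε

lemma exists_bounded_abs (hφ : Continuous φ) : ∃ C, ∀ x, |φ x| ≤ C := by
  obtain ⟨C, hC⟩ := isCompact_univ.exists_bound_of_continuousOn hφ.continuousOn
  exact ⟨C, fun x => hC x (Set.mem_univ x)⟩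

/-- The first and the second variation of the forced energy in a smooth direction. -/
lemma hasDerivAt_forcedEnergy (hW : ContDiff ℝ 2 W) (hK : ∀ t, |deriv (deriv W) t| ≤ K)
    (hu : MemLp u 2 (vol g)) (hG : HasWeakGradient g u G)
    (hGi : Integrable (fun x => g.inner x (G x) (G x)) (vol g))
    (hφ : ContMDiff (𝓡 m) 𝓘(ℝ) ∞ φ) :
    HasDerivAt (fun t : ℝ => forcedEnergy g W ε μ fun x => u x + t * φ x)
      (1 / (2 * sigma W) * (ε * ∫ x, g.inner x (G x) (grad g φ x) ∂vol g
        + (∫ x, deriv W (u x) * φ x ∂vol g) / ε - μ * ∫ x, φ x ∂vol g)) 0 ∧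
    deriv (deriv fun t : ℝ => forcedEnergy g W ε μ fun x => u x + t * φ x) 0
      = 1 / (2 * sigma W) * (ε * ∫ x, gradInner g φ φ x ∂vol g
        + (∫ x, deriv (deriv W) (u x) * φ x ^ 2 ∂vol g) / ε) := by
  obtain ⟨C, hC⟩ := exists_bounded_abs hφ.continuous
  have hJ := hasDerivAt_integral_comp hW hK hu hφ.continuous.aestronglyMeasurable hC
  simp only [forcedEnergy_add_mul hW hK hu hG hGi hφ]
  set a := ∫ x, g.inner x (G x) (G x) ∂vol g
  set b := ∫ x, g.inner x (G x) (grad g φ x) ∂vol g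
  set c := ∫ x, gradInner g φ φ x ∂vol g
  set U := ∫ x, u x ∂vol g
  set Φ := ∫ x, φ x ∂vol g
  have hd : ∀ t : ℝ, HasDerivAt (fun t : ℝ => 1 / (2 * sigma W) * (ε / 2 * (a + 2 * t * b
      + t ^ 2 * c) + (∫ x, W (u x + t * φ x) ∂vol g) / ε) - μ / (2 * sigma W) * (U + t * Φ))
      (1 / (2 * sigma W) * (ε * (b + t * c)
        + (∫ x, deriv W (u x + t * φ x) * φ x ∂vol g) / ε - μ * Φ)) t := by
    intro t
    have h1 : HasDerivAt (fun t : ℝ => a + 2 * t * b + t ^ 2 * c) (2 * b + 2 * t * c) t := by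
      have e1 : HasDerivAt (fun t : ℝ => 2 * t * b) (2 * b) t := by
        simpa using ((hasDerivAt_id t).const_mul 2).mul_const b
      have e2 : HasDerivAt (fun t : ℝ => t ^ 2 * c) (2 * t * c) t := by
        simpa using (hasDerivAt_pow 2 t).mul_const c
      exact ((e1.const_add a).add e2).congr_deriv (by simp)
    have h2 : HasDerivAt (fun t : ℝ => U + t * Φ) Φ t := by
      simpa using ((hasDerivAt_id t).mul_const Φ).const_add U
    refine ((((h1.const_mul (ε / 2)).add ((hJ t).1.div_const ε)).const_mul
      (1 / (2 * sigma W))).sub (h2.const_mul (μ / (2 * sigma W)))).congr_deriv ?_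
    ring
  refine ⟨by simpa using hd 0, ?_⟩
  rw [funext fun t => (hd t).deriv]
  have h1 : HasDerivAt (fun t : ℝ => b + t * c) c 0 := by
    simpa using ((hasDerivAt_id (0 : ℝ)).mul_const c).const_add b
  have h2 := (((h1.const_mul ε).add ((hJ 0).2.div_const ε)).sub_const
    (μ * Φ)).const_mul (1 / (2 * sigma W))
  simpa using h2.deriv

/-- The weak form of the equation `Δu = (W'(u)/ε - μ)/ε`. -/
lemma IsCriticalPoint.weak_equation (hW : IsDoubleWell W) (hε : 0 < ε)
    (hcrit : IsCriticalPoint g W ε μ u) (hG : HasWeakGradient g u G)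
    (hGi : Integrable (fun x => g.inner x (G x) (G x)) (vol g))
    (hφ : ContMDiff (𝓡 m) 𝓘(ℝ) ∞ φ) :
    ∫ x, g.inner x (grad g φ x) (G x) ∂vol g
      = -∫ x, nonlinearity W ε μ (u x) * φ x ∂vol g := by
  obtain ⟨K, hK⟩ := hW.quadratic_growth
  have hu := hcrit.1.1
  have h := (hasDerivAt_forcedEnergy (ε := ε) (μ := μ) hW.contDiff hK hu hG hGi hφ).1.unique
    (hcrit.2 φ (memW12_of_contMDiff hφ))
  have hσ := sigma_pos hW
  rw [mul_eq_zero, or_iff_right (by positivity)] at h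
  obtain ⟨C, hC⟩ := exists_bounded_abs hφ.continuous
  have i1 : Integrable (fun x => deriv W (u x) * φ x) (vol g) :=
    (integrable_deriv_comp hW.contDiff hK hu).mul_bdd (c := C)
      hφ.continuous.aestronglyMeasurable (Filter.Eventually.of_forall hC)
  have h1 : ∫ x, nonlinearity W ε μ (u x) * φ x ∂vol g
      = ((∫ x, deriv W (u x) * φ x ∂vol g) / ε - μ * ∫ x, φ x ∂vol g) / ε := by
    rw [← integral_div, ← integral_const_mul, ← integral_sub (i1.div_const ε)
      (hφ.continuous.integrable_vol.const_mul μ), ← integral_div]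
    refine integral_congr_ae (Filter.Eventually.of_forall fun x => ?_)
    simp only [nonlinearity]
    ring
  simp only [g.symm _ (grad g φ _)]
  rw [h1, ← neg_div, eq_div_iff hε.ne']
  linarith

lemma contDiff_nonlinearity {W : ℝ → ℝ} (hW : ContDiff ℝ 2 W) (ε μ : ℝ) :
    ContDiff ℝ 1 (nonlinearity W ε μ) := by
  have := (contDiff_succ_iff_deriv (n := 1)).1 (hW.of_le (by norm_num))
  exact (((this.2.2).div_const ε).sub contDiff_const).div_const ε

lemma deriv_nonlinearity (W : ℝ → ℝ) (hW : ContDiff ℝ 2 W) (ε μ s : ℝ) :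
    HasDerivAt (nonlinearity W ε μ) (deriv (deriv W) s / ε / ε) s :=
  (((hW.differentiable_deriv_two s).hasDerivAt.div_const ε).sub_const μ).div_const ε

/-- Stability as nonnegativity of the quadratic form `∫ |∇φ|² + f'(u) φ²`, tested with smooth
functions only. -/
lemma IsStable.nonneg (hW : IsDoubleWell W) (hε : 0 < ε) (hstab : IsStable g W ε μ u)
    (hu : MemLp u 2 (vol g)) (hG : HasWeakGradient g u G)
    (hGi : Integrable (fun x => g.inner x (G x) (G x)) (vol g))
    (hφ : ContMDiff (𝓡 m) 𝓘(ℝ) ∞ φ) :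
    0 ≤ ∫ x, gradInner g φ φ x ∂vol g
      + ∫ x, deriv (nonlinearity W ε μ) (u x) * φ x ^ 2 ∂vol g := by
  obtain ⟨K, hK⟩ := hW.quadratic_growth
  have h := hstab φ (memW12_of_contMDiff hφ)
  rw [(hasDerivAt_forcedEnergy (ε := ε) (μ := μ) hW.contDiff hK hu hG hGi hφ).2] at h
  have hσ := sigma_pos hW
  have h2 : ∫ x, deriv (nonlinearity W ε μ) (u x) * φ x ^ 2 ∂vol g
      = (∫ x, deriv (deriv W) (u x) * φ x ^ 2 ∂vol g) / ε / ε := by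
    rw [← integral_div, ← integral_div]
    refine integral_congr_ae (Filter.Eventually.of_forall fun x => ?_)
    simp only [(deriv_nonlinearity W hW.contDiff ε μ _).deriv]
    ring
  have h3 := nonneg_of_mul_nonneg_right h (by positivity)
  rw [h2]
  have h4 := div_nonneg h3 hε.le
  rwa [add_div, mul_div_cancel_left₀ _ hε.ne'] at h4

end Energy

/-! ### Localization of the weak equation -/

section Localization

variable {m : ℕ} {Ω : Set (E m)} {U : E m → ℝ} {V : Fin m → E m → ℝ} {θ : E m → ℝ}

/-- The product rule for weak derivatives. -/
lemma integral_mul_pd_of_weak (hU : LocallyIntegrableOn U Ω) {i : Fin m}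
    (hV : LocallyIntegrableOn (V i) Ω)
    (hw : ∀ ψ : E m → ℝ, ContDiff ℝ ∞ ψ → HasCompactSupport ψ → tsupport ψ ⊆ Ω →
      ∫ y, U y * pd i ψ y = -∫ y, V i y * ψ y)
    (hθ : ContDiff ℝ ∞ θ) (hθc : HasCompactSupport θ) (hθs : tsupport θ ⊆ Ω) {ψ : E m → ℝ}
    (hψ : ContDiff ℝ ∞ ψ) :
    Integrable (fun y => U y * θ y * pd i ψ y) ∧
    Integrable (fun y => (U y * pd i θ y + V i y * θ y) * ψ y) ∧
    ∫ y, U y * θ y * pd i ψ y = -∫ y, (U y * pd i θ y + V i y * θ y) * ψ y := by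
  have hpθ := contDiff_pd i hθ
  have e1 : Integrable fun y => U y * (θ y * pd i ψ y) :=
    hU.integrable_mul_of_tsupport_subset (hθ.continuous.mul (contDiff_pd i hψ).continuous)
      hθc.mul_right ((tsupport_mul_subset_left).trans hθs)
  have e2 : Integrable fun y => U y * (pd i θ y * ψ y) :=
    hU.integrable_mul_of_tsupport_subset (hpθ.continuous.mul hψ.continuous)
      (hθc.pd i).mul_right ((tsupport_mul_subset_left).trans ((tsupport_pd_subset i θ).trans hθs))
  have e3 : Integrable fun y => V i y * (θ y * ψ y) :=
    hV.integrable_mul_of_tsupport_subset (hθ.continuous.mul hψ.continuous)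
      hθc.mul_right ((tsupport_mul_subset_left).trans hθs)
  have h := hw (fun y => θ y * ψ y) (hθ.mul hψ) hθc.mul_right
    ((tsupport_mul_subset_left).trans hθs)
  have hpd : ∀ y, U y * pd i (fun y => θ y * ψ y) y
      = U y * (pd i θ y * ψ y) + U y * (θ y * pd i ψ y) := fun y => by
    rw [pd_mul i (hθ.differentiable (by simp) y) (hψ.differentiable (by simp) y)]
    ring
  simp only [hpd] at h
  rw [integral_add e2 e1] at h
  refine ⟨e1.congr (Filter.Eventually.of_forall fun y => by ring),
    (e2.add e3).congr (Filter.Eventually.of_forall fun y => by simp only [Pi.add_apply]; ring), ?_⟩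
  simp only [add_mul, mul_assoc]
  rw [integral_add e2 e3]
  linarith

/-- Cutting off a weak solution of `∑ᵢⱼ ∂ᵢ(aᵢⱼ ∂ⱼU) = H` by a test function `θ` gives a solution of
an equation of the same kind on the whole space. -/
lemma divergence_equation_cutoff {a : Fin m → Fin m → E m → ℝ} {H : E m → ℝ} {B : Fin m → E m → ℝ}
    (hΩ : IsOpen Ω) (ha : ∀ i j, ContDiffOn ℝ ∞ (a i j) Ω)
    (hsymm : ∀ i j, ∀ y ∈ Ω, a i j y = a j i y)
    (hU : LocallyIntegrableOn U Ω) (hV : ∀ i, LocallyIntegrableOn (V i) Ω)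
    (hH : LocallyIntegrableOn H Ω)
    (hw : ∀ i, ∀ ψ : E m → ℝ, ContDiff ℝ ∞ ψ → HasCompactSupport ψ → tsupport ψ ⊆ Ω →
      ∫ y, U y * pd i ψ y = -∫ y, V i y * ψ y)
    (heq : ∀ ψ : E m → ℝ, ContDiff ℝ ∞ ψ → HasCompactSupport ψ → tsupport ψ ⊆ Ω →
      ∑ i, ∑ j, ∫ y, a i j y * V j y * pd i ψ y = -∫ y, H y * ψ y)
    (hθ : ContDiff ℝ ∞ θ) (hθc : HasCompactSupport θ) (hθs : tsupport θ ⊆ Ω)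
    (hB : ∀ i, ContDiff ℝ ∞ (B i)) (hBs : ∀ i, tsupport (B i) ⊆ tsupport θ)
    (hBa : ∀ i y, B i y = ∑ j, a i j y * pd j θ y) {ψ : E m → ℝ} (hψ : ContDiff ℝ ∞ ψ) :
    ∑ i, ∑ j, ∫ y, a i j y * (U y * pd j θ y + V j y * θ y) * pd i ψ y
      = -∫ y, (H y * θ y + 2 * ∑ i, V i y * B i y + U y * ∑ i, pd i (B i) y) * ψ y := by
  have hBc : ∀ i, HasCompactSupport (B i) := fun i =>
    hθc.of_isClosed_subset (isClosed_tsupport _) (hBs i)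
  have hBΩ : ∀ i, tsupport (B i) ⊆ Ω := fun i => (hBs i).trans hθs
  have haV : ∀ i j, LocallyIntegrableOn (fun y => V j y * a i j y) Ω := fun i j =>
    (hV j).mul_continuousOn (ha i j).continuousOn hΩ.isLocallyClosed
  have haU : ∀ i j, LocallyIntegrableOn (fun y => U y * a i j y) Ω := fun i j =>
    hU.mul_continuousOn (ha i j).continuousOn hΩ.isLocallyClosed
  have hψi := fun i => (contDiff_pd i hψ).continuous
  have hθi := fun i => (contDiff_pd i hθ).continuous
  have hθis : ∀ i, tsupport (pd i θ) ⊆ Ω := fun i => (tsupport_pd_subset i θ).trans hθs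
  -- the terms arising from the product rule
  have i1 : ∀ i j, Integrable fun y => U y * a i j y * (pd j θ y * pd i ψ y) := fun i j =>
    (haU i j).integrable_mul_of_tsupport_subset ((hθi j).mul (hψi i)) (hθc.pd j).mul_right
      ((tsupport_mul_subset_left).trans (hθis j))
  have i2 : ∀ i j, Integrable fun y => V j y * a i j y * (θ y * pd i ψ y) := fun i j =>
    (haV i j).integrable_mul_of_tsupport_subset (hθ.continuous.mul (hψi i)) hθc.mul_right
      ((tsupport_mul_subset_left).trans hθs)
  have i3 : ∀ i j, Integrable fun y => V j y * a i j y * (pd i θ y * ψ y) := fun i j =>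
    (haV i j).integrable_mul_of_tsupport_subset ((hθi i).mul hψ.continuous) (hθc.pd i).mul_right
      ((tsupport_mul_subset_left).trans (hθis i))
  have i4 : ∀ j, Integrable fun y => V j y * (B j y * ψ y) := fun j =>
    (hV j).integrable_mul_of_tsupport_subset ((hB j).continuous.mul hψ.continuous)
      (hBc j).mul_right ((tsupport_mul_subset_left).trans (hBΩ j))
  have i5 : Integrable fun y => H y * (θ y * ψ y) :=
    hH.integrable_mul_of_tsupport_subset (hθ.continuous.mul hψ.continuous) hθc.mul_right
      ((tsupport_mul_subset_left).trans hθs)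
  have i6 : ∀ i, Integrable fun y => U y * (pd i (B i) y * ψ y) := fun i =>
    hU.integrable_mul_of_tsupport_subset ((contDiff_pd i (hB i)).continuous.mul hψ.continuous)
      ((hBc i).pd i).mul_right ((tsupport_mul_subset_left).trans
        ((tsupport_pd_subset i (B i)).trans (hBΩ i)))
  have hsplit : ∑ i, ∑ j, ∫ y, a i j y * (U y * pd j θ y + V j y * θ y) * pd i ψ y
      = ∑ i, (∫ y, U y * B i y * pd i ψ y)
        + ∑ i, ∑ j, ∫ y, V j y * a i j y * (θ y * pd i ψ y) := by
    rw [← Finset.sum_add_distrib]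
    refine Finset.sum_congr rfl fun i _ => ?_
    have e : ∫ y, U y * B i y * pd i ψ y
        = ∑ j, ∫ y, U y * a i j y * (pd j θ y * pd i ψ y) := by
      rw [← integral_finsetSum _ fun j _ => i1 i j]
      refine integral_congr_ae (Filter.Eventually.of_forall fun y => ?_)
      simp only [hBa, Finset.mul_sum, Finset.sum_mul]
      exact Finset.sum_congr rfl fun j _ => by ring
    rw [e, ← Finset.sum_add_distrib]
    refine Finset.sum_congr rfl fun j _ => ?_
    rw [← integral_add (i1 i j) (i2 i j)]
    exact integral_congr_ae (Filter.Eventually.of_forall fun y => by ring)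
  have hfirst : ∀ i, ∫ y, U y * B i y * pd i ψ y
      = -((∫ y, U y * (pd i (B i) y * ψ y)) + ∫ y, V i y * (B i y * ψ y)) := fun i => by
    rw [(integral_mul_pd_of_weak hU (hV i) (hw i) (hB i) (hBc i) (hBΩ i) hψ).2.2,
      ← integral_add (i6 i) (i4 i)]
    congr 1
    exact integral_congr_ae (Filter.Eventually.of_forall fun y => by ring)
  have hsecond : ∑ i, ∑ j, ∫ y, V j y * a i j y * (θ y * pd i ψ y)
      = -(∫ y, H y * (θ y * ψ y)) - ∑ j, ∫ y, V j y * (B j y * ψ y) := by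
    have h := heq (fun y => θ y * ψ y) (hθ.mul hψ) hθc.mul_right
      ((tsupport_mul_subset_left).trans hθs)
    have e1 : ∀ i j, ∫ y, a i j y * V j y * pd i (fun y => θ y * ψ y) y
        = (∫ y, V j y * a i j y * (pd i θ y * ψ y))
          + ∫ y, V j y * a i j y * (θ y * pd i ψ y) := fun i j => by
      rw [← integral_add (i3 i j) (i2 i j)]
      refine integral_congr_ae (Filter.Eventually.of_forall fun y => ?_)
      simp only
      rw [pd_mul i (hθ.differentiable (by simp) y) (hψ.differentiable (by simp) y)]
      ring
    have e2 : ∀ j, ∑ i, ∫ y, V j y * a i j y * (pd i θ y * ψ y)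
        = ∫ y, V j y * (B j y * ψ y) := fun j => by
      rw [← integral_finsetSum _ fun i _ => i3 i j]
      refine integral_congr_ae (Filter.Eventually.of_forall fun y => ?_)
      simp only [hBa, Finset.mul_sum, Finset.sum_mul]
      refine Finset.sum_congr rfl fun i _ => ?_
      by_cases hy : y ∈ Ω
      · rw [hsymm i j y hy]
        ring
      · rw [image_eq_zero_of_notMem_tsupport fun h => hy (hθis i h)]
        ring
    simp only [e1, Finset.sum_add_distrib] at h
    rw [Finset.sum_comm, Finset.sum_congr rfl fun j _ => e2 j] at h
    linarith
  rw [hsplit, hsecond, Finset.sum_congr rfl fun i _ => hfirst i]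
  have hR : ∫ y, (H y * θ y + 2 * ∑ i, V i y * B i y + U y * ∑ i, pd i (B i) y) * ψ y
      = (∫ y, H y * (θ y * ψ y)) + 2 * (∑ i, ∫ y, V i y * (B i y * ψ y))
        + ∑ i, ∫ y, U y * (pd i (B i) y * ψ y) := by
    have j4 := integrable_finsetSum Finset.univ fun i (_ : i ∈ Finset.univ) => i4 i
    have j6 := integrable_finsetSum Finset.univ fun i (_ : i ∈ Finset.univ) => i6 i
    have j5 : Integrable fun y => H y * (θ y * ψ y) + 2 * ∑ i, V i y * (B i y * ψ y) :=
      i5.add (j4.const_mul 2)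
    rw [← integral_finsetSum _ fun i _ => i4 i, ← integral_finsetSum _ fun i _ => i6 i,
      ← integral_const_mul, ← integral_add i5 (j4.const_mul 2), ← integral_add j5 j6]
    refine integral_congr_ae (Filter.Eventually.of_forall fun y => ?_)
    simp only [Finset.sum_mul, Finset.mul_sum, add_mul]
    congr 1
    · congr 1
      · ring
      · exact Finset.sum_congr rfl fun i _ => by ring
    · exact Finset.sum_congr rfl fun i _ => by ring
  rw [hR, Finset.sum_neg_distrib, Finset.sum_add_distrib]
  ring

/-- A function that is locally square integrable on `Ω`, times a test function. -/
lemma memLp_mul_of_sq_le {f q : E m → ℝ} (hf : LocallyIntegrableOn f Ω)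
    (hq : LocallyIntegrableOn q Ω) (hfq : ∀ y ∈ Ω, f y ^ 2 ≤ q y) (hθ : Continuous θ)
    (hθc : HasCompactSupport θ) (hθs : tsupport θ ⊆ Ω) : MemLp (fun y => f y * θ y) 2 volume := by
  have h1 := hf.integrable_mul_of_tsupport_subset hθ hθc hθs
  have h2 : Integrable fun y => q y * (θ y * θ y) :=
    hq.integrable_mul_of_tsupport_subset (hθ.mul hθ) hθc.mul_right
      ((tsupport_mul_subset_left).trans hθs)
  refine (memLp_two_iff_integrable_sq h1.1).2 (h2.mono' (h1.1.pow 2)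
    (Filter.Eventually.of_forall fun y => ?_))
  simp only [Real.norm_eq_abs, abs_of_nonneg (sq_nonneg (f y * θ y))]
  by_cases hy : y ∈ Ω
  · have := mul_le_mul_of_nonneg_right (hfq y hy) (mul_self_nonneg (θ y))
    linarith
  · have h0 : θ y = 0 := image_eq_zero_of_notMem_tsupport fun h => hy (hθs h)
    simp [h0]

end Localization

/-! ### Transfer of `L²` estimates between charts and manifold -/

section Transfer

open Set

variable {m : ℕ} {N : Type*} [TopologicalSpace N]
  [ChartedSpace (EuclideanSpace ℝ (Fin m)) N] [IsManifold (𝓡 m) ∞ N]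
  [MeasurableSpace N] [BorelSpace N] {g : Metric m N} {p : N}

lemma locallyIntegrableOn_param {f : N → ℝ} (hf : Integrable f (vol g)) (p : N) :
    LocallyIntegrableOn (fun y => f (param m p y)) (coordDomain m p) := by
  have h1 : Integrable f ((vol g).restrict (chartDomain m p)) := hf.restrict
  rw [vol_restrict, chartVolume_eq_map] at h1
  have h2 := (integrable_map_measure h1.1 (aemeasurable_param g p)).1 h1
  rw [coordMeasure, integrable_withDensity_iff_integrable_smul₀' (aemeasurable_density g p)
    (ae_of_all _ fun _ => ENNReal.ofReal_lt_top)] at h2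
  have hm := (isOpen_coordDomain (m := m) p).measurableSet
  have h3 : LocallyIntegrableOn (fun y => f (param m p y) * density g p y) (coordDomain m p) := by
    refine (IntegrableOn.locallyIntegrableOn h2).congr ?_
    filter_upwards [ae_restrict_mem hm] with y hy
    rw [ENNReal.toReal_ofReal (density_pos hy).le, smul_eq_mul, mul_comm]
    rfl
  have h4 := h3.mul_continuousOn (g := fun y => (density g p y)⁻¹)
    (contDiffOn_density.continuousOn.inv₀ fun y hy => (density_pos hy).ne')
    (isOpen_coordDomain p).isLocallyClosed
  refine h4.congr ?_
  filter_upwards [ae_restrict_mem hm] with y hy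
  rw [mul_assoc, mul_inv_cancel₀ (density_pos hy).ne', mul_one]

/-- On a compact part of a chart the Riemannian volume is bounded by a multiple of Lebesgue
measure, hence so are the `L²` norms. -/
lemma exists_eLpNorm_vol_le {K : Set (E m)} (hK : IsCompact K) (hKD : K ⊆ coordDomain m p) :
    ∃ C : ENNReal, C ≠ ⊤ ∧ ∀ f : N → ℝ, AEStronglyMeasurable f (vol g) →
      (∀ x ∉ param m p '' K, f x = 0) →
      eLpNorm f 2 (vol g) ≤ C * eLpNorm (fun y => f (param m p y)) 2 (volume.restrict K) := by
  obtain ⟨c, hc⟩ := hK.exists_bound_of_continuousOn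
    ((contDiffOn_density (g := g) (p := p)).continuousOn.mono hKD)
  refine ⟨ENNReal.ofReal c ^ (1 / (2 : ENNReal)).toReal,
    ENNReal.rpow_ne_top_of_nonneg (by simp) ENNReal.ofReal_ne_top, fun f hf h0 => ?_⟩
  have hsub : Function.support f ⊆ chartDomain m p := by
    intro x hx
    by_contra hxD
    exact hx (h0 x fun ⟨y, hy, hyx⟩ => hxD (hyx ▸ param_mem (hKD hy)))
  have hf' : AEStronglyMeasurable f (chartVolume g p) := by
    rw [← vol_restrict]
    exact hf.restrict
  rw [chartVolume_eq_map] at hf'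
  rw [← eLpNorm_restrict_eq_of_support_subset hsub, vol_restrict, chartVolume_eq_map,
    eLpNorm_map_measure hf' (aemeasurable_param g p)]
  have h1 : eLpNorm (f ∘ param m p) 2 (coordMeasure g p)
      = eLpNorm (K.indicator (f ∘ param m p)) 2 (coordMeasure g p) := by
    refine eLpNorm_congr_ae ?_
    filter_upwards [ae_mem_coordDomain g p] with y hy
    by_cases hyK : y ∈ K
    · rw [indicator_of_mem hyK]
    · rw [indicator_of_notMem hyK]
      refine h0 _ fun ⟨z, hz, hzy⟩ => hyK ?_
      rwa [← coord_param hy, ← hzy, coord_param (hKD hz)]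
  have h2 : (coordMeasure g p).restrict K ≤ ENNReal.ofReal c • volume.restrict K := by
    rw [coordMeasure, restrict_withDensity hK.measurableSet,
      Measure.restrict_restrict hK.measurableSet, inter_eq_left.2 hKD, ← withDensity_const]
    refine withDensity_mono ?_
    filter_upwards [ae_restrict_mem hK.measurableSet] with y hy
    exact ENNReal.ofReal_le_ofReal ((le_abs_self _).trans (hc y hy))
  rw [h1, eLpNorm_indicator_eq_eLpNorm_restrict hK.measurableSet]
  refine (eLpNorm_mono_measure _ h2).trans_eq ?_
  rw [eLpNorm_smul_measure_of_ne_top (by norm_num), smul_eq_mul]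
  rfl

/-- Convergence in `L²` on the manifold, for functions supported in a fixed compact subset of a
chart, follows from `L²` convergence of majorants in the chart. -/
lemma tendsto_eLpNorm_vol {K : Set (E m)} (hK : IsCompact K) (hKD : K ⊆ coordDomain m p)
    {f : ℕ → N → ℝ} (hf : ∀ k, AEStronglyMeasurable (f k) (vol g))
    (h0 : ∀ k, ∀ x ∉ param m p '' K, f k x = 0) {r : ℕ → E m → ℝ} {c : ℝ}
    (hr : ∀ k, ∀ y ∈ K, |f k (param m p y)| ≤ c * |r k y|)
    (hlim : Filter.Tendsto (fun k => eLpNorm (r k) 2 volume) Filter.atTop (nhds 0)) :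
    Filter.Tendsto (fun k => eLpNorm (f k) 2 (vol g)) Filter.atTop (nhds 0) := by
  obtain ⟨C, hC, h⟩ := exists_eLpNorm_vol_le (g := g) hK hKD
  have h1 : ∀ k, eLpNorm (f k) 2 (vol g) ≤ C * (ENNReal.ofReal c * eLpNorm (r k) 2 volume) := by
    intro k
    refine (h (f k) (hf k) (h0 k)).trans (mul_le_mul_right ?_ _)
    refine (eLpNorm_le_mul_eLpNorm_of_ae_le_mul (c := c) ?_ 2).trans
      (mul_le_mul_right (eLpNorm_mono_measure _ Measure.restrict_le_self) _)
    filter_upwards [ae_restrict_mem hK.measurableSet] with y hy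
    exact hr k y hy
  have h2 := ENNReal.Tendsto.const_mul (ENNReal.Tendsto.const_mul hlim
    (Or.inr (ENNReal.ofReal_ne_top (r := c)))) (Or.inr hC)
  simp only [mul_zero] at h2
  exact tendsto_of_tendsto_of_tendsto_of_le_of_le tendsto_const_nhds h2 (fun _ => zero_le) h1

end Transfer

/-! ### Smooth approximation in a chart -/

section Approximation

open Set Filter

variable {m : ℕ} {N : Type*} [TopologicalSpace N]
  [ChartedSpace (EuclideanSpace ℝ (Fin m)) N] [IsManifold (𝓡 m) ∞ N]
  {g : Metric m N} {p : N} {y : E m} {x : N}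

lemma inner_ext {v w : TangentSpace (𝓡 m) x} (h : ∀ z, g.inner x v z = g.inner x w z) : v = w := by
  rw [← sub_eq_zero]
  by_contra hne
  have h1 := g.pos x _ hne
  have h2 : g.inner x (v - w) (v - w) = 0 := by
    rw [map_sub (g.inner x), _root_.sub_apply, h, sub_self]
  exact h1.ne' h2

lemma grad_eq_zero {h : N → ℝ} (hx : x ∉ tsupport h) : grad g h x = 0 := by
  have h0 : h =ᶠ[nhds x] fun _ => 0 := notMem_tsupport_iff_eventuallyEq.1 hx
  refine inner_ext (g := g) fun z => ?_
  rw [inner_grad, h0.mfderiv_eq, mfderiv_const, map_zero]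
  rfl

lemma lap_eq_zero {h : N → ℝ} (hx : x ∉ tsupport h) : lap g h x = 0 := by
  have h0 : h =ᶠ[nhds x] fun _ => 0 := notMem_tsupport_iff_eventuallyEq.1 hx
  have hy := coord_mem (mem_chartDomain (m := m) x)
  have hc : Tendsto (param m x) (nhds (coord m x x)) (nhds x) := by
    have := ((contMDiffOn_param x).continuousOn.continuousAt
      ((isOpen_coordDomain (m := m) x).mem_nhds hy)).tendsto
    rwa [param_coord (mem_chartDomain x)] at this
  have h1 : (fun y => h (param m x y)) =ᶠ[nhds (coord m x x)] fun _ => 0 := hc.eventually h0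
  have hpd : ∀ (i : Fin m) {f : E m → ℝ}, f =ᶠ[nhds (coord m x x)] (fun _ => 0) →
      pd i f =ᶠ[nhds (coord m x x)] fun _ => 0 := fun i f hf => by
    filter_upwards [hf.eventuallyEq_nhds] with z hz
    rw [pd_congr i hz]
    simp [pd]
  have hg : ∀ i, gradC g x (fun y => h (param m x y)) i =ᶠ[nhds (coord m x x)] fun _ => 0 := by
    intro i
    filter_upwards [eventually_all.2 fun l => hpd l h1] with z hz
    simp [gradC, hz]
  rw [lap, lapC, divC, Finset.sum_eq_zero fun i _ => (hpd i (hg i)).eq_of_nhds, zero_add]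
  exact Finset.sum_eq_zero fun i _ => Finset.sum_eq_zero fun k _ => by
    rw [(hg i).eq_of_nhds, mul_zero]

variable (g) in
/-- The length `√g(v, v)` of a tangent vector. -/
def vnorm (x : N) (v : TangentSpace (𝓡 m) x) : ℝ := Real.sqrt (g.inner x v v)

lemma vnorm_sq (x : N) (v : TangentSpace (𝓡 m) x) : vnorm g x v ^ 2 = g.inner x v v :=
  Real.sq_sqrt (inner_self_nonneg x v)

lemma inner_le_vnorm_mul (x : N) (v w : TangentSpace (𝓡 m) x) :
    g.inner x v w ≤ vnorm g x v * vnorm g x w := by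
  have hv := inner_self_nonneg (g := g) x v
  have hw := inner_self_nonneg (g := g) x w
  have hq : ∀ t : ℝ, 0 ≤ g.inner x v v * (t * t) + (2 * g.inner x v w) * t + g.inner x w w := by
    intro t
    have h := inner_self_nonneg (g := g) x (t • v + w)
    simp only [map_add, map_smul, _root_.add_apply, _root_.smul_apply, smul_eq_mul,
      g.symm x w v] at h
    linarith
  have hd := discrim_le_zero hq
  rw [discrim] at hd
  rw [vnorm, vnorm, ← Real.sqrt_mul hv]
  exact Real.le_sqrt_of_sq_le (by linarith)

lemma vnorm_add_le (x : N) (v w : TangentSpace (𝓡 m) x) :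
    vnorm g x (v + w) ≤ vnorm g x v + vnorm g x w := by
  refine Real.sqrt_le_iff.2 ⟨add_nonneg (Real.sqrt_nonneg _) (Real.sqrt_nonneg _), ?_⟩
  simp only [map_add, _root_.add_apply, g.symm x w v, ← vnorm_sq]
  have := inner_le_vnorm_mul (g := g) x v w
  linarith [add_sq (vnorm g x v) (vnorm g x w)]

lemma vnorm_sum_le {ι : Type*} (s : Finset ι) (x : N) (v : ι → TangentSpace (𝓡 m) x) :
    vnorm g x (∑ a ∈ s, v a) ≤ ∑ a ∈ s, vnorm g x (v a) :=
  Finset.le_sum_of_subadditive (vnorm g x) (by simp [vnorm]) (vnorm_add_le x) s v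

/-- On a compact part of a chart the length of a tangent vector is controlled by its covariant
components. -/
lemma exists_vnorm_le {K : Set (E m)} (hK : IsCompact K) (hKD : K ⊆ coordDomain m p) :
    ∃ c : ℝ, ∀ y ∈ K, ∀ v : TangentSpace (𝓡 m) (param m p y),
      vnorm g (param m p y) v ≤ c * ∑ j, |g.inner (param m p y) v (coordVec m p y j)| := by
  choose b hb using fun k l : Fin m => hK.exists_bound_of_continuousOn
    ((contDiffOn_gram_inv (g := g) (p := p) k l).continuousOn.mono hKD)
  set c : ℝ := ∑ k, ∑ l, |b k l| with hc
  have hc0 : 0 ≤ c := Finset.sum_nonneg fun k _ => Finset.sum_nonneg fun l _ => abs_nonneg _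
  have hle : ∀ k l, |b k l| ≤ c := fun k l =>
    (Finset.single_le_sum (f := fun l => |b k l|) (fun l _ => abs_nonneg _)
      (Finset.mem_univ l)).trans
    (Finset.single_le_sum (f := fun k => ∑ l, |b k l|)
      (fun k _ => Finset.sum_nonneg fun l _ => abs_nonneg _) (Finset.mem_univ k))
  refine ⟨Real.sqrt c, fun y hy v => ?_⟩
  have hS : 0 ≤ ∑ j, |g.inner (param m p y) v (coordVec m p y j)| :=
    Finset.sum_nonneg fun j _ => abs_nonneg _
  refine Real.sqrt_le_iff.2 ⟨mul_nonneg (Real.sqrt_nonneg _) hS, ?_⟩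
  rw [mul_pow, Real.sq_sqrt hc0, inner_eq_sum_inv (hKD hy), pow_two, Finset.sum_mul_sum,
    Finset.mul_sum]
  refine Finset.sum_le_sum fun k _ => ?_
  rw [Finset.sum_mul, Finset.mul_sum]
  refine Finset.sum_le_sum fun l _ => ?_
  refine (le_abs_self _).trans ?_
  rw [abs_mul, abs_mul, mul_assoc, mul_comm |g.inner (param m p y) v (coordVec m p y l)|]
  exact mul_le_mul_of_nonneg_right ((hb k l y hy).trans ((le_abs_self _).trans (hle k l)))
    (mul_nonneg (abs_nonneg _) (abs_nonneg _))

variable [T2Space N] [CompactSpace N] [MeasurableSpace N] [BorelSpace N] {u F : N → ℝ}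
  {G : ∀ x : N, TangentSpace (𝓡 m) x}

/-- The weak equation in a chart, in divergence form. -/
lemma weak_equation_chart (hweak : ∀ φ : N → ℝ, ContMDiff (𝓡 m) 𝓘(ℝ) ∞ φ →
      ∫ x, g.inner x (grad g φ x) (G x) ∂vol g = -∫ x, F x * φ x ∂vol g)
    (hG : HasWeakGradient g u G) {ψ : E m → ℝ} (hψ : ContDiff ℝ ∞ ψ) (hψc : HasCompactSupport ψ)
    (hψs : tsupport ψ ⊆ coordDomain m p) :
    ∑ i, ∑ j, ∫ y, density g p y * (gram g p y)⁻¹ i j * cov g p G j y * pd i ψ y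
      = -∫ y, density g p y * F (param m p y) * ψ y := by
  have hφ := contMDiff_ofChart (p := p) hψc hψs hψ le_rfl
  have hφs := tsupport_ofChart_subset_chartDomain hψc hψs
  have hm := (isOpen_coordDomain (m := m) p).measurableSet
  have h := hweak _ hφ
  have hout : ∀ i, ∀ y ∉ coordDomain m p, pd i ψ y = 0 := fun i y hy =>
    image_eq_zero_of_notMem_tsupport fun h => hy (hψs (tsupport_pd_subset i ψ h))
  rw [integral_vol_of_support_subset g p, integral_vol_of_support_subset g p] at h
  · have hint : ∀ i j, Integrable fun y =>
        density g p y * (gram g p y)⁻¹ i j * cov g p G j y * pd i ψ y := fun i j =>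
      (((hG p).2 j).1.continuousOn_mul
        (contDiffOn_density.mul (contDiffOn_gram_inv i j)).continuousOn
        (isOpen_coordDomain p).isLocallyClosed).integrable_mul_of_tsupport_subset
        (contDiff_pd i hψ).continuous (hψc.pd i) ((tsupport_pd_subset i ψ).trans hψs)
    have e1 : ∫ y in coordDomain m p, density g p y *
          g.inner (param m p y) (grad g (ofChart m p ψ) (param m p y)) (G (param m p y))
        = ∑ i, ∑ j, ∫ y, density g p y * (gram g p y)⁻¹ i j * cov g p G j y * pd i ψ y := by
      rw [Finset.sum_congr rfl fun i _ => (integral_finsetSum _ fun j _ => hint i j).symm,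
        ← integral_finsetSum _ fun i _ => integrable_finsetSum _ fun j _ => hint i j,
        ← setIntegral_eq_integral_of_forall_compl_eq_zero (s := coordDomain m p)
          (f := fun y => ∑ i, ∑ j,
            density g p y * (gram g p y)⁻¹ i j * cov g p G j y * pd i ψ y)]
      · refine setIntegral_congr_fun hm fun y hy => ?_
        rw [inner_grad_param (hφ.of_le (by simp)) hy, Finset.sum_comm, Finset.mul_sum]
        refine Finset.sum_congr rfl fun j _ => ?_
        rw [gradC_congr (fun z hz => ofChart_param ψ hz) hy, gradC, Finset.sum_mul,
          Finset.mul_sum]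
        refine Finset.sum_congr rfl fun i _ => ?_
        rw [gram_inv_symm]
        ring
      · intro y hy
        simp [hout _ y hy]
    have e2 : ∫ y in coordDomain m p, density g p y *
          (F (param m p y) * ofChart m p ψ (param m p y))
        = ∫ y, density g p y * F (param m p y) * ψ y := by
      rw [← setIntegral_eq_integral_of_forall_compl_eq_zero (s := coordDomain m p)
        (f := fun y => density g p y * F (param m p y) * ψ y)]
      · refine setIntegral_congr_fun hm fun y hy => ?_
        simp only [ofChart_param ψ hy, mul_assoc]
      · intro y hy
        have : ψ y = 0 := image_eq_zero_of_notMem_tsupport fun h => hy (hψs h)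
        simp [this]
    rw [← e1, ← e2, h]
  · intro x hx
    simp only [ofChart, indicator_of_notMem hx, mul_zero]
  · intro x hx
    rw [grad_eq_zero fun h => hx (hφs h), map_zero]
    rfl

lemma aestronglyMeasurable_vnorm_cutoff (hG : HasWeakGradient g u G) {χ v : N → ℝ}
    (hχ : ContMDiff (𝓡 m) 𝓘(ℝ) ∞ χ) (hv : ContMDiff (𝓡 m) 𝓘(ℝ) ∞ v) :
    AEStronglyMeasurable (fun x => vnorm g x (grad g v x - (χ x • G x + u x • grad g χ x)))
      (vol g) := by
  have hm : ∀ q j, AEStronglyMeasurable (cov g q (fun x => grad g v x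
      - (χ x • G x + u x • grad g χ x)) j) (volume.restrict (coordDomain m q)) := by
    intro q j
    refine AEStronglyMeasurable.congr (f := fun y => cov g q (grad g v) j y
      - (χ (param m q y) * cov g q G j y + u (param m q y) * cov g q (grad g χ) j y)) ?_
      (Filter.Eventually.of_forall fun y => ?_)
    · have h1 : AEStronglyMeasurable (fun y => χ (param m q y))
          (volume.restrict (coordDomain m q)) :=
        (contDiffOn_comp_param hχ le_rfl q).continuousOn.aestronglyMeasurable
          (isOpen_coordDomain q).measurableSet
      exact ((hasWeakGradient_grad hv).aestronglyMeasurable_cov q j).sub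
        ((h1.mul (hG.aestronglyMeasurable_cov q j)).add
          ((hG q).1.aestronglyMeasurable.mul
            ((hasWeakGradient_grad hχ).aestronglyMeasurable_cov q j)))
    · simp only [cov, map_sub, map_add, map_smul, _root_.sub_apply, _root_.add_apply,
        _root_.smul_apply, smul_eq_mul]
  exact Real.continuous_sqrt.comp_aestronglyMeasurable (aestronglyMeasurable_inner hm hm)

lemma aestronglyMeasurable_lap_cutoff (hu : AEStronglyMeasurable u (vol g))
    (hG : HasWeakGradient g u G) (hF : AEStronglyMeasurable F (vol g)) {χ v : N → ℝ}
    (hχ : ContMDiff (𝓡 m) 𝓘(ℝ) ∞ χ) (hv : ContMDiff (𝓡 m) 𝓘(ℝ) ∞ v) :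
    AEStronglyMeasurable (fun x => lap g v x
      - (χ x * F x + 2 * g.inner x (grad g χ x) (G x) + u x * lap g χ x)) (vol g) :=
  (contMDiff_lap hv).continuous.aestronglyMeasurable.sub
    (((hχ.continuous.aestronglyMeasurable.mul hF).add ((aestronglyMeasurable_inner
      (hasWeakGradient_grad hχ).aestronglyMeasurable_cov
      hG.aestronglyMeasurable_cov).const_mul 2)).add
      (hu.mul (contMDiff_lap hχ).continuous.aestronglyMeasurable))

/-- A cut-off weak solution `χu` of `Δu = F` is approximated by smooth functions, together with its
gradient and its Laplacian `χF + 2⟨∇χ, ∇u⟩ + uΔχ`: this is Friedrichs approximation in the chart,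
with the coefficients `√(det g) gⁱʲ`. -/
lemma exists_smooth_approx_chart (hu : MemLp u 2 (vol g)) (hG : HasWeakGradient g u G)
    (hGi : Integrable (fun x => g.inner x (G x) (G x)) (vol g)) (hF : MemLp F 2 (vol g))
    (hweak : ∀ φ : N → ℝ, ContMDiff (𝓡 m) 𝓘(ℝ) ∞ φ →
      ∫ x, g.inner x (grad g φ x) (G x) ∂vol g = -∫ x, F x * φ x ∂vol g)
    {χ : N → ℝ} (hχ : ContMDiff (𝓡 m) 𝓘(ℝ) ∞ χ) (hχs : tsupport χ ⊆ chartDomain m p) :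
    ∃ v : ℕ → N → ℝ, (∀ k, ContMDiff (𝓡 m) 𝓘(ℝ) ∞ (v k)) ∧
      Tendsto (fun k => eLpNorm (fun x => v k x - χ x * u x) 2 (vol g)) atTop (nhds 0) ∧
      Tendsto (fun k => eLpNorm (fun x => vnorm g x (grad g (v k) x
        - (χ x • G x + u x • grad g χ x))) 2 (vol g)) atTop (nhds 0) ∧
      Tendsto (fun k => eLpNorm (fun x => lap g (v k) x
        - (χ x * F x + 2 * g.inner x (grad g χ x) (G x) + u x * lap g χ x)) 2 (vol g))
        atTop (nhds 0) := by
  have hΩ := isOpen_coordDomain (m := m) p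
  have hlc := hΩ.isLocallyClosed
  set θ := inChart m p χ with hθdef
  have hθ : ContDiff ℝ ∞ θ := contDiff_inChart hχs hχ le_rfl
  have hθc : HasCompactSupport θ := hasCompactSupport_inChart hχs
  set K := coord m p '' tsupport χ with hKdef
  have hK : IsCompact K := isCompact_image_coord hχs
  have hKΩ : K ⊆ coordDomain m p := image_coord_subset hχs
  have hθK : tsupport θ ⊆ K := tsupport_inChart_subset hχs
  have hθs : tsupport θ ⊆ coordDomain m p := hθK.trans hKΩ
  set U : E m → ℝ := fun y => u (param m p y) with hUdef
  set a : Fin m → Fin m → E m → ℝ := fun i j y => density g p y * (gram g p y)⁻¹ i j with hadef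
  have ha : ∀ i j, ContDiffOn ℝ ∞ (a i j) (coordDomain m p) := fun i j =>
    contDiffOn_density.mul (contDiffOn_gram_inv i j)
  set H : E m → ℝ := fun y => density g p y * F (param m p y) with hHdef
  set B : Fin m → E m → ℝ := fun i y => ∑ j, a i j y * pd j θ y with hBdef
  have hpθ := fun j => contDiff_pd j hθ
  have hpθs : ∀ j, tsupport (pd j θ) ⊆ coordDomain m p := fun j =>
    (tsupport_pd_subset j θ).trans hθs
  have hB : ∀ i, ContDiff ℝ ∞ (B i) := fun i => ContDiff.sum fun j _ =>
    contDiff_mul_of_tsupport_subset hΩ (ha i j) (hpθ j) (hpθs j)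
  have hBs : ∀ i, tsupport (B i) ⊆ tsupport θ := fun i =>
    closure_minimal (fun y hy => by
      by_contra h0
      exact hy (Finset.sum_eq_zero fun j _ => by
        rw [image_eq_zero_of_notMem_tsupport fun h => h0 (tsupport_pd_subset j θ h), mul_zero]))
      (isClosed_tsupport _)
  have hBc : ∀ i, HasCompactSupport (B i) := fun i =>
    hθc.of_isClosed_subset (isClosed_tsupport _) (hBs i)
  have hU : LocallyIntegrableOn U (coordDomain m p) := (hG p).1
  have hV : ∀ j, LocallyIntegrableOn (cov g p G j) (coordDomain m p) := fun j => ((hG p).2 j).1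
  have hH : LocallyIntegrableOn H (coordDomain m p) :=
    (locallyIntegrableOn_param (hF.integrable (by norm_num)) p).continuousOn_mul
      contDiffOn_density.continuousOn hlc
  -- local square integrability
  have hU2 : ∀ η : E m → ℝ, Continuous η → HasCompactSupport η → tsupport η ⊆ coordDomain m p →
      MemLp (fun y => U y * η y) 2 volume := fun η hη hηc hηs =>
    memLp_mul_of_sq_le hU (locallyIntegrableOn_param hu.integrable_sq p) (fun y _ => le_rfl)
      hη hηc hηs
  have hV2 : ∀ j, ∀ η : E m → ℝ, Continuous η → HasCompactSupport η →
      tsupport η ⊆ coordDomain m p → MemLp (fun y => cov g p G j y * η y) 2 volume := by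
    intro j η hη hηc hηs
    refine memLp_mul_of_sq_le (hV j) ((locallyIntegrableOn_param hGi p).mul_continuousOn
      (contDiffOn_gram (g := g) (p := p) j j).continuousOn hlc) (fun y _ => ?_) hη hηc hηs
    have h1 := inner_le_vnorm_mul (g := g) (param m p y) (G (param m p y)) (coordVec m p y j)
    have h2 := inner_le_vnorm_mul (g := g) (param m p y) (-G (param m p y)) (coordVec m p y j)
    have h3 : vnorm g (param m p y) (-G (param m p y))
        = vnorm g (param m p y) (G (param m p y)) := by
      simp [vnorm]
    rw [h3] at h2
    simp only [map_neg, _root_.neg_apply] at h2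
    have h4 := sq_le_sq' (neg_le.1 h2) h1
    rwa [mul_pow, vnorm_sq, vnorm_sq] at h4
  have hH2 : MemLp (fun y => H y * θ y) 2 volume := by
    refine memLp_mul_of_sq_le hH ((locallyIntegrableOn_param hF.integrable_sq p).continuousOn_mul
      (g := fun y => density g p y ^ 2) (contDiffOn_density.continuousOn.pow 2) hlc)
      (fun y _ => ?_) hθ.continuous hθc hθs
    simp only [hHdef, mul_pow, le_refl]
  set z : E m → ℝ := fun y => U y * θ y with hzdef
  set zd : Fin m → E m → ℝ := fun j y => U y * pd j θ y + cov g p G j y * θ y with hzddef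
  set h : E m → ℝ := fun y => H y * θ y + 2 * ∑ i, cov g p G i y * B i y + U y * ∑ i, pd i (B i) y
    with hhdef
  have hz : MemLp z 2 volume := hU2 θ hθ.continuous hθc hθs
  have hzd : ∀ j, MemLp (zd j) 2 volume := fun j =>
    (hU2 _ (hpθ j).continuous (hθc.pd j) (hpθs j)).add (hV2 j θ hθ.continuous hθc hθs)
  have hh : MemLp h 2 volume := by
    refine (hH2.add ((memLp_finsetSum Finset.univ fun i _ => hV2 i (B i) (hB i).continuous (hBc i)
      ((hBs i).trans hθs)).const_mul 2)).add ?_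
    have := memLp_finsetSum Finset.univ fun i (_ : i ∈ Finset.univ) =>
      hU2 (pd i (B i)) (contDiff_pd i (hB i)).continuous ((hBc i).pd i)
        ((tsupport_pd_subset i (B i)).trans ((hBs i).trans hθs))
    simpa only [Finset.mul_sum] using this
  obtain ⟨K', hK', hK'Ω, Z, hZ, hZs, hZ0, hZ1, hZ2⟩ :=
    exists_friedrichs_approx hΩ hK hKΩ ha hz hzd hh
    (fun y hy => by
      have h0 : θ y = 0 := inChart_eq_zero hy
      simp only [hzdef, h0, mul_zero])
    (fun j y hy => by
      have h0 : θ y = 0 := inChart_eq_zero hy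
      simp only [hzddef, h0, mul_zero, add_zero]
      rw [image_eq_zero_of_notMem_tsupport fun h => hy (hθK (tsupport_pd_subset j θ h)), mul_zero])
    (fun ψ hψ _ j => (integral_mul_pd_of_weak hU (hV j) ((hG p).2 j).2 hθ hθc hθs hψ).2.2)
    (fun ψ hψ _ => divergence_equation_cutoff hΩ ha (fun i j y _ => by
        simp only [hadef]
        rw [gram_inv_symm]) hU hV hH (fun i => ((hG p).2 i).2)
      (fun ψ hψ hψc hψs => weak_equation_chart hweak hG hψ hψc hψs) hθ hθc hθs hB hBs
      (fun _ _ => rfl) hψ)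
  have hZc : ∀ k, HasCompactSupport (Z k) := fun k =>
    hK'.of_isClosed_subset (isClosed_tsupport _) (hZs k)
  have hZΩ : ∀ k, tsupport (Z k) ⊆ coordDomain m p := fun k => (hZs k).trans hK'Ω
  have hv : ∀ k, ContMDiff (𝓡 m) 𝓘(ℝ) ∞ (ofChart m p (Z k)) := fun k =>
    contMDiff_ofChart (hZc k) (hZΩ k) (hZ k) le_rfl
  have hKK : IsCompact (K' ∪ K) := hK'.union hK
  have hKKΩ : K' ∪ K ⊆ coordDomain m p := union_subset hK'Ω hKΩ
  have hvout : ∀ k, ∀ x ∉ param m p '' (K' ∪ K), x ∉ tsupport (ofChart m p (Z k)) :=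
    fun k x hx h => hx (image_mono ((hZs k).trans subset_union_left)
      (tsupport_ofChart_subset (hZc k) (hZΩ k) h))
  have hχout : ∀ x ∉ param m p '' (K' ∪ K), x ∉ tsupport χ := fun x hx h =>
    hx ⟨coord m p x, Or.inr ⟨x, h, rfl⟩, param_coord (hχs h)⟩
  have hvK : ∀ k, ∀ y ∈ coordDomain m p, ofChart m p (Z k) (param m p y) = Z k y := fun k y hy =>
    ofChart_param (Z k) hy
  have hχK : ∀ y ∈ coordDomain m p, χ (param m p y) = θ y := fun y hy => (inChart_apply χ hy).symm
  have hcovχ : ∀ j, ∀ y ∈ coordDomain m p, cov g p (grad g χ) j y = pd j θ y := fun j y hy => by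
    rw [hθdef, pd_inChart χ hy]
    exact inner_grad_coordVec (hχ.of_le (by simp)) hy j
  have hcovv : ∀ k j, ∀ y ∈ coordDomain m p, cov g p (grad g (ofChart m p (Z k))) j y
      = pd j (Z k) y := fun k j y hy => by
    rw [← pd_congr_on j hΩ hy (hvK k)]
    exact inner_grad_coordVec ((hv k).of_le (by simp)) hy j
  have hχm : AEStronglyMeasurable χ (vol g) := hχ.continuous.aestronglyMeasurable
  refine ⟨fun k => ofChart m p (Z k), hv, ?_, ?_, ?_⟩
  · refine tendsto_eLpNorm_vol hKK hKKΩ (c := 1)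
      (fun k => (hv k).continuous.aestronglyMeasurable.sub (hχm.mul hu.1)) (fun k x hx => ?_)
      (fun k y hy => ?_) hZ0
    · beta_reduce
      rw [image_eq_zero_of_notMem_tsupport (hvout k x hx),
        image_eq_zero_of_notMem_tsupport (hχout x hx)]
      ring
    · beta_reduce
      rw [hvK k y (hKKΩ hy), hχK y (hKKΩ hy), one_mul, mul_comm (θ y)]
  · obtain ⟨c, hc⟩ := exists_vnorm_le (g := g) hKK hKKΩ
    have hcov : ∀ k j y, cov g p (fun x => grad g (ofChart m p (Z k)) x
        - (χ x • G x + u x • grad g χ x)) j y = cov g p (grad g (ofChart m p (Z k))) j y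
        - (χ (param m p y) * cov g p G j y + u (param m p y) * cov g p (grad g χ) j y) := by
      intro k j y
      simp only [cov, map_sub, map_add, map_smul, _root_.sub_apply, _root_.add_apply,
        _root_.smul_apply, smul_eq_mul]
    refine tendsto_eLpNorm_vol hKK hKKΩ (c := c)
      (r := fun k y => ∑ j, |pd j (Z k) y - zd j y|) (fun k => ?_) (fun k x hx => ?_)
      (fun k y hy => ?_) ?_
    · exact aestronglyMeasurable_vnorm_cutoff hG hχ (hv k)
    · rw [grad_eq_zero (hvout k x hx), grad_eq_zero (hχout x hx),
        image_eq_zero_of_notMem_tsupport (hχout x hx)]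
      simp [vnorm]
    · rw [abs_of_nonneg (show 0 ≤ vnorm g _ _ from Real.sqrt_nonneg _)]
      refine (hc y hy _).trans_eq ?_
      rw [abs_of_nonneg (Finset.sum_nonneg fun j _ => abs_nonneg _)]
      congr 1
      refine Finset.sum_congr rfl fun j _ => ?_
      congr 1
      refine (hcov k j y).trans ?_
      rw [hcovv k j y (hKKΩ hy), hcovχ j y (hKKΩ hy), hχK y (hKKΩ hy)]
      simp only [hzddef, hUdef]
      ring
    · have hlim := tendsto_finsetSum Finset.univ fun j (_ : j ∈ Finset.univ) => hZ1 j
      simp only [Finset.sum_const_zero] at hlim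
      refine tendsto_of_tendsto_of_tendsto_of_le_of_le tendsto_const_nhds hlim
        (fun _ => zero_le) fun k => ?_
      have hsum : (fun y => ∑ j, |pd j (Z k) y - zd j y|)
          = ∑ j, fun y => ‖pd j (Z k) y - zd j y‖ := by
        ext y
        simp
      simp only [hsum]
      refine (eLpNorm_sum_le (fun j _ => ?_) (by norm_num)).trans_eq
        (Finset.sum_congr rfl fun j _ => eLpNorm_norm _)
      exact ((contDiff_pd j (hZ k)).continuous.aestronglyMeasurable.sub (hzd j).1).norm
  · obtain ⟨c, hc⟩ := hKK.exists_bound_of_continuousOn (f := fun y => (density g p y)⁻¹)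
      ((contDiffOn_density.continuousOn.inv₀ fun y hy => (density_pos hy).ne').mono hKKΩ)
    refine tendsto_eLpNorm_vol hKK hKKΩ (c := c) (fun k => ?_) (fun k x hx => ?_)
      (fun k y hy => ?_) hZ2
    · exact aestronglyMeasurable_lap_cutoff hu.1 hG hF.1 hχ (hv k)
    · rw [lap_eq_zero (hvout k x hx), lap_eq_zero (hχout x hx), grad_eq_zero (hχout x hx),
        image_eq_zero_of_notMem_tsupport (hχout x hx), map_zero]
      simp
    · have hyΩ := hKKΩ hy
      have hd := density_pos (g := g) hyΩ
      -- the divergence form of the Laplacian of a function of the coordinates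
      have hdiv : ∀ f : E m → ℝ, ContDiff ℝ ∞ f →
          ∑ i, pd i (fun y => ∑ j, a i j y * pd j f y) y = density g p y * lapC g p f y := by
        intro f hf
        rw [lapC, ← sum_pd_density_mul hyΩ fun i => (contDiffOn_gradC hf.contDiffOn i).diffAt hyΩ]
        refine Finset.sum_congr rfl fun i _ => ?_
        congr 1
        ext w
        simp only [hadef, gradC, Finset.mul_sum, mul_assoc]
      have hBy : ∀ i, B i y = density g p y * gradC g p θ i y := fun i => by
        simp only [hBdef, hadef, gradC, Finset.mul_sum, mul_assoc]
      have e1 : lap g (ofChart m p (Z k)) (param m p y) = lapC g p (Z k) y := by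
        rw [lap_param (hv k) hyΩ, lapC_congr (hvK k) hyΩ]
      have e2 : lap g χ (param m p y) = lapC g p θ y := by
        rw [lap_param hχ hyΩ, lapC_congr hχK hyΩ]
      have e3 : g.inner (param m p y) (grad g χ (param m p y)) (G (param m p y))
          = ∑ i, gradC g p θ i y * cov g p G i y := by
        rw [inner_grad_param (hχ.of_le (by simp)) hyΩ]
        exact Finset.sum_congr rfl fun i _ => by rw [gradC_congr hχK hyΩ]
      have e4 : h y = density g p y * (θ y * F (param m p y)
          + 2 * ∑ i, gradC g p θ i y * cov g p G i y + U y * lapC g p θ y) := by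
        have e5 : ∑ i, pd i (B i) y = density g p y * lapC g p θ y := hdiv θ hθ
        simp only [hhdef]
        rw [e5]
        simp only [hHdef, hBy, mul_add, Finset.mul_sum]
        congr 1
        · congr 1
          · ring
          · exact Finset.sum_congr rfl fun i _ => by ring
        · ring
      rw [e1, e2, e3, hχK y hyΩ, hdiv (Z k) (hZ k), e4, ← mul_sub, abs_mul, abs_of_pos hd,
        ← mul_assoc]
      refine le_mul_of_one_le_left (abs_nonneg _) ?_
      have h1 := mul_le_mul_of_nonneg_right ((le_abs_self _).trans (hc y hy)) hd.le
      rwa [inv_mul_cancel₀ hd.ne'] at h1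

end Approximation

/-! ### Smooth approximation of weak solutions -/

section GlobalApproximation

open Set Filter

variable {m : ℕ} {N : Type*} [TopologicalSpace N]
  [ChartedSpace (EuclideanSpace ℝ (Fin m)) N] [IsManifold (𝓡 m) ∞ N]
  {g : Metric m N} {p : N} {y : E m} {x : N} {ι : Type*}

lemma grad_sum_eq (s : Finset ι) {h : ι → N → ℝ}
    (hh : ∀ a ∈ s, ContMDiff (𝓡 m) 𝓘(ℝ) 1 (h a)) (x : N) :
    grad g (fun z => ∑ a ∈ s, h a z) x = ∑ a ∈ s, grad g (h a) x := by
  refine inner_ext (g := g) fun z => ?_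
  rw [grad_sum s hh, map_sum, _root_.sum_apply]

lemma gradC_sum (s : Finset ι) {f : ι → E m → ℝ}
    (hf : ∀ a, DifferentiableAt ℝ (f a) y) (i : Fin m) :
    gradC g p (fun z => ∑ a ∈ s, f a z) i y = ∑ a ∈ s, gradC g p (f a) i y := by
  simp only [gradC, pd_sum s _ fun a _ => hf a, Finset.mul_sum]
  exact Finset.sum_comm

lemma lapC_sum (s : Finset ι) {f : ι → E m → ℝ}
    (hf : ∀ a, ContDiffOn ℝ ∞ (f a) (coordDomain m p)) (hy : y ∈ coordDomain m p) :
    lapC g p (fun z => ∑ a ∈ s, f a z) y = ∑ a ∈ s, lapC g p (f a) y := by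
  have h1 : ∀ i, ∀ z ∈ coordDomain m p, gradC g p (fun z => ∑ a ∈ s, f a z) i z
      = ∑ a ∈ s, gradC g p (f a) i z := fun i z hz => gradC_sum s (fun a => (hf a).diffAt hz) i
  have h2 : ∀ i, pd i (gradC g p (fun z => ∑ a ∈ s, f a z) i) y
      = ∑ a ∈ s, pd i (gradC g p (f a) i) y := fun i => by
    rw [pd_congr_on i (isOpen_coordDomain p) hy (h1 i),
      pd_sum s i fun a _ => (contDiffOn_gradC (hf a) i).diffAt hy]
  simp only [lapC, divC, h2, h1 _ y hy, Finset.mul_sum, Finset.sum_add_distrib]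
  congr 1
  · exact Finset.sum_comm
  · rw [Finset.sum_congr rfl fun i _ => Finset.sum_comm, Finset.sum_comm]

lemma lap_sum (s : Finset ι) {h : ι → N → ℝ} (hh : ∀ a, ContMDiff (𝓡 m) 𝓘(ℝ) ∞ (h a)) (x : N) :
    lap g (fun z => ∑ a ∈ s, h a z) x = ∑ a ∈ s, lap g (h a) x :=
  lapC_sum s (fun a => contDiffOn_comp_param (hh a) le_rfl x) (coord_mem (mem_chartDomain x))

variable [T2Space N] [CompactSpace N] [MeasurableSpace N] [BorelSpace N] {u F : N → ℝ}
  {G : ∀ x : N, TangentSpace (𝓡 m) x}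

lemma tendsto_eLpNorm_of_le_sum [Fintype ι] {X : Type*} [MeasurableSpace X] {ν : Measure X}
    {f : ℕ → X → ℝ} {r : ι → ℕ → X → ℝ} (hr : ∀ a k, AEStronglyMeasurable (r a k) ν)
    (hf : ∀ k x, |f k x| ≤ ∑ a, |r a k x|)
    (hlim : ∀ a, Tendsto (fun k => eLpNorm (r a k) 2 ν) atTop (nhds 0)) :
    Tendsto (fun k => eLpNorm (f k) 2 ν) atTop (nhds 0) := by
  have hl := tendsto_finsetSum Finset.univ fun a (_ : a ∈ Finset.univ) => hlim a
  simp only [Finset.sum_const_zero] at hl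
  refine tendsto_of_tendsto_of_tendsto_of_le_of_le tendsto_const_nhds hl (fun _ => zero_le)
    fun k => ?_
  refine (eLpNorm_mono_real (g := ∑ a, fun x => ‖r a k x‖) fun x => ?_).trans
    ((eLpNorm_sum_le (fun a _ => (hr a k).norm) (by norm_num)).trans_eq
      (Finset.sum_congr rfl fun a _ => eLpNorm_norm _))
  simpa using hf k x

/-- A weak solution `u` of `Δu = F` with `F` square integrable is the limit of smooth functions
in the graph norm of the Laplacian. This replaces elliptic regularity of `u`. -/
theorem exists_smooth_approx (hu : MemLp u 2 (vol g)) (hG : HasWeakGradient g u G)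
    (hGi : Integrable (fun x => g.inner x (G x) (G x)) (vol g)) (hF : MemLp F 2 (vol g))
    (hweak : ∀ φ : N → ℝ, ContMDiff (𝓡 m) 𝓘(ℝ) ∞ φ →
      ∫ x, g.inner x (grad g φ x) (G x) ∂vol g = -∫ x, F x * φ x ∂vol g) :
    ∃ v : ℕ → N → ℝ, (∀ k, ContMDiff (𝓡 m) 𝓘(ℝ) ∞ (v k)) ∧
      Tendsto (fun k => eLpNorm (fun x => v k x - u x) 2 (vol g)) atTop (nhds 0) ∧
      Tendsto (fun k => eLpNorm (fun x => vnorm g x (grad g (v k) x - G x)) 2 (vol g))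
        atTop (nhds 0) ∧
      Tendsto (fun k => eLpNorm (fun x => lap g (v k) x - F x) 2 (vol g)) atTop (nhds 0) := by
  obtain ⟨t, χ, hχ, hχs, hχ1⟩ := exists_partition_of_unity m N
  choose v hv h1 h2 h3 using fun a : t =>
    exists_smooth_approx_chart (p := (a : N)) hu hG hGi hF hweak (hχ a) (hχs a)
  -- the terms with derivatives of the cut-off functions cancel in the sum, since `∑ χ = 1`
  have hgχ : ∀ x, ∑ a, grad g (χ a) x = 0 := by
    intro x
    rw [← grad_sum_eq Finset.univ (fun a _ => (hχ a).of_le (by simp)) x]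
    simp only [hχ1]
    refine inner_ext (g := g) fun z => ?_
    rw [inner_grad, mfderiv_const, map_zero]
    rfl
  have hlχ : ∀ x, ∑ a, lap g (χ a) x = 0 := by
    intro x
    rw [← lap_sum Finset.univ hχ x]
    have hg : ∀ i, gradC g x (fun _ : E m => (1 : ℝ)) i = fun _ => 0 := fun i => by
      ext z
      simp [gradC, pd]
    rw [funext hχ1]
    simp [lap, lapC, divC, hg, pd]
  refine ⟨fun k x => ∑ a, v a k x, fun k => contMDiff_finsetSum fun a _ => hv a k, ?_, ?_, ?_⟩
  · refine tendsto_eLpNorm_of_le_sum (r := fun a k x => v a k x - χ a x * u x)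
      (fun a k => (hv a k).continuous.aestronglyMeasurable.sub
        ((hχ a).continuous.aestronglyMeasurable.mul hu.1)) (fun k x => ?_) h1
    refine le_trans (le_of_eq ?_) (Finset.abs_sum_le_sum_abs _ _)
    rw [Finset.sum_sub_distrib, ← Finset.sum_mul, hχ1, one_mul]
  · refine tendsto_eLpNorm_of_le_sum
      (fun a k => aestronglyMeasurable_vnorm_cutoff hG (hχ a) (hv a k)) (fun k x => ?_) h2
    have hdec : grad g (fun x => ∑ a, v a k x) x - G x
        = ∑ a, (grad g (v a k) x - (χ a x • G x + u x • grad g (χ a) x)) := by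
      rw [grad_sum_eq Finset.univ (fun a _ => (hv a k).of_le (by simp)) x, Finset.sum_sub_distrib,
        Finset.sum_add_distrib, ← Finset.sum_smul, ← Finset.smul_sum, hχ1, hgχ, one_smul,
        smul_zero, add_zero]
    rw [hdec, abs_of_nonneg (show 0 ≤ vnorm g _ _ from Real.sqrt_nonneg _)]
    refine (vnorm_sum_le _ x _).trans (Finset.sum_le_sum fun a _ => le_abs_self _)
  · refine tendsto_eLpNorm_of_le_sum
      (fun a k => aestronglyMeasurable_lap_cutoff hu.1 hG hF.1 (hχ a) (hv a k)) (fun k x => ?_) h3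
    refine le_trans (le_of_eq ?_) (Finset.abs_sum_le_sum_abs _ _)
    have hin : ∑ a, 2 * g.inner x (grad g (χ a) x) (G x) = 0 := by
      have h := congrArg (fun w => g.inner x w (G x)) (hgχ x)
      simp only [map_sum, _root_.sum_apply, map_zero, _root_.zero_apply] at h
      rw [← Finset.mul_sum, h, mul_zero]
    rw [lap_sum Finset.univ (fun a => hv a k), Finset.sum_sub_distrib, Finset.sum_add_distrib,
      Finset.sum_add_distrib, hin, ← Finset.sum_mul, ← Finset.mul_sum, hχ1, hlχ]
    ring_nf

end GlobalApproximation

/-! ### Vanishing of the gradient -/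

section Vanishing

open Set Filter

/-- Integrals of products are continuous with respect to `L²` convergence of the factors. -/
lemma tendsto_integral_mul {X : Type*} [MeasurableSpace X] {ν : Measure X} {α β : ℕ → X → ℝ}
    {a b : X → ℝ} (hα : ∀ k, MemLp (α k) 2 ν) (hβ : ∀ k, MemLp (β k) 2 ν) (ha : MemLp a 2 ν)
    (hb : MemLp b 2 ν) (h1 : Tendsto (fun k => eLpNorm (fun x => α k x - a x) 2 ν) atTop (nhds 0))
    (h2 : Tendsto (fun k => eLpNorm (fun x => β k x - b x) 2 ν) atTop (nhds 0)) :
    Tendsto (fun k => ∫ x, α k x * β k x ∂ν) atTop (nhds (∫ x, a x * b x ∂ν)) := by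
  have key : ∀ {f h : X → ℝ} (hf : MemLp f 2 ν) (hh : MemLp h 2 ν),
      ∫ x, f x * h x ∂ν = inner ℝ (hh.toLp h) (hf.toLp f) := by
    intro f h hf hh
    rw [L2.inner_def]
    refine integral_congr_ae ?_
    filter_upwards [hf.coeFn_toLp, hh.coeFn_toLp] with x e1 e2
    rw [e1, e2]
    simp
  simp only [key (hα _) (hβ _), key ha hb]
  exact ((Lp.tendsto_Lp_iff_tendsto_eLpNorm'' β hβ b hb).2 h2).inner
    ((Lp.tendsto_Lp_iff_tendsto_eLpNorm'' α hα a ha).2 h1)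

variable {m : ℕ} {N : Type*} [TopologicalSpace N]
  [ChartedSpace (EuclideanSpace ℝ (Fin m)) N] [IsManifold (𝓡 m) ∞ N]
  {g : Metric m N}

lemma inner_self_le (x : N) (v w : TangentSpace (𝓡 m) x) :
    g.inner x v v ≤ 2 * g.inner x (v - w) (v - w) + 2 * g.inner x w w := by
  have h := inner_self_nonneg (g := g) x (v - (2 : ℝ) • w)
  simp only [map_sub, map_smul, _root_.sub_apply, _root_.smul_apply, smul_eq_mul,
    g.symm x w v] at h ⊢
  linarith

lemma gradInner_comp_left {f : ℝ → ℝ} {h : N → ℝ} (hf : ContDiff ℝ 1 f)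
    (hh : ContMDiff (𝓡 m) 𝓘(ℝ) ∞ h) (x : N) :
    gradInner g (fun x => f (h x)) h x = deriv f (h x) * gradInner g h h x := by
  obtain ⟨p, y, hy, rfl⟩ : ∃ p, ∃ y ∈ coordDomain m p, param m p y = x :=
    ⟨x, _, coord_mem (mem_chartDomain x), param_coord (mem_chartDomain x)⟩
  have hh1 : ContMDiff (𝓡 m) 𝓘(ℝ) 1 h := hh.of_le (by simp)
  have hfh : ContMDiff (𝓡 m) 𝓘(ℝ) 1 fun x => f (h x) := hf.contMDiff.comp hh1
  rw [gradInner_param hfh hh1 hy, gradInner_param hh1 hh1 hy, Finset.mul_sum]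
  refine Finset.sum_congr rfl fun k _ => ?_
  rw [pd_comp (f := fun y => h (param m p y)) k (hf.differentiable (by simp) _).hasDerivAt
    ((contDiffOn_comp_param hh le_rfl p).diffAt hy)]
  ring

variable [T2Space N] [CompactSpace N] [MeasurableSpace N] [BorelSpace N] {u : N → ℝ}
  {G : ∀ x : N, TangentSpace (𝓡 m) x} {f : ℝ → ℝ} {K : ℝ}

lemma memLp_comp_of_deriv_le (hf : ContDiff ℝ 1 f) (hK : ∀ s, |deriv f s| ≤ K)
    (hu : MemLp u 2 (vol g)) : MemLp (fun x => f (u x)) 2 (vol g) := by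
  have hL : ∀ s t, |f s - f t| ≤ K * |s - t| := fun s t =>
    convex_univ.norm_image_sub_le_of_norm_deriv_le (f := f) (fun x _ =>
      hf.differentiable (by simp) x) (fun x _ => hK x) (mem_univ t) (mem_univ s)
  have h1 : MemLp (fun x => f (u x) - f 0) 2 (vol g) := by
    refine MemLp.of_le_mul (c := K) hu ((hf.continuous.comp_aestronglyMeasurable hu.1).sub
      aestronglyMeasurable_const) (Filter.Eventually.of_forall fun x => ?_)
    simpa using hL (u x) 0
  refine (h1.add (memLp_const (f 0))).ae_eq (Filter.Eventually.of_forall fun x => ?_)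
  simp

/-- **The rigidity argument.** For a weak solution of `Δu = f(u)`, stability and the Bochner
inequality give `κ ∫ |∇u|² ≤ ∫ (Δu)² + ∫ f'(u) |∇u|²`, and the right side vanishes because
`∫ (Δu)² = ∫ f(u) Δu = -∫ f'(u) |∇u|²` by Green's formula. As `u` is not known to be smooth, both
steps are carried out for smooth functions `v` approximating `u` in the graph norm of the Laplacian,
but with the weight `f'(u)` in the first one. -/
theorem weakGradient_eq_zero (hf : ContDiff ℝ 1 f) (hK : ∀ s, |deriv f s| ≤ K)
    (hRic : PositiveRicci g) (hu : MemLp u 2 (vol g)) (hG : HasWeakGradient g u G)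
    (hGi : Integrable (fun x => g.inner x (G x) (G x)) (vol g))
    (hweak : ∀ φ : N → ℝ, ContMDiff (𝓡 m) 𝓘(ℝ) ∞ φ →
      ∫ x, g.inner x (grad g φ x) (G x) ∂vol g = -∫ x, f (u x) * φ x ∂vol g)
    (hstab : ∀ φ : N → ℝ, ContMDiff (𝓡 m) 𝓘(ℝ) ∞ φ →
      0 ≤ ∫ x, gradInner g φ φ x ∂vol g + ∫ x, deriv f (u x) * φ x ^ 2 ∂vol g) :
    ∀ᵐ x ∂vol g, G x = 0 := by
  have hK0 : 0 ≤ K := (abs_nonneg _).trans (hK 0)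
  have hL : ∀ s t, |f s - f t| ≤ K * |s - t| := fun s t =>
    convex_univ.norm_image_sub_le_of_norm_deriv_le (f := f) (fun x _ =>
      hf.differentiable (by simp) x) (fun x _ => hK x) (mem_univ t) (mem_univ s)
  have hf' : Continuous (deriv f) := hf.continuous_deriv le_rfl
  have hFL : MemLp (fun x => f (u x)) 2 (vol g) := memLp_comp_of_deriv_le hf hK hu
  obtain ⟨κ, hκ0, hκ⟩ := exists_bochner hRic
  obtain ⟨v, hv, hv0, hv1, hv2⟩ := exists_smooth_approx hu hG hGi hFL hweak
  have hfu : AEStronglyMeasurable (fun x => deriv f (u x)) (vol g) :=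
    hf'.comp_aestronglyMeasurable hu.1
  have hvL : ∀ k, MemLp (v k) 2 (vol g) := fun k => (memW12_of_contMDiff (hv k)).1
  have hlL : ∀ k, MemLp (lap g (v k)) 2 (vol g) := fun k =>
    (memW12_of_contMDiff (contMDiff_lap (hv k))).1
  have hfvL : ∀ k, MemLp (fun x => f (v k x)) 2 (vol g) := fun k =>
    memLp_comp_of_deriv_le hf hK (hvL k)
  have ie : ∀ k, Integrable (gradInner g (v k) (v k)) (vol g) := fun k =>
    (contMDiff_gradInner (hv k) (hv k)).continuous.integrable_vol
  -- the error in the gradient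
  set n : ℕ → N → ℝ := fun k x => vnorm g x (grad g (v k) x - G x) with hn
  have hnsq : ∀ k x, n k x * n k x = g.inner x (grad g (v k) x - G x) (grad g (v k) x - G x) :=
    fun k x => by rw [← pow_two]; exact vnorm_sq x _
  have hnm : ∀ k, AEStronglyMeasurable (n k) (vol g) := by
    intro k
    have h := aestronglyMeasurable_vnorm_cutoff (g := g) hG (χ := fun _ => 1) contMDiff_const (hv k)
    have h0 : ∀ x, grad g (fun _ : N => (1 : ℝ)) x = 0 := fun x =>
      inner_ext (g := g) fun z => by
        rw [inner_grad, mfderiv_const, map_zero]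
        rfl
    simpa only [h0, smul_zero, add_zero, one_smul] using h
  have hnL : ∀ k, MemLp (n k) 2 (vol g) := by
    intro k
    refine (memLp_two_iff_integrable_sq (hnm k)).2 (Integrable.mono'
      (((ie k).const_mul 2).add (hGi.const_mul 2)) ((hnm k).pow 2)
      (Filter.Eventually.of_forall fun x => ?_))
    have h := inner_self_le (g := g) x (grad g (v k) x - G x) (-G x)
    rw [Real.norm_eq_abs, abs_of_nonneg (sq_nonneg _), pow_two, hnsq]
    simpa [gradInner] using h
  have hn0 : Tendsto (fun k => ∫ x, n k x * n k x ∂vol g) atTop (nhds 0) := by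
    have := tendsto_integral_mul (a := fun _ => 0) (b := fun _ => 0) hnL hnL (by simp) (by simp)
      (by simpa using hv1) (by simpa using hv1)
    simpa using this
  have inn : ∀ k, Integrable (fun x => n k x * n k x) (vol g) := fun k =>
    (hnL k).integrable_mul (hnL k)
  -- the equation holds approximately
  have hfv : Tendsto (fun k => eLpNorm (fun x => f (v k x) - f (u x)) 2 (vol g)) atTop
      (nhds 0) := by
    have hl := ENNReal.Tendsto.const_mul hv0 (Or.inr (ENNReal.ofReal_ne_top (r := K)))
    simp only [mul_zero] at hl
    exact tendsto_of_tendsto_of_tendsto_of_le_of_le tendsto_const_nhds hl (fun _ => zero_le)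
      fun k => eLpNorm_le_mul_eLpNorm_of_ae_le_mul
        (Filter.Eventually.of_forall fun x => hL (v k x) (u x)) 2
  have hI : Tendsto (fun k => ∫ x, (lap g (v k) x - f (v k x)) * lap g (v k) x ∂vol g) atTop
      (nhds 0) := by
    have hd : Tendsto (fun k => eLpNorm (fun x => lap g (v k) x - f (v k x) - 0) 2 (vol g))
        atTop (nhds 0) := by
      have hl := hv2.add hfv
      simp only [add_zero] at hl
      refine tendsto_of_tendsto_of_tendsto_of_le_of_le tendsto_const_nhds hl (fun _ => zero_le)
        fun k => ?_
      refine le_trans (le_of_eq ?_) (eLpNorm_sub_le ((hlL k).sub hFL).1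
        ((hfvL k).sub hFL).1 (by norm_num))
      congr 1
      ext x
      simp
    have := tendsto_integral_mul (fun k => (hlL k).sub (hfvL k)) hlL (MemLp.zero' (p := 2)) hFL
      hd hv2
    simpa using this
  obtain ⟨ns, hns, hae⟩ := (tendstoInMeasure_of_tendsto_eLpNorm (p := 2) (by norm_num)
    (fun k => (hvL k).1) hu.1 hv0).exists_seq_tendsto_ae
  have hGm := hGi.1
  have iD : ∀ k, Integrable (fun x => |deriv f (u x) - deriv f (v k x)| * g.inner x (G x) (G x))
      (vol g) := fun k =>
    hGi.bdd_mul (c := K + K) ((hfu.sub (hf'.comp (hv k).continuous).aestronglyMeasurable).norm)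
      (Filter.Eventually.of_forall fun x => by
        rw [Real.norm_eq_abs, abs_abs]
        exact (abs_sub _ _).trans (add_le_add (hK _) (hK _)))
  -- along a subsequence converging almost everywhere the weights `f'(v)` approach `f'(u)`
  have hD : Tendsto (fun k => ∫ x, |deriv f (u x) - deriv f (v (ns k) x)| * g.inner x (G x) (G x)
      ∂vol g) atTop (nhds 0) := by
    have h := tendsto_integral_of_dominated_convergence (μ := vol g) (f := fun _ => (0 : ℝ))
      (F := fun k x => |deriv f (u x) - deriv f (v (ns k) x)| * g.inner x (G x) (G x))
      (fun x => (K + K) * g.inner x (G x) (G x)) (fun k => (iD (ns k)).1) (hGi.const_mul _)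
      (fun k => Filter.Eventually.of_forall fun x => ?_) ?_
    · simpa using h
    · have hG0 := inner_self_nonneg (g := g) x (G x)
      rw [Real.norm_eq_abs, abs_mul, abs_abs, abs_of_nonneg hG0]
      exact mul_le_mul_of_nonneg_right ((abs_sub _ _).trans (add_le_add (hK _) (hK _))) hG0
    · filter_upwards [hae] with x hx
      have h1 := (hf'.tendsto (u x)).comp hx
      have h2 := ((tendsto_const_nhds (x := deriv f (u x))).sub h1).abs.mul_const
        (g.inner x (G x) (G x))
      simpa using h2
  -- all three terms on the right tend to zero
  have key : ∀ k, κ * ∫ x, g.inner x (G x) (G x) ∂vol g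
      ≤ (2 * κ + 8 * K) * (∫ x, n k x * n k x ∂vol g)
        + 2 * (∫ x, (lap g (v k) x - f (v k x)) * lap g (v k) x ∂vol g)
        + 4 * ∫ x, |deriv f (u x) - deriv f (v k x)| * g.inner x (G x) (G x) ∂vol g := by
    intro k
    have hfvk : AEStronglyMeasurable (fun x => deriv f (v k x)) (vol g) :=
      (hf'.comp (hv k).continuous).aestronglyMeasurable
    have iu : Integrable (fun x => deriv f (u x) * gradInner g (v k) (v k) x) (vol g) :=
      (ie k).bdd_mul (c := K) hfu (Filter.Eventually.of_forall fun x => hK _)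
    have iv : Integrable (fun x => deriv f (v k x) * gradInner g (v k) (v k) x) (vol g) :=
      (ie k).bdd_mul (c := K) hfvk (Filter.Eventually.of_forall fun x => hK _)
    -- `κ ∫ |∇v|² ≤ ∫ (Δv)² + ∫ f'(u) |∇v|²`
    have h1 := integral_lap_sq_of_stable (q := fun x => deriv f (u x)) hκ (fun F hF =>
      hF.integrable_vol.bdd_mul (c := K) hfu (Filter.Eventually.of_forall fun x => hK _)) hstab
      (hv k)
    have h2 : ∫ x, f (v k x) * lap g (v k) x ∂vol g
        + ∫ x, deriv f (v k x) * gradInner g (v k) (v k) x ∂vol g = 0 := by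
      have hfk : ContMDiff (𝓡 m) 𝓘(ℝ) 1 fun x => f (v k x) :=
        hf.contMDiff.comp ((hv k).of_le (by simp))
      rw [green hfk (hv k)]
      simp only [gradInner_comp_left hf (hv k)]
      ring
    have h3 : ∫ x, (lap g (v k) x - f (v k x)) * lap g (v k) x ∂vol g
        = ∫ x, lap g (v k) x ^ 2 ∂vol g - ∫ x, f (v k x) * lap g (v k) x ∂vol g := by
      have i1 : Integrable (fun x => f (v k x) * lap g (v k) x) (vol g) :=
        (hfvL k).integrable_mul (hlL k)
      rw [← integral_sub (hlL k).integrable_sq i1]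
      exact integral_congr_ae (Filter.Eventually.of_forall fun x => by ring)
    have h4 : ∫ x, deriv f (u x) * gradInner g (v k) (v k) x ∂vol g
        - ∫ x, deriv f (v k x) * gradInner g (v k) (v k) x ∂vol g
        ≤ 4 * K * (∫ x, n k x * n k x ∂vol g)
          + 2 * ∫ x, |deriv f (u x) - deriv f (v k x)| * g.inner x (G x) (G x) ∂vol g := by
      rw [← integral_sub iu iv, ← integral_const_mul, ← integral_const_mul,
        ← integral_add ((inn k).const_mul _) ((iD k).const_mul _)]
      refine integral_mono (iu.sub iv) (((inn k).const_mul _).add ((iD k).const_mul _))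
        fun x => ?_
      have e1 := inner_self_le (g := g) x (grad g (v k) x) (G x)
      rw [← hnsq] at e1
      have e2 := abs_nonneg (deriv f (u x) - deriv f (v k x))
      have e3 : |deriv f (u x) - deriv f (v k x)| ≤ K + K :=
        (abs_sub _ _).trans (add_le_add (hK _) (hK _))
      have e4 := mul_le_mul_of_nonneg_right (le_abs_self (deriv f (u x) - deriv f (v k x)))
        (gradInner_self_nonneg (g := g) (v k) x)
      have e5 := mul_le_mul_of_nonneg_left e1 e2
      have e6 := mul_le_mul_of_nonneg_right e3 (mul_self_nonneg (n k x))
      simp only [gradInner] at e4 ⊢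
      linarith
    have h5 : ∫ x, g.inner x (G x) (G x) ∂vol g
        ≤ 2 * (∫ x, n k x * n k x ∂vol g) + 2 * ∫ x, gradInner g (v k) (v k) x ∂vol g := by
      rw [← integral_const_mul, ← integral_const_mul,
        ← integral_add ((inn k).const_mul _) ((ie k).const_mul _)]
      refine integral_mono hGi (((inn k).const_mul _).add ((ie k).const_mul _)) fun x => ?_
      have e1 := inner_self_le (g := g) x (G x) (grad g (v k) x)
      have e2 : g.inner x (G x - grad g (v k) x) (G x - grad g (v k) x) = n k x * n k x := by
        rw [hnsq]
        simp only [map_sub, _root_.sub_apply]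
        ring
      rw [e2] at e1
      exact e1
    have h6 := mul_le_mul_of_nonneg_left h5 hκ0.le
    linarith
  have hlim := ((hn0.comp hns.tendsto_atTop).const_mul (2 * κ + 8 * K)).add
    ((hI.comp hns.tendsto_atTop).const_mul 2) |>.add (hD.const_mul 4)
  simp only [mul_zero, add_zero] at hlim
  have hle : κ * ∫ x, g.inner x (G x) (G x) ∂vol g ≤ 0 := ge_of_tendsto' hlim fun k => key (ns k)
  have hle' : ∫ x, g.inner x (G x) (G x) ∂vol g = 0 :=
    le_antisymm (not_lt.1 fun h => absurd hle (not_le.2 (mul_pos hκ0 h)))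
      (integral_nonneg fun x => inner_self_nonneg x _)
  have h0 := (integral_eq_zero_iff_of_nonneg (fun x => inner_self_nonneg x _) hGi).1 hle'
  filter_upwards [h0] with x hx
  by_contra hne
  exact (g.pos x _ hne).ne' hx

end Vanishing

/-! ### Functions with vanishing weak gradient -/

section Constancy

open Set Filter

/-- A square integrable function with vanishing weak derivatives on a ball is constant on the
concentric ball of half the radius: its mollifications are. -/
lemma exists_ae_eq_const_of_weak {m : ℕ} {z : E m → ℝ} (hz : MemLp z 2 volume) {y₀ : E m} {r : ℝ}
    (hr : 0 < r)
    (hw : ∀ ψ : E m → ℝ, ContDiff ℝ ∞ ψ → HasCompactSupport ψ →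
      tsupport ψ ⊆ Metric.closedBall y₀ (2 * r) → ∀ i, ∫ y, z y * pd i ψ y = 0) :
    ∃ c : ℝ, ∀ᵐ y, y ∈ Metric.ball y₀ r → z y = c := by
  set δ : ℕ → ℝ := fun k => r * (1 / ((k : ℝ) + 1)) with hδdef
  have hδ : ∀ k, 0 < δ k := fun k => by positivity
  have hδr : ∀ k, δ k ≤ r := fun k => by
    refine mul_le_of_le_one_right hr.le ?_
    rw [div_le_one (by positivity)]
    linarith [(Nat.cast_nonneg k : (0 : ℝ) ≤ k)]
  have hδ0 : Tendsto δ atTop (nhds 0) := by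
    have h := (tendsto_one_div_add_atTop_nhds_zero_nat (𝕜 := ℝ)).const_mul r
    rwa [mul_zero] at h
  have hzl : LocallyIntegrable z := hz.locallyIntegrable (by norm_num)
  have hconst : ∀ k, ∀ x ∈ Metric.ball y₀ r, mollify (δ k) z x = mollify (δ k) z y₀ := by
    intro k x hx
    have hd := (contDiff_mollify (hδ k) hzl).differentiable (by simp)
    refine (convex_ball y₀ r).is_const_of_fderivWithin_eq_zero (𝕜 := ℝ) hd.differentiableOn
      (fun w hw' => ?_) hx (Metric.mem_ball_self hr)
    rw [fderivWithin_of_isOpen Metric.isOpen_ball hw']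
    ext e
    rw [fderiv_apply_eq_sum_pd]
    refine Finset.sum_eq_zero fun i _ => ?_
    have hsupp : tsupport (fun y => mollifier (δ k) (w - y)) ⊆ Metric.closedBall y₀ (2 * r) := by
      refine closure_minimal (fun y hy => ?_) Metric.isClosed_closedBall
      have h1 : ‖w - y‖ ≤ δ k := by
        by_contra! h
        exact hy (mollifier_eq_zero (hδ k) h)
      have h2 : dist y y₀ ≤ dist y w + dist w y₀ := dist_triangle _ _ _
      rw [dist_comm y w, dist_eq_norm w y] at h2
      have h3 : dist w y₀ < r := hw'
      have := hδr k
      exact Metric.mem_closedBall.2 (by linarith)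
    rw [pd_mollify_of_weak (z' := fun _ => 0) (hδ k) hzl i w]
    · simp [mollify]
    · rw [hw _ (contDiff_mollifier_sub w) (hasCompactSupport_mollifier_sub (hδ k) w) hsupp i]
      simp
  obtain ⟨ns, -, hns⟩ := (tendstoInMeasure_of_tendsto_eLpNorm (p := 2) (by norm_num)
    (fun k => (contDiff_mollify (hδ k) hzl).continuous.aestronglyMeasurable) hz.1
    (tendsto_eLpNorm_mollify hδ hδ0 hz)).exists_seq_tendsto_ae
  obtain ⟨w, hw1, hw2⟩ : ∃ w ∈ Metric.ball y₀ r,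
      Tendsto (fun k => mollify (δ (ns k)) z w) atTop (nhds (z w)) := by
    by_contra! h
    exact (Metric.isOpen_ball.measure_pos volume ⟨y₀, Metric.mem_ball_self hr⟩).ne'
      (measure_mono_null (fun w hw => h w hw) hns)
  refine ⟨z w, ?_⟩
  filter_upwards [hns] with y hy hyr
  refine tendsto_nhds_unique hy (hw2.congr fun k => ?_)
  rw [hconst _ w hw1, hconst _ y hyr]

variable {m : ℕ} {N : Type*} [TopologicalSpace N]
  [ChartedSpace (EuclideanSpace ℝ (Fin m)) N] [IsManifold (𝓡 m) ∞ N]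
  [MeasurableSpace N] [BorelSpace N] {g : Metric m N} {u : N → ℝ}
  {G : ∀ x : N, TangentSpace (𝓡 m) x}

/-- A function with vanishing weak gradient is constant near every point. -/
lemma exists_nhds_ae_eq_const (hu : MemLp u 2 (vol g)) (hG : HasWeakGradient g u G)
    (hG0 : ∀ᵐ x ∂vol g, G x = 0) (p : N) :
    ∃ c : ℝ, ∃ O : Set N, IsOpen O ∧ p ∈ O ∧ ∀ᵐ x ∂vol g, x ∈ O → u x = c := by
  have hΩ := isOpen_coordDomain (m := m) p
  have hp := mem_chartDomain (m := m) p
  obtain ⟨R, hR, hRΩ⟩ := Metric.nhds_basis_closedBall.mem_iff.1 (hΩ.mem_nhds (coord_mem hp))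
  set y₀ := coord m p p with hy₀
  set r := R / 2 with hrdef
  have hr : 0 < r := half_pos hR
  have h2r : 2 * r = R := by rw [hrdef]; ring
  set B := Metric.closedBall y₀ R with hB
  have hBc : IsCompact B := isCompact_closedBall _ _
  set z : E m → ℝ := B.indicator fun y => u (param m p y) with hz
  have hzL : MemLp z 2 volume := by
    rw [hz, memLp_indicator_iff_restrict hBc.measurableSet]
    refine (memLp_two_iff_integrable_sq ?_).2 ?_
    · exact ((hG p).1.integrableOn_compact_subset hRΩ hBc).1
    · exact (locallyIntegrableOn_param hu.integrable_sq p).integrableOn_compact_subset hRΩ hBc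
  have hcov : ∀ i, ∀ᵐ y, y ∈ coordDomain m p → cov g p G i y = 0 := fun i => by
    filter_upwards [ae_chart_of_ae_vol (p := p) g hG0] with y hy hyΩ
    rw [cov, hy hyΩ, map_zero]
    rfl
  obtain ⟨c, hc⟩ := exists_ae_eq_const_of_weak hzL (y₀ := y₀) hr fun ψ hψ hψc hψs i => by
    rw [h2r] at hψs
    have h1 : ∫ y, z y * pd i ψ y = ∫ y, u (param m p y) * pd i ψ y := by
      refine integral_congr_ae (Filter.Eventually.of_forall fun y => ?_)
      by_cases hy : y ∈ B
      · simp only [hz, indicator_of_mem hy]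
      · simp only [image_eq_zero_of_notMem_tsupport
          fun h => hy (hψs (tsupport_pd_subset i ψ h)), mul_zero]
    rw [h1, ((hG p).2 i).2 ψ hψ hψc (hψs.trans hRΩ), neg_eq_zero]
    refine integral_eq_zero_of_ae ?_
    filter_upwards [hcov i] with y hy
    by_cases hyΩ : y ∈ coordDomain m p
    · have h2 : g.inner (param m p y) (G (param m p y)) (coordVec m p y i) = 0 := hy hyΩ
      simp [h2]
    · have h2 : ψ y = 0 := image_eq_zero_of_notMem_tsupport fun h => hyΩ (hRΩ (hψs h))
      simp [h2]
  set O : Set N := chartDomain m p ∩ coord m p ⁻¹' Metric.ball y₀ r with hO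
  have hOo : IsOpen O := (contMDiffOn_coord p).continuousOn.isOpen_inter_preimage
    (isOpen_chartDomain p) Metric.isOpen_ball
  refine ⟨c, O, hOo, ⟨hp, Metric.mem_ball_self hr⟩, ?_⟩
  have hc' : ∀ᵐ y ∂coordMeasure g p, y ∈ Metric.ball y₀ r → z y = c :=
    (coordMeasure_ac g p).ae_le (ae_restrict_of_ae hc)
  rw [← map_coord_chartVolume] at hc'
  have h3 := ae_of_ae_map (aemeasurable_coord g p) hc'
  rw [← vol_restrict, ae_restrict_iff' (isOpen_chartDomain p).measurableSet] at h3
  filter_upwards [h3] with x hx hxO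
  have h4 := hx hxO.1 hxO.2
  rwa [hz, indicator_of_mem (Metric.ball_subset_closedBall.trans
    (Metric.closedBall_subset_closedBall (by linarith)) hxO.2), param_coord hxO.1] at h4

/-- A function with vanishing weak gradient on a connected manifold is constant: the points near
which it equals a given constant form an open and closed set. -/
theorem ae_eq_const_of_weakGradient_eq_zero [CompactSpace N] [ConnectedSpace N]
    (hu : MemLp u 2 (vol g)) (hG : HasWeakGradient g u G) (hG0 : ∀ᵐ x ∂vol g, G x = 0) :
    ∃ c : ℝ, u =ᵐ[vol g] fun _ => c := by
  set S : ℝ → Set N := fun c => {p | ∃ O : Set N, IsOpen O ∧ p ∈ O ∧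
    ∀ᵐ x ∂vol g, x ∈ O → u x = c} with hS
  have hcov : ∀ p, ∃ c, p ∈ S c := exists_nhds_ae_eq_const hu hG hG0
  have hSo : ∀ c, IsOpen (S c) := fun c => isOpen_iff_forall_mem_open.2
    fun p ⟨O, hO, hpO, h⟩ => ⟨O, fun q hq => ⟨O, hO, hq, h⟩, hO, hpO⟩
  have hdisj : ∀ p c c', p ∈ S c → p ∈ S c' → c = c' := by
    rintro p c c' ⟨O, hO, hpO, h⟩ ⟨O', hO', hpO', h'⟩
    by_contra hne
    refine (vol_pos_of_isOpen g (hO.inter hO') ⟨p, hpO, hpO'⟩).ne' ?_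
    refine measure_mono_null (fun x hx => ?_) (h.and h')
    exact fun hx' => hne ((hx'.1 hx.1).symm.trans (hx'.2 hx.2))
  obtain ⟨p₀⟩ : Nonempty N := inferInstance
  obtain ⟨c, hc⟩ := hcov p₀
  have hclopen : IsClopen (S c) := by
    refine ⟨⟨?_⟩, hSo c⟩
    have : (S c)ᶜ = ⋃ c' ∈ {c' | c' ≠ c}, S c' := by
      ext p
      simp only [mem_compl_iff, mem_iUnion, exists_prop]
      refine ⟨fun hp => ?_, fun ⟨c', hc', hp⟩ hp' => hc' (hdisj p c' c hp hp')⟩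
      obtain ⟨c', hc'⟩ := hcov p
      exact ⟨c', fun h => hp (h ▸ hc'), hc'⟩
    rw [this]
    exact isOpen_biUnion fun c' _ => hSo c'
  have huniv : S c = univ := hclopen.eq_univ ⟨p₀, hc⟩
  refine ⟨c, ?_⟩
  have hall : ∀ᵐ x ∂vol g, x ∈ (univ : Set N) → u x = c := by
    refine isCompact_univ.induction_on (p := fun s => ∀ᵐ x ∂vol g, x ∈ s → u x = c)
      (Filter.Eventually.of_forall fun x hx => hx.elim) (fun s t hst ht => ?_)
      (fun s t hs ht => ?_) fun p _ => ?_
    · filter_upwards [ht] with x hx hxs using hx (hst hxs)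
    · filter_upwards [hs, ht] with x h1 h2 hx using hx.elim h1 h2
    · obtain ⟨O, hO, hpO, h⟩ : p ∈ S c := huniv ▸ mem_univ p
      exact ⟨O, mem_nhdsWithin_of_mem_nhds (hO.mem_nhds hpO), h⟩
  filter_upwards [hall] with x hx using hx (mem_univ x)

end Constancy

end AllenCahn

end

theorem mainTheorem4 (n : ℕ) (hn : 2 ≤ n) {N : Type*} [TopologicalSpace N] [T2Space N]
    [CompactSpace N] [ConnectedSpace N] [MeasurableSpace N] [BorelSpace N]
    [ChartedSpace (EuclideanSpace ℝ (Fin (n + 1))) N] [IsManifold (𝓡 (n + 1)) ∞ N]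
    (g : AllenCahn.Metric (n + 1) N) (hRic : AllenCahn.PositiveRicci g)
    (W : ℝ → ℝ) (hW : AllenCahn.IsDoubleWell W) (ε : ℝ) (hε : 0 < ε) (μ : ℝ)
    (u : N → ℝ) (hcrit : AllenCahn.IsCriticalPoint g W ε μ u)
    (hstab : AllenCahn.IsStable g W ε μ u) :
    ∃ c : ℝ, u =ᵐ[AllenCahn.vol g] fun _ => c := by
  obtain ⟨hu, G, hG, hGi⟩ := hcrit.1
  obtain ⟨K, hK⟩ := hW.quadratic_growth
  refine AllenCahn.ae_eq_const_of_weakGradient_eq_zero hu hG ?_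
  refine AllenCahn.weakGradient_eq_zero (K := K / ε / ε)
    (AllenCahn.contDiff_nonlinearity hW.contDiff ε μ) (fun s => ?_) hRic hu hG hGi
    (fun φ hφ => hcrit.weak_equation hW hε hG hGi hφ)
    (fun φ hφ => hstab.nonneg hW hε hu hG hGi hφ)
  rw [(AllenCahn.deriv_nonlinearity W hW.contDiff ε μ s).deriv, abs_div, abs_div, abs_of_pos hε]
  have := hK s
  gcongr
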